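/- **Conventions.** Let $\langle x\rangle=(1+x^2)^{1/2}$, $\widehat f(\xi)=\int_{\mathbb R}e^{-ix\xi}f(x)\,dx$, and $\|f\|_{H^s}^2=\int|\widehat f(\xi)|^2\langle\xi\rangle^{2s}\,d\xi$. For a function $v(t,x)$ in $L^1(\mathbb R_t;L^2(\mathbb R_x))$ let $\widehat v(\xi,\tau)=\iint e^{-ix\xi}e^{-it\tau}v(t,x)\,dx\,dt$ and $$\|v\|_{X^{0,b}}^2=\iint|\widehat v(\xi,\tau)|^2\langle\tau+\xi^2\rangle^{2b}\,d\xi\,d\tau\in[0,\infty].$$ For $N\ge1$ let $P_{<N}$ be the Fourier projection in $x$ onto the frequencies $|\xi|\le N$, and for $\lambda>0$ let $T_\lambda u(t,x)=\lambda u(\lambda^2t,\lambda x)$. Fix $\eta\in C_0^\infty(\mathbb R)$ with $\eta(0)\neq0$, and for $-\tfrac12\le s\le 0$ put $$\|u\|_{Y^{s,b}}=\sup_{t_0\in\mathbb R}\ \sup_{N\ge1}\ \big\|\eta(t-t_0)\,T_{N^{2s}}(P_{<N}u)\big\|_{X^{0,b}}\in[0,\infty].$$ Fix $T>0$ and a smooth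 real-valued function $\zeta_0$ with $\zeta_0\equiv1$ on $[0,T]$ and support in $(-2T,2T)$. For $\omega=\pm1$ consider the Cauchy problem $$\text{(NLS*)}\qquad iu_t+u_{xx}+\zeta_0(t)\,\omega|u|^2u=0,\qquad u(0,x)=u_0(x),\qquad (t,x)\in\mathbb R\times\mathbb R .$$ **Proposition.** Let $-\tfrac2{15}<s\le0$ and $b\in(\tfrac12,1)$ satisfy $$-s<(1+4b)^{-1}\min\Big(\tfrac1{10}+\tfrac35(1-b),\ \tfrac1{12}+\tfrac23(1-b)\Big).$$ Then there is a constant $C<\infty$, depending only on $s$, $b$, $\eta$, $T$ and $\zeta_0$, such that for $\omega=\pm1$ and every $u_0$, every solution $u\in C^0(\mathbb R;H^{10}(\mathbb R))$ of (NLS*) with initial datum $u_0$, satisfying the equation in the classical sense, obeys $$\|u\|_{Y^{s,b}}\le C\,\big(\|u\|_{C^0([-2T,2T],H^s)}+\|u\|_{Y^{s,b}}^3\big).$$ -/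

import Mathlib

namespace NLS

open MeasureTheory FourierTransform
open scoped ENNReal

noncomputable section

/-- The Japanese bracket `⟨x⟩ = (1 + |x|²)^{1/2}`. -/
def bracket (x : ℝ) : ℝ := Real.sqrt (1 + x ^ 2)

/-- The class in `L²(ℝ; ℂ)` of a square integrable function (zero for other functions; below it is
only applied to square integrable ones). -/
def toL2 (f : ℝ → ℂ) : Lp ℂ 2 (volume : Measure ℝ) :=
  open Classical in if h : MemLp f 2 volume then h.toLp f else 0

/-- The spatial Fourier transform `f̂(ξ) = ∫ e^{-ixξ} f(x) dx` of `f ∈ L²(ℝ)`, in the sense of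
Plancherel. Mathlib's `𝓕` on `L²` has the kernel `e^{-2πixξ}`, whence the argument `ξ / (2π)`.
It is defined up to null sets. -/
def spaceFourier (f : ℝ → ℂ) (ξ : ℝ) : ℂ :=
  (𝓕 (toL2 f) : Lp ℂ 2 (volume : Measure ℝ)) (ξ / (2 * Real.pi))

/-- The Sobolev norm `‖f‖_{H^s} = (∫ |f̂(ξ)|² ⟨ξ⟩^{2s} dξ)^{1/2} ∈ [0,∞]` of `f ∈ L²(ℝ)`. -/
def sobolevNorm (s : ℝ) (f : ℝ → ℂ) : ℝ≥0∞ :=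
  (∫⁻ ξ : ℝ, ‖spaceFourier f ξ‖ₑ ^ 2 * ENNReal.ofReal (bracket ξ ^ (2 * s))) ^ (1 / 2 : ℝ)

/-- The space-time Fourier transform `v̂(ξ,τ) = ∬ e^{-ixξ} e^{-itτ} v(t,x) dx dt` of
`v ∈ L¹(ℝ_t; L²(ℝ_x))`: for each `τ` it is the `L²(ℝ_ξ)`-valued Bochner integral over `t` of
`e^{-itτ}` times the spatial Fourier transform of `v(t,·)`. -/
def spaceTimeFourier (v : ℝ → ℝ → ℂ) (ξ τ : ℝ) : ℂ :=
  (∫ t : ℝ, Complex.exp (-(Complex.I * t * τ)) •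
    (𝓕 (toL2 (v t)) : Lp ℂ 2 (volume : Measure ℝ))) (ξ / (2 * Real.pi))

/-- The Bourgain norm `‖v‖_{X^{r,b}} = (∬ |v̂(ξ,τ)|² ⟨τ+ξ²⟩^{2b} ⟨ξ⟩^{2r} dξ dτ)^{1/2} ∈ [0,∞]`
for `v ∈ L¹(ℝ_t; L²(ℝ_x))`. With the kernel `e^{-ixξ} e^{-itτ}`, solutions of `i v_t + v_xx = 0`
have their Fourier transform on the parabola `τ + ξ² = 0`. -/
def bourgainNorm (r b : ℝ) (v : ℝ → ℝ → ℂ) : ℝ≥0∞ :=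
  (∫⁻ τ : ℝ, ∫⁻ ξ : ℝ, ‖spaceTimeFourier v ξ τ‖ₑ ^ 2 *
    ENNReal.ofReal (bracket (τ + ξ ^ 2) ^ (2 * b) * bracket ξ ^ (2 * r))) ^ (1 / 2 : ℝ)

/-- The rough Littlewood-Paley projection `P_{<N}`, which restricts the spatial frequency to
`|ξ| ≤ N`. (Mathlib's frequency variable `y` corresponds to `ξ = 2πy`.) -/
def lowFreq (N : ℝ) (f : ℝ → ℂ) : ℝ → ℂ :=
  (𝓕⁻ (toL2 ({y : ℝ | |2 * Real.pi * y| ≤ N}.indicator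
    (𝓕 (toL2 f) : Lp ℂ 2 (volume : Measure ℝ)))) : Lp ℂ 2 (volume : Measure ℝ))

/-- The scaling operator `(T_lam u)(t,x) = lam · u(lam² t, lam x)`. -/
def scaling (lam : ℝ) (u : ℝ → ℝ → ℂ) : ℝ → ℝ → ℂ :=
  fun t x => (lam : ℂ) * u (lam ^ 2 * t) (lam * x)

/-- `‖u‖_{Y^{s,b}} = sup_{t₀ ∈ ℝ} sup_{N ≥ 1} ‖η(t - t₀) T_{N^{2s}} (P_{<N} u)‖_{X^{0,b}}`, with
values in `[0,∞]`, where `η` is the fixed cutoff function in time. -/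
def yNorm (η : ℝ → ℂ) (s b : ℝ) (u : ℝ → ℝ → ℂ) : ℝ≥0∞ :=
  ⨆ (t₀ : ℝ) (N : ℝ) (_ : 1 ≤ N),
    bourgainNorm 0 b
      (fun t x => η (t - t₀) * scaling (N ^ (2 * s)) (fun t' => lowFreq N (u t')) t x)

/-- `‖u‖_{C⁰(H^s)} = ‖u‖_{C⁰([-2T,2T], H^s)}`. -/
def c0SobolevNorm (T s : ℝ) (u : ℝ → ℝ → ℂ) : ℝ≥0∞ :=
  ⨆ t ∈ Set.Icc (-2 * T) (2 * T), sobolevNorm s (u t)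

/-- `u` is a smooth solution, defined for all times, of the Cauchy problem
`i u_t + u_xx + ζ₀(t) ω |u|² u = 0`, `u(0,·) = u₀`: it belongs to `C⁰(ℝ; H^{10}(ℝ))` and satisfies
the equation in the classical sense. -/
structure IsSmoothSolution (ω : ℝ) (ζ₀ : ℝ → ℝ) (u₀ : ℝ → ℂ) (u : ℝ → ℝ → ℂ) : Prop where
  contDiff_space : ∀ t, ContDiff ℝ 2 (u t)
  differentiable_time : ∀ x, Differentiable ℝ (fun t => u t x)
  memLp : ∀ t, MemLp (u t) 2 volume
  sobolevNorm_lt_top : ∀ t, sobolevNorm 10 (u t) < ∞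
  continuous_sobolev : ∀ t₀, Filter.Tendsto (fun t => sobolevNorm 10 (fun x => u t x - u t₀ x))
    (nhds t₀) (nhds 0)
  equation : ∀ t x, Complex.I * deriv (fun t' => u t' x) t + iteratedDeriv 2 (u t) x
    + (ζ₀ t : ℂ) * (ω : ℂ) * ((‖u t x‖ ^ 2 : ℝ) : ℂ) * u t x = 0
  initial : u 0 = u₀

end

end NLS

/-!
The unknown is studied in the interaction picture: `profile N U t` is the Fourier transform of
`u(t)` at the frequencies `|ξ| ≤ N` with the free evolution undone. By `bourgainNorm_sq` the
`X^{0,b}` norm of the localized, rescaled low frequencies is an `L²` norm of the time Fourier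
transform of the profile, localized to times of size `N^{4s}`, with a power of the modulation as
weight. By `IsSmoothSolution.hasDerivAt_profile` the time derivative of the profile is the low
frequency part of the nonlinearity. An integration by parts in time (`lintegral_localSpec_le`)
therefore bounds the norm by two terms.

* The linear term involves only the size of the profile. Since the profile is constant outside
  `[-2T, 2T]`, the norm in `C⁰([-2T, 2T], H^s)` controls it
  (`IsSmoothSolution.enorm_profile_sq_le`).
* The forcing term is measured with the dual weight `⟨·⟩^{2b-2}` (`exists_cubic_bound`).

For the forcing term, the `Y^{s,b}` norm is used at all frequencies `M ≳ N`. On time intervals of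
length comparable to `M^{4s}` it dominates the frequencies below `M`, in mean square, by a
superposition of free solutions with mass `M^{-2s} ‖u‖²_Y` (`exists_controlled`,
`exists_windowBound`). Bilinear and `L⁶` Strichartz estimates pass to such superpositions.
If frequencies near `M ≥ 16 N` interact into a frequency below `N`, then one of the three is far
from the output, and the two others are far from each other (`resonance_cases`,
`transversal_piece`). Two bilinear estimates thus gain a factor `M⁻¹` when the nonlinearity is
tested against a free solution, and one of them gains `(N/M)^{1/2}` in `L²`
(`Controlled.lowCubic_sub_le`).

With `μ = M/N`, a time interval of length `N^{4s}` is covered by about `μ^{-4s}` intervals of length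
`M^{4s}`. The first gain is used at modulations below `μ^{1+4s}`, the second one above
(`exists_cubic_step`). Both contribute a power `μ^{-(3 - 2b + (18 - 8b)s)}` to the square of the
norm, and in the given range of `s` and `b` the exponent is negative (`exponent_pos`), so that the
dyadic blocks can be summed. The interactions of frequencies comparable to `N` are bounded with the
`L⁶` estimate alone.
-/

namespace NLS

open MeasureTheory FourierTransform Filter Topology
open scoped ENNReal

noncomputable section

/-! ### The Fourier transform in `L²` -/

section

/-- The Hilbert space `L²(ℝ; ℂ)`. -/
abbrev L2 := Lp ℂ 2 (volume : Measure ℝ)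

section FourierConsistency

variable {F : Type*} [NormedAddCommGroup F] [InnerProductSpace ℂ F] [CompleteSpace F]

theorem integral_fourier_smul_eq {g : ℝ → ℂ} {f : ℝ → F} (hg : Integrable g) (hf : Integrable f) :
    ∫ x, 𝓕 g x • f x = ∫ x, g x • 𝓕 f x := by
  simpa using! VectorFourier.integral_fourierIntegral_smul_eq_flip (L := innerₗ ℝ)
    Real.continuous_fourierChar continuous_inner hg hf

/-- The Fourier transform on `L²` is given by the integral on integrable functions. Both are tested
against smooth functions with compact support. -/
theorem fourier_toLp_ae {f : ℝ → F} (h1 : Integrable f) (h2 : MemLp f 2 volume) :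
    ((𝓕 (h2.toLp f) : Lp F 2 (volume : Measure ℝ)) : ℝ → F) =ᵐ[volume] 𝓕 f := by
  have hc : Continuous (𝓕 f) :=
    VectorFourier.fourierIntegral_continuous Real.continuous_fourierChar
      (by exact continuous_inner) h1
  refine ae_eq_of_integral_contDiff_smul_eq
    ((Lp.memLp _).locallyIntegrable (by norm_num)) hc.locallyIntegrable ?_
  intro g hg hgc
  set gs : SchwartzMap ℝ ℂ := (hgc.comp_left (g := ((↑) : ℝ → ℂ)) rfl).toSchwartzMap
    (Complex.ofRealCLM.contDiff.comp hg) with hgs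
  have e0 : ∀ x, gs x = (g x : ℂ) := fun x => rfl
  have e1 := congrArg (fun D => D gs) (Lp.fourier_toTemperedDistribution_eq (h2.toLp f))
  simp only [TemperedDistribution.fourier_apply, Lp.toTemperedDistribution_apply] at e1
  have e2 : ∫ x, (𝓕 gs) x • (h2.toLp f : ℝ → F) x = ∫ x, (𝓕 (gs : ℝ → ℂ)) x • f x := by
    refine integral_congr_ae ?_
    filter_upwards [h2.coeFn_toLp] with x hx
    rw [hx, SchwartzMap.fourier_coe]
  have e3 := integral_fourier_smul_eq (gs.integrable (μ := volume)) h1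
  rw [e2, e3] at e1
  simp only [e0] at e1
  simpa [Complex.coe_smul] using e1.symm

theorem fourierInv_toLp_ae {f : ℝ → F} (h1 : Integrable f) (h2 : MemLp f 2 volume) :
    ((𝓕⁻ (h2.toLp f) : Lp F 2 (volume : Measure ℝ)) : ℝ → F) =ᵐ[volume] 𝓕⁻ f := by
  have hc : Continuous (𝓕⁻ f) := by
    have : 𝓕⁻ f = fun x => 𝓕 f (-x) := by
      ext x; rw [Real.fourierInv_eq_fourier_neg]
    rw [this]
    exact (VectorFourier.fourierIntegral_continuous Real.continuous_fourierChar
      (by exact continuous_inner) h1).comp continuous_neg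
  refine ae_eq_of_integral_contDiff_smul_eq
    ((Lp.memLp _).locallyIntegrable (by norm_num)) hc.locallyIntegrable ?_
  intro g hg hgc
  set gs : SchwartzMap ℝ ℂ := (hgc.comp_left (g := ((↑) : ℝ → ℂ)) rfl).toSchwartzMap
    (Complex.ofRealCLM.contDiff.comp hg) with hgs
  have e0 : ∀ x, gs x = (g x : ℂ) := fun x => rfl
  have e1 := congrArg (fun D => D gs) (Lp.fourierInv_toTemperedDistribution_eq (h2.toLp f))
  simp only [TemperedDistribution.fourierInv_apply, Lp.toTemperedDistribution_apply] at e1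
  have e2 : ∫ x, (𝓕⁻ gs) x • (h2.toLp f : ℝ → F) x = ∫ x, (𝓕⁻ (gs : ℝ → ℂ)) x • f x := by
    refine integral_congr_ae ?_
    filter_upwards [h2.coeFn_toLp] with x hx
    rw [hx, SchwartzMap.fourierInv_coe]
  have e3 : ∫ x, (𝓕⁻ (gs : ℝ → ℂ)) x • f x = ∫ x, gs x • 𝓕⁻ f x := by
    have := integral_fourier_smul_eq ((gs.integrable (μ := volume)).comp_neg) h1
    rw [← integral_neg_eq_self (fun x => gs x • 𝓕⁻ f x)]
    have h4 : ∀ x, 𝓕 (fun y => gs (-y)) x = 𝓕⁻ (gs : ℝ → ℂ) x := by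
      intro x; rw [Real.fourierInv_eq_fourier_comp_neg]
    simp only [h4] at this
    rw [this]
    congr 1; ext x; rw [Real.fourierInv_eq_fourier_neg, neg_neg]
  rw [e2, e3] at e1
  simp only [e0] at e1
  simpa [Complex.coe_smul] using e1.symm

theorem lintegral_fourier_sq {f : ℝ → F} (h1 : Integrable f) (h2 : MemLp f 2 volume) :
    ∫⁻ x, ‖𝓕 f x‖ₑ ^ 2 = ∫⁻ x, ‖f x‖ₑ ^ 2 := by
  have key : eLpNorm (𝓕 f) 2 volume = eLpNorm f 2 volume := by
    rw [← eLpNorm_congr_ae (fourier_toLp_ae h1 h2), ← Lp.enorm_def, ← Lp.enorm_toLp h2]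
    simp only [← ofReal_norm, Lp.norm_fourier_eq]
  have := congrArg (fun x => x ^ 2) key
  simp only [eLpNorm_eq_lintegral_rpow_enorm_toReal (p := 2) (by norm_num) (by norm_num)] at this
  simp only [← ENNReal.rpow_natCast, ← ENNReal.rpow_mul] at this
  norm_num at this
  exact this

/-- **Plancherel's theorem** for integrable functions with values in a Hilbert space, as an
inequality; it is trivial unless `f` is square integrable. -/
theorem lintegral_fourier_sq_le {f : ℝ → F} (h1 : Integrable f) :
    ∫⁻ x, ‖𝓕 f x‖ₑ ^ 2 ≤ ∫⁻ x, ‖f x‖ₑ ^ 2 := by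
  by_cases h : ∫⁻ x, ‖f x‖ₑ ^ 2 = ∞
  · rw [h]; exact le_top
  have h2 : MemLp f 2 volume := by
    refine ⟨h1.1, ?_⟩
    rw [eLpNorm_lt_top_iff_lintegral_rpow_enorm_lt_top (by norm_num) (by norm_num)]
    simpa using lt_top_iff_ne_top.2 h
  exact (lintegral_fourier_sq h1 h2).le

end FourierConsistency

theorem L2_lintegral_sq (f : L2) : ∫⁻ y, ‖f y‖ₑ ^ 2 = ‖f‖ₑ ^ 2 := by
  rw [Lp.enorm_def, eLpNorm_eq_lintegral_rpow_enorm_toReal (by norm_num) (by norm_num),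
    ← ENNReal.rpow_natCast, ← ENNReal.rpow_mul]
  norm_num

theorem fourier_L2_sub (f g : L2) : (𝓕 (f - g) : L2) = 𝓕 f - 𝓕 g := by
  have h : (𝓕 (f - g) : L2) + 𝓕 g = 𝓕 f := by rw [← FourierTransform.fourier_add, sub_add_cancel]
  rw [← h, add_sub_cancel_right]

theorem fourierInv_L2_sub (f g : L2) : (𝓕⁻ (f - g) : L2) = 𝓕⁻ f - 𝓕⁻ g := by
  have h : (𝓕⁻ (f - g) : L2) + 𝓕⁻ g = 𝓕⁻ f := by
    rw [← FourierTransform.fourierInv_add, sub_add_cancel]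
  rw [← h, add_sub_cancel_right]

theorem toL2_of_memLp {f : ℝ → ℂ} (h : MemLp f 2 volume) : toL2 f = h.toLp f := by
  simp [toL2, h]

theorem toL2_ae {f : ℝ → ℂ} (h : MemLp f 2 volume) : (toL2 f : ℝ → ℂ) =ᵐ[volume] f := by
  rw [toL2_of_memLp h]; exact h.coeFn_toLp

theorem toL2_congr {f g : ℝ → ℂ} (hf : MemLp f 2 volume) (h : f =ᵐ[volume] g) :
    toL2 f = toL2 g := by
  rw [toL2_of_memLp hf, toL2_of_memLp (hf.ae_eq h)]
  exact MemLp.toLp_congr _ _ h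

theorem toL2_coe (f : L2) : toL2 (f : ℝ → ℂ) = f := by
  rw [toL2_of_memLp (Lp.memLp f)]; exact Lp.toLp_coeFn f _

theorem toL2_sub {f g : ℝ → ℂ} (hf : MemLp f 2 volume) (hg : MemLp g 2 volume) :
    toL2 (fun x => f x - g x) = toL2 f - toL2 g := by
  rw [toL2_of_memLp hf, toL2_of_memLp hg, ← MemLp.toLp_sub hf hg]
  exact toL2_of_memLp (hf.sub hg)

theorem enorm_toL2_sq {f : ℝ → ℂ} (hf : MemLp f 2 volume) :
    ‖toL2 f‖ₑ ^ 2 = ∫⁻ x, ‖f x‖ₑ ^ 2 := by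
  rw [← L2_lintegral_sq]
  exact lintegral_congr_ae ((toL2_ae hf).mono fun x hx => by simp [hx])

/-! ### Multiplication operators on `L²` and the free Schrödinger evolution -/

/-- Multiplication by the function `m` as a bounded operator on `L²` (zero unless `m` is essentially
bounded). -/
def mulOp (m : ℝ → ℂ) : L2 →L[ℂ] L2 :=
  open Classical in
  if h : MemLp m ∞ volume then
    (ContinuousLinearMap.mul ℂ ℂ).holderL volume ∞ 2 2 (h.toLp m) else 0

theorem mulOp_ae {m : ℝ → ℂ} (hm : MemLp m ∞ volume) (a : L2) :
    (mulOp m a : ℝ → ℂ) =ᵐ[volume] fun y => m y * a y := by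
  simp only [mulOp, hm, dite_true]
  filter_upwards [ContinuousLinearMap.coeFn_holder (r := 2) (ContinuousLinearMap.mul ℂ ℂ)
    (hm.toLp m) a, hm.coeFn_toLp] with y h1 h2
  simp only [ContinuousLinearMap.holderL_apply_apply]
  rw [h1, h2]; rfl

theorem mulOp_norm_le {m : ℝ → ℂ} (hm : Measurable m) {C : ℝ} (hC : 0 ≤ C)
    (h : ∀ y, ‖m y‖ ≤ C) : ‖mulOp m‖ ≤ C := by
  have hm' : MemLp m ∞ volume := memLp_top_of_bound hm.aestronglyMeasurable C (.of_forall h)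
  refine ContinuousLinearMap.opNorm_le_bound _ hC fun a => ?_
  refine Lp.norm_le_mul_norm_of_ae_le_mul ?_
  filter_upwards [mulOp_ae hm' a] with y hy
  rw [hy, norm_mul]
  exact mul_le_mul_of_nonneg_right (h y) (norm_nonneg _)

theorem mulOp_sub {m n : ℝ → ℂ} (hm : MemLp m ∞ volume) (hn : MemLp n ∞ volume) :
    mulOp (fun y => m y - n y) = mulOp m - mulOp n := by
  ext1 a
  apply Lp.ext
  filter_upwards [mulOp_ae hm a, mulOp_ae hn a, mulOp_ae (hm.sub hn) a,
    Lp.coeFn_sub (mulOp m a) (mulOp n a)] with y h1 h2 h3 h4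
  have : mulOp (fun y => m y - n y) = mulOp (m - n) := rfl
  rw [this, h3, sub_apply, h4]
  simp [h1, h2, sub_mul]

theorem mulOp_const_mul {m : ℝ → ℂ} (hm : MemLp m ∞ volume) (c : ℂ) :
    mulOp (fun y => c * m y) = c • mulOp m := by
  ext1 a
  apply Lp.ext
  filter_upwards [mulOp_ae hm a, mulOp_ae (hm.const_mul c) a,
    Lp.coeFn_smul c (mulOp m a)] with y h1 h2 h4
  rw [h2, smul_apply, h4]
  simp [h1, mul_assoc]

theorem mulOp_comp {m n : ℝ → ℂ} (hm : MemLp m ∞ volume) (hn : MemLp n ∞ volume) (a : L2) :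
    mulOp m (mulOp n a) = mulOp (fun y => m y * n y) a := by
  have hmn : MemLp (fun y => m y * n y) ∞ volume := hn.mul' hm
  apply Lp.ext
  filter_upwards [mulOp_ae hm (mulOp n a), mulOp_ae hn a, mulOp_ae hmn a] with y h1 h2 h3
  rw [h1, h2, h3, mul_assoc]

/-- The phase `2πxy - (2πy)²t` of the plane wave of frequency `y`. -/
def wavePhase (t x y : ℝ) : ℝ := 2 * Real.pi * x * y - (2 * Real.pi * y) ^ 2 * t

/-- The symbol `1_J(y) e^{i(2πxy - (2πy)²t)}`. -/
def waveSymb (J : Set ℝ) (t x : ℝ) : ℝ → ℂ :=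
  J.indicator fun y => Complex.exp ((wavePhase t x y : ℝ) * Complex.I)

/-- The operator on the Fourier side that restricts the frequency to `J`, evolves the free
Schrödinger equation for the time `t` and translates by `x`. -/
def waveOp (J : Set ℝ) (t x : ℝ) : L2 →L[ℂ] L2 := mulOp (waveSymb J t x)

/-- The free Schrödinger solution `∫_J e^{2πixy - i(2πy)²t} a(y) dy` with initial datum
`𝓕⁻(1_J a)`. -/
def freeSol (J : Set ℝ) (a : L2) (t x : ℝ) : ℂ := ∫ y, waveSymb J t x y * a y

variable {J : Set ℝ}

theorem waveSymb_norm_le (J : Set ℝ) (t x y : ℝ) : ‖waveSymb J t x y‖ ≤ 1 := by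
  unfold waveSymb
  by_cases h : y ∈ J
  · simp [h, Complex.norm_exp_ofReal_mul_I]
  · simp [h]

theorem waveSymb_measurable (hJ : MeasurableSet J) (t x : ℝ) : Measurable (waveSymb J t x) := by
  refine Measurable.indicator ?_ hJ
  unfold wavePhase
  fun_prop

theorem waveSymb_memLp_top (hJ : MeasurableSet J) (t x : ℝ) : MemLp (waveSymb J t x) ∞ volume :=
  memLp_top_of_bound (waveSymb_measurable hJ t x).aestronglyMeasurable 1
    (.of_forall (waveSymb_norm_le J t x))

theorem waveOp_ae (hJ : MeasurableSet J) (t x : ℝ) (a : L2) :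
    (waveOp J t x a : ℝ → ℂ) =ᵐ[volume] fun y => waveSymb J t x y * a y :=
  mulOp_ae (waveSymb_memLp_top hJ t x) a

theorem waveOp_opNorm_le (hJ : MeasurableSet J) (t x : ℝ) : ‖waveOp J t x‖ ≤ 1 :=
  mulOp_norm_le (waveSymb_measurable hJ t x) zero_le_one (waveSymb_norm_le J t x)

theorem norm_waveOp_le (hJ : MeasurableSet J) (t x : ℝ) (a : L2) : ‖waveOp J t x a‖ ≤ ‖a‖ := by
  simpa using (waveOp J t x).le_of_opNorm_le (waveOp_opNorm_le hJ t x) a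

theorem waveSymb_mul (J J' : Set ℝ) (t x t' x' y : ℝ) :
    waveSymb J t x y * waveSymb J' t' x' y = waveSymb (J ∩ J') (t + t') (x + x') y := by
  unfold waveSymb
  by_cases h : y ∈ J <;> by_cases h' : y ∈ J' <;> simp [h, h']
  rw [← Complex.exp_add]
  congr 1
  unfold wavePhase
  push_cast
  ring

theorem waveOp_waveOp {J' : Set ℝ} (hJ : MeasurableSet J) (hJ' : MeasurableSet J')
    (t x t' x' : ℝ) (a : L2) :
    waveOp J t x (waveOp J' t' x' a) = waveOp (J ∩ J') (t + t') (x + x') a := by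
  unfold waveOp
  rw [mulOp_comp (waveSymb_memLp_top hJ t x) (waveSymb_memLp_top hJ' t' x')]
  congr 2
  ext y
  exact waveSymb_mul ..

theorem norm_exp_I_sub_le (a b : ℝ) :
    ‖Complex.exp (a * Complex.I) - Complex.exp (b * Complex.I)‖ ≤ |a - b| := by
  have h : Complex.exp (a * Complex.I) - Complex.exp (b * Complex.I)
      = Complex.exp (b * Complex.I) * (Complex.exp (Complex.I * ((a - b : ℝ) : ℂ)) - 1) := by
    rw [mul_sub, ← Complex.exp_add, mul_one]
    congr 2
    push_cast; ring
  rw [h, norm_mul, Complex.norm_exp_ofReal_mul_I, one_mul]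
  simpa using Real.norm_exp_I_mul_ofReal_sub_one_le (x := a - b)

theorem waveSymb_sub_le {R : ℝ} (hR : ∀ y ∈ J, |y| ≤ R) (hR0 : 0 ≤ R) (t x t' x' y : ℝ) :
    ‖waveSymb J t x y - waveSymb J t' x' y‖
      ≤ 2 * Real.pi * R * |x - x'| + (2 * Real.pi * R) ^ 2 * |t - t'| := by
  unfold waveSymb
  by_cases h : y ∈ J
  · simp only [h, Set.indicator_of_mem]
    refine (norm_exp_I_sub_le _ _).trans ?_
    unfold wavePhase
    have h1 : 2 * Real.pi * x * y - (2 * Real.pi * y) ^ 2 * t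
        - (2 * Real.pi * x' * y - (2 * Real.pi * y) ^ 2 * t')
        = 2 * Real.pi * y * (x - x') - (2 * Real.pi * y) ^ 2 * (t - t') := by ring
    rw [h1]
    refine (abs_sub _ _).trans ?_
    have hy := hR y h
    have h2 : |2 * Real.pi * y| ≤ 2 * Real.pi * R := by
      rw [abs_mul, abs_of_pos Real.two_pi_pos]
      exact mul_le_mul_of_nonneg_left hy Real.two_pi_pos.le
    rw [abs_mul (2 * Real.pi * y), abs_mul (_ ^ 2), abs_pow]
    gcongr
  · simp only [h, not_false_eq_true, Set.indicator_of_notMem, sub_self, norm_zero]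
    positivity

theorem continuous_waveOp (hJ : MeasurableSet J) {R : ℝ} (hR : ∀ y ∈ J, |y| ≤ R) :
    Continuous fun p : ℝ × ℝ => waveOp J p.1 p.2 := by
  rw [continuous_iff_continuousAt]
  intro p
  rw [ContinuousAt, tendsto_iff_norm_sub_tendsto_zero]
  have hR' : ∀ y ∈ J, |y| ≤ max R 0 := fun y hy => (hR y hy).trans (le_max_left _ _)
  refine squeeze_zero (g := fun q : ℝ × ℝ => 2 * Real.pi * max R 0 * |q.2 - p.2|
    + (2 * Real.pi * max R 0) ^ 2 * |q.1 - p.1|) (fun _ => norm_nonneg _) (fun q => ?_) ?_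
  · unfold waveOp
    rw [← mulOp_sub (waveSymb_memLp_top hJ _ _) (waveSymb_memLp_top hJ _ _)]
    have hM : (0:ℝ) ≤ max R 0 := le_max_right _ _
    refine mulOp_norm_le ((waveSymb_measurable hJ _ _).sub (waveSymb_measurable hJ _ _)) ?_
      (waveSymb_sub_le hR' (le_max_right _ _) _ _ _ _)
    have := Real.pi_pos
    positivity
  · have : Continuous fun q : ℝ × ℝ => 2 * Real.pi * max R 0 * |q.2 - p.2|
      + (2 * Real.pi * max R 0) ^ 2 * |q.1 - p.1| := by fun_prop
    simpa using this.tendsto p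

theorem integrable_waveSymb_mul (hJ : MeasurableSet J) {R : ℝ} (hR : ∀ y ∈ J, |y| ≤ R)
    (t x : ℝ) (a : L2) : Integrable fun y => waveSymb J t x y * a y := by
  have hfin : volume J < ∞ :=
    (measure_mono fun y hy => abs_le.1 (hR y hy)).trans_lt
      (measure_Icc_lt_top (a := -R) (b := R))
  have : Fact (volume J < ∞) := ⟨hfin⟩
  have h1 : IntegrableOn (a : ℝ → ℂ) J :=
    ((Lp.memLp a).restrict J).integrable (by norm_num)
  have h2 : Integrable (J.indicator (a : ℝ → ℂ)) := h1.integrable_indicator hJ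
  refine h2.mono ((waveSymb_measurable hJ t x).aestronglyMeasurable.mul
    (Lp.aestronglyMeasurable a)) (.of_forall fun y => ?_)
  by_cases h : y ∈ J <;> simp [waveSymb, h, Complex.norm_exp_ofReal_mul_I]

theorem integrable_waveOp (hJ : MeasurableSet J) {R : ℝ} (hR : ∀ y ∈ J, |y| ≤ R)
    (t x : ℝ) (a : L2) : Integrable (waveOp J t x a : ℝ → ℂ) :=
  (integrable_waveSymb_mul hJ hR t x a).congr (waveOp_ae hJ t x a).symm

/-- The indicator function of `J` as an element of `L²`. -/
def indL2 (J : Set ℝ) : L2 := toL2 (J.indicator fun _ => 1)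

theorem volume_le_of_abs_le {R : ℝ} (hR : ∀ y ∈ J, |y| ≤ R) :
    volume J ≤ ENNReal.ofReal (2 * R) := by
  have hs : J ⊆ Set.Icc (-R) R := fun y hy => abs_le.1 (hR y hy)
  refine (measure_mono hs).trans ?_
  rw [Real.volume_Icc]
  exact ENNReal.ofReal_le_ofReal (by linarith)

theorem memLp_indicator_one (hJ : MeasurableSet J) {R : ℝ} (hR : ∀ y ∈ J, |y| ≤ R) :
    MemLp (J.indicator fun _ => (1 : ℂ)) 2 volume :=
  memLp_indicator_const 2 hJ 1 (.inr ((volume_le_of_abs_le hR).trans_lt ENNReal.ofReal_lt_top).ne)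

theorem freeSol_eq_inner (hJ : MeasurableSet J) {R : ℝ} (hR : ∀ y ∈ J, |y| ≤ R)
    (a : L2) (t x : ℝ) : freeSol J a t x = inner ℂ (indL2 J) (waveOp J t x a) := by
  rw [L2.inner_def, freeSol]
  refine integral_congr_ae ?_
  filter_upwards [toL2_ae (memLp_indicator_one hJ hR), waveOp_ae hJ t x a] with y h1 h2
  rw [indL2, h1, h2]
  by_cases h : y ∈ J <;> simp [waveSymb, h]

theorem continuous_freeSol (hJ : MeasurableSet J) {R : ℝ} (hR : ∀ y ∈ J, |y| ≤ R) :
    Continuous fun p : L2 × ℝ × ℝ => freeSol J p.1 p.2.1 p.2.2 := by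
  have h1 : Continuous fun p : L2 × ℝ × ℝ => waveOp J p.2.1 p.2.2 p.1 :=
    ((continuous_waveOp hJ hR).comp continuous_snd).clm_apply continuous_fst
  simp only [freeSol_eq_inner hJ hR]
  exact continuous_const.inner h1

theorem freeSol_eq_fourierInv (hJ : MeasurableSet J) (a : L2) (t x : ℝ) :
    freeSol J a t x = 𝓕⁻ (waveOp J t 0 a : ℝ → ℂ) x := by
  rw [Real.fourierInv_eq', freeSol]
  refine integral_congr_ae ?_
  filter_upwards [waveOp_ae hJ t 0 a] with y h1
  rw [h1]
  by_cases h : y ∈ J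
  · simp only [waveSymb, h, Set.indicator_of_mem, smul_eq_mul, ← mul_assoc]
    rw [← Complex.exp_add]
    congr 2
    simp only [wavePhase, RCLike.inner_apply, conj_trivial]
    push_cast; ring
  · simp [waveSymb, h]

theorem freeSol_ae (hJ : MeasurableSet J) {R : ℝ} (hR : ∀ y ∈ J, |y| ≤ R) (a : L2) (t : ℝ) :
    ((𝓕⁻ (waveOp J t 0 a) : L2) : ℝ → ℂ) =ᵐ[volume] freeSol J a t := by
  have h := fourierInv_toLp_ae (integrable_waveOp hJ hR t 0 a) (Lp.memLp (waveOp J t 0 a))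
  rw [Lp.toLp_coeFn] at h
  filter_upwards [h] with x hx
  rw [hx, freeSol_eq_fourierInv hJ]

theorem memLp_freeSol (hJ : MeasurableSet J) {R : ℝ} (hR : ∀ y ∈ J, |y| ≤ R) (a : L2) (t : ℝ) :
    MemLp (freeSol J a t) 2 volume :=
  (Lp.memLp _).ae_eq (freeSol_ae hJ hR a t)

theorem toL2_freeSol (hJ : MeasurableSet J) {R : ℝ} (hR : ∀ y ∈ J, |y| ≤ R) (a : L2) (t : ℝ) :
    toL2 (freeSol J a t) = 𝓕⁻ (waveOp J t 0 a) := by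
  rw [← toL2_congr (Lp.memLp _) (freeSol_ae hJ hR a t), toL2_coe]

theorem norm_waveOp_eq (hJ : MeasurableSet J) (t x : ℝ) (a : L2) :
    ‖waveOp J t x a‖ = ‖waveOp J 0 0 a‖ := by
  refine le_antisymm ?_ ?_
  · have := norm_waveOp_le hJ t x (waveOp J 0 0 a)
    rwa [waveOp_waveOp hJ hJ, Set.inter_self, add_zero, add_zero] at this
  · have := norm_waveOp_le hJ (-t) (-x) (waveOp J t x a)
    rwa [waveOp_waveOp hJ hJ, Set.inter_self, neg_add_cancel, neg_add_cancel] at this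

theorem lintegral_freeSol_sq (hJ : MeasurableSet J) {R : ℝ} (hR : ∀ y ∈ J, |y| ≤ R)
    (a : L2) (t : ℝ) : ∫⁻ x, ‖freeSol J a t x‖ₑ ^ 2 = ‖waveOp J 0 0 a‖ₑ ^ 2 := by
  rw [← enorm_toL2_sq (memLp_freeSol hJ hR a t), toL2_freeSol hJ hR, ← ofReal_norm,
    ← ofReal_norm, ← norm_waveOp_eq hJ t 0, ← Lp.norm_fourier_eq, fourier_fourierInv_eq]

theorem norm_freeSol_sq_le (hJ : MeasurableSet J) {R : ℝ} (hR : ∀ y ∈ J, |y| ≤ R)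
    (hR0 : 0 ≤ R) (a : L2) (t x : ℝ) :
    ‖freeSol J a t x‖ ^ 2 ≤ 2 * R * ‖waveOp J 0 0 a‖ ^ 2 := by
  rw [freeSol_eq_inner hJ hR, ← norm_waveOp_eq hJ t x]
  have h1 := norm_inner_le_norm (𝕜 := ℂ) (indL2 J) (waveOp J t x a)
  have h2 : ‖indL2 J‖ ^ 2 ≤ 2 * R := by
    have h3 : ‖indL2 J‖ₑ ^ 2 ≤ ENNReal.ofReal (2 * R) := by
      rw [indL2, enorm_toL2_sq (memLp_indicator_one hJ hR)]
      refine le_trans (le_of_eq ?_) (volume_le_of_abs_le hR)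
      rw [← lintegral_indicator_one hJ]
      congr 1; ext y
      by_cases h : y ∈ J <;> simp [h]
    rw [← ofReal_norm, ← ENNReal.ofReal_pow (norm_nonneg _)] at h3
    exact (ENNReal.ofReal_le_ofReal_iff (by positivity)).1 h3
  calc _ ≤ (‖indL2 J‖ * ‖waveOp J t x a‖) ^ 2 := by gcongr
    _ = ‖indL2 J‖ ^ 2 * ‖waveOp J t x a‖ ^ 2 := by ring
    _ ≤ _ := by gcongr

theorem freeSol_waveOp {J' : Set ℝ} (hJ' : MeasurableSet J') (a : L2)
    (t x t' x' : ℝ) :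
    freeSol J (waveOp J' t' x' a) t x = freeSol (J ∩ J') a (t + t') (x + x') := by
  unfold freeSol
  refine integral_congr_ae ?_
  filter_upwards [waveOp_ae hJ' t' x' a] with y hy
  rw [hy, ← mul_assoc, waveSymb_mul]

/-- Evaluation of the free solution at a point, as a continuous linear functional of the datum. -/
def freeSolL (J : Set ℝ) (t x : ℝ) : L2 →L[ℂ] ℂ := (innerSL ℂ (indL2 J)) ∘L waveOp J t x

theorem freeSolL_apply (hJ : MeasurableSet J) {R : ℝ} (hR : ∀ y ∈ J, |y| ≤ R) (a : L2)
    (t x : ℝ) : freeSolL J t x a = freeSol J a t x := by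
  rw [freeSol_eq_inner hJ hR]; rfl

end

/-! ### Bilinear and `L⁶` Strichartz estimates -/

section

theorem lintegral_comp_mul_left (f : ℝ → ℝ≥0∞) {c : ℝ} (hc : c ≠ 0) :
    ∫⁻ x, f (c * x) = ENNReal.ofReal |c⁻¹| * ∫⁻ x, f x := by
  have h := (Homeomorph.mulLeft₀ c hc).measurableEmbedding.lintegral_map (μ := volume) f
  have h2 : Measure.map (Homeomorph.mulLeft₀ c hc) volume = ENNReal.ofReal |c⁻¹| • volume := by
    rw [← Real.map_volume_mul_left hc]; rfl
  rw [h2, lintegral_smul_measure] at h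
  simpa using h.symm

variable {J J' : Set ℝ}

/-- The spatial Fourier transform of the product `f₁ \bar f₂` of two free solutions. -/
def pairFourier (J J' : Set ℝ) (a a' : L2) (t p : ℝ) : ℂ :=
  𝓕 (fun x => freeSol J a t x * star (freeSol J' a' t x)) p

/-- The product `a(y+p) \bar{a'(y)}` of the frequency profiles of the two waves. -/
def corrProfile (J J' : Set ℝ) (a a' : L2) (p y : ℝ) : ℂ :=
  J.indicator a (y + p) * star (J'.indicator a' y)

theorem memLp_indicator (hJ : MeasurableSet J) (a : L2) :
    MemLp (J.indicator a) 2 volume := (Lp.memLp a).indicator hJ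

theorem integrable_corrProfile (hJ : MeasurableSet J) (hJ' : MeasurableSet J') (a a' : L2)
    (p : ℝ) : Integrable (corrProfile J J' a a' p) := by
  have h1 : MemLp (fun y => J.indicator a (y + p)) 2 volume :=
    (memLp_indicator hJ a).comp_measurePreserving (measurePreserving_add_right volume p)
  have h2 : MemLp (fun y => star (J'.indicator a' y)) 2 volume := (memLp_indicator hJ' a').star
  exact h1.integrable_mul h2

theorem fourierInv_comp_add_right (b : ℝ → ℂ) (p x : ℝ) :
    𝓕⁻ (fun y => b (y + p)) x = Complex.exp (-(2 * Real.pi * x * p : ℝ) * Complex.I) * 𝓕⁻ b x := by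
  rw [Real.fourierInv_eq', Real.fourierInv_eq', ← integral_const_mul]
  conv_rhs => rw [← integral_add_right_eq_self _ p]
  congr 1; ext y
  rw [smul_eq_mul, smul_eq_mul, ← mul_assoc, ← Complex.exp_add]
  congr 2
  simp only [RCLike.inner_apply, conj_trivial]
  push_cast; ring

/-- With `ξ₁ = 2π(y+p)` and `ξ₂ = 2πy` the phase is `ξ₁² - ξ₂² = (2πp)² + 8π²py`, which is affine
in `y`. For a fixed `p` this leaves a Fourier transform in `y`, evaluated at `4πpt`. -/
theorem pairFourier_eq (hJ : MeasurableSet J) (hJ' : MeasurableSet J') {R : ℝ}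
    (hR : ∀ y ∈ J, |y| ≤ R) (hR' : ∀ y ∈ J', |y| ≤ R) (a a' : L2) (t p : ℝ) :
    pairFourier J J' a a' t p = Complex.exp (-((2 * Real.pi * p) ^ 2 * t : ℝ) * Complex.I) *
      𝓕 (corrProfile J J' a a' p) (4 * Real.pi * p * t) := by
  set b := waveOp J t 0 a with hb
  set b' := waveOp J' t 0 a' with hb'
  have hbp2 : MemLp (fun y => b (y + p)) 2 volume :=
    (Lp.memLp b).comp_measurePreserving (measurePreserving_add_right volume p)
  have hbp1 : Integrable (fun y => b (y + p)) :=
    (integrable_waveOp hJ hR t 0 a).comp_add_right p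
  have e1 : pairFourier J J' a a' t p
      = inner ℂ (𝓕⁻ b' : L2) (𝓕⁻ (hbp2.toLp _) : L2) := by
    rw [L2.inner_def, pairFourier, Real.fourier_eq']
    refine integral_congr_ae ?_
    filter_upwards [freeSol_ae hJ' hR' a' t, fourierInv_toLp_ae hbp1 hbp2] with x h1 h2
    rw [h1, h2, fourierInv_comp_add_right, ← freeSol_eq_fourierInv hJ]
    simp only [RCLike.inner_apply, conj_trivial, smul_eq_mul, RCLike.star_def, ← mul_assoc]
    congr 3
    push_cast; ring
  have e2 : inner ℂ (𝓕⁻ b' : L2) (𝓕⁻ (hbp2.toLp _) : L2) = inner ℂ b' (hbp2.toLp _) := by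
    rw [← Lp.inner_fourier_eq, fourier_fourierInv_eq, fourier_fourierInv_eq]
  rw [e1, e2, L2.inner_def, Real.fourier_eq', ← integral_const_mul]
  refine integral_congr_ae ?_
  have h3 := (measurePreserving_add_right volume p).quasiMeasurePreserving.ae_eq_comp
    (waveOp_ae hJ t 0 a)
  filter_upwards [hbp2.coeFn_toLp, waveOp_ae hJ' t 0 a', h3] with y h4 h5 h6
  simp only [Function.comp] at h6
  rw [h4, h5, hb, h6]
  simp only [RCLike.inner_apply, conj_trivial, corrProfile, waveSymb]
  by_cases hy : y ∈ J' <;> by_cases hyp : y + p ∈ J <;> simp [hy, hyp]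
  rw [← Complex.exp_conj, mul_mul_mul_comm, ← Complex.exp_add]
  have h7 : Complex.exp ((wavePhase t 0 (y + p) : ℝ) * Complex.I
      + (starRingEnd ℂ) ((wavePhase t 0 y : ℝ) * Complex.I))
      = Complex.exp (-((2 * Real.pi * p) ^ 2 * t * Complex.I)) *
        Complex.exp (-(2 * Real.pi * (4 * Real.pi * p * t * y) * Complex.I)) := by
    rw [← Complex.exp_add]
    congr 1
    simp only [wavePhase, map_mul, Complex.conj_ofReal, Complex.conj_I]
    push_cast; ring
  rw [h7, mul_assoc]

theorem enorm_pairFourier (hJ : MeasurableSet J) (hJ' : MeasurableSet J') {R : ℝ}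
    (hR : ∀ y ∈ J, |y| ≤ R) (hR' : ∀ y ∈ J', |y| ≤ R) (a a' : L2) (t p : ℝ) :
    ‖pairFourier J J' a a' t p‖ₑ = ‖𝓕 (corrProfile J J' a a' p) (4 * Real.pi * p * t)‖ₑ := by
  rw [pairFourier_eq hJ hJ' hR hR', enorm_mul]
  have := Complex.norm_exp_ofReal_mul_I (-((2 * Real.pi * p) ^ 2 * t))
  rw [← ofReal_norm, ← Complex.ofReal_neg, this]; simp

theorem measurable_pairFourier (hJ : MeasurableSet J) (hJ' : MeasurableSet J') {R : ℝ}
    (hR : ∀ y ∈ J, |y| ≤ R) (hR' : ∀ y ∈ J', |y| ≤ R) (a a' : L2) :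
    Measurable fun q : ℝ × ℝ => pairFourier J J' a a' q.1 q.2 := by
  have h : StronglyMeasurable fun q : ℝ × ℝ => ∫ x : ℝ,
      Complex.exp (((-2 * Real.pi * inner ℝ x q.2 : ℝ) : ℂ) * Complex.I) •
        (freeSol J a q.1 x * star (freeSol J' a' q.1 x)) := by
    refine StronglyMeasurable.integral_prod_right (f := fun (q : ℝ × ℝ) (x : ℝ) =>
      Complex.exp (((-2 * Real.pi * inner ℝ x q.2 : ℝ) : ℂ) * Complex.I) •
        (freeSol J a q.1 x * star (freeSol J' a' q.1 x))) ?_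
    apply Continuous.stronglyMeasurable
    have h1 : Continuous fun q : (ℝ × ℝ) × ℝ => freeSol J a q.1.1 q.2 :=
      (continuous_freeSol hJ hR).comp (f := fun q : (ℝ × ℝ) × ℝ => (a, q.1.1, q.2)) (by fun_prop)
    have h2 : Continuous fun q : (ℝ × ℝ) × ℝ => freeSol J' a' q.1.1 q.2 :=
      (continuous_freeSol hJ' hR').comp (f := fun q : (ℝ × ℝ) × ℝ => (a', q.1.1, q.2))
        (by fun_prop)
    have h3 : Continuous fun q : (ℝ × ℝ) × ℝ =>
        Complex.exp (((-2 * Real.pi * inner ℝ q.2 q.1.2 : ℝ) : ℂ) * Complex.I) := by fun_prop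
    exact h3.smul (h1.mul h2.star)
  simp only [pairFourier, Real.fourier_eq']
  exact h.measurable

/-- For each `p ≠ 0`, the phase of the product of two free solutions depends on `t` through
`e^{-2πi y (4πpt)}`, so that Plancherel's theorem in `t` computes its size. -/
theorem lintegral_pairFourier_le (hJ : MeasurableSet J) (hJ' : MeasurableSet J') {R : ℝ}
    (hR : ∀ y ∈ J, |y| ≤ R) (hR' : ∀ y ∈ J', |y| ≤ R) (a a' : L2) {p : ℝ} (hp : p ≠ 0) :
    ∫⁻ t, ‖pairFourier J J' a a' t p‖ₑ ^ 2
      ≤ ENNReal.ofReal (1 / (4 * Real.pi * |p|)) * ∫⁻ y, ‖corrProfile J J' a a' p y‖ₑ ^ 2 := by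
  simp only [enorm_pairFourier hJ hJ' hR hR']
  have hc : 4 * Real.pi * p ≠ 0 := by positivity
  rw [lintegral_comp_mul_left (fun s => ‖𝓕 (corrProfile J J' a a' p) s‖ₑ ^ 2) hc]
  have : |(4 * Real.pi * p)⁻¹| = 1 / (4 * Real.pi * |p|) := by
    rw [abs_inv, abs_mul, abs_of_pos (by positivity), one_div]
  rw [this]
  refine mul_le_mul_right ?_ _
  exact lintegral_fourier_sq_le (integrable_corrProfile hJ hJ' a a' p)

theorem measurable_corrProfile (hJ : MeasurableSet J) (hJ' : MeasurableSet J') (a a' : L2) :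
    Measurable (Function.uncurry fun p y => ‖corrProfile J J' a a' p y‖ₑ ^ 2) := by
  have m1 : Measurable (J.indicator a) := (Lp.stronglyMeasurable a).measurable.indicator hJ
  have m2 : Measurable (J'.indicator a') := (Lp.stronglyMeasurable a').measurable.indicator hJ'
  have m3 : Measurable fun q : ℝ × ℝ => J.indicator (a : ℝ → ℂ) (q.2 + q.1) :=
    m1.comp (by fun_prop)
  have m4 : Measurable fun q : ℝ × ℝ => star (J'.indicator (a' : ℝ → ℂ) q.2) :=
    continuous_star.measurable.comp (m2.comp measurable_snd)
  exact ((m3.mul m4).enorm).pow_const 2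

theorem lintegral_corrProfile (hJ : MeasurableSet J) (hJ' : MeasurableSet J') (a a' : L2) :
    ∫⁻ p, ∫⁻ y, ‖corrProfile J J' a a' p y‖ₑ ^ 2 ≤ ‖a‖ₑ ^ 2 * ‖a'‖ₑ ^ 2 := by
  have m1 : Measurable (J.indicator a) := (Lp.stronglyMeasurable a).measurable.indicator hJ
  have m2 : Measurable (J'.indicator a') := (Lp.stronglyMeasurable a').measurable.indicator hJ'
  rw [lintegral_lintegral_swap]
  · have h1 : ∀ y, ∫⁻ p, ‖corrProfile J J' a a' p y‖ₑ ^ 2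
        = (∫⁻ p, ‖J.indicator a p‖ₑ ^ 2) * ‖J'.indicator a' y‖ₑ ^ 2 := by
      intro y
      have h2 : ∀ p, ‖corrProfile J J' a a' p y‖ₑ ^ 2
          = ‖J.indicator a (y + p)‖ₑ ^ 2 * ‖J'.indicator a' y‖ₑ ^ 2 := by
        intro p; rw [corrProfile, enorm_mul, mul_pow]; simp [← ofReal_norm]
      simp only [h2]
      rw [lintegral_mul_const _ (by fun_prop),
        lintegral_add_left_eq_self (fun p => ‖J.indicator a p‖ₑ ^ 2) y]
    simp only [h1]
    rw [lintegral_const_mul _ (by fun_prop), ← L2_lintegral_sq a, ← L2_lintegral_sq a']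
    refine mul_le_mul' (lintegral_mono fun y => ?_) (lintegral_mono fun y => ?_)
    · by_cases h : y ∈ J <;> simp [h]
    · by_cases h : y ∈ J' <;> simp [h]
  · exact (measurable_corrProfile hJ hJ' a a').aemeasurable

theorem integrable_freeSol_mul (hJ : MeasurableSet J) (hJ' : MeasurableSet J') {R : ℝ}
    (hR : ∀ y ∈ J, |y| ≤ R) (hR' : ∀ y ∈ J', |y| ≤ R) (a a' : L2) (t : ℝ) :
    Integrable fun x => freeSol J a t x * star (freeSol J' a' t x) :=
  (memLp_freeSol hJ hR a t).integrable_mul (memLp_freeSol hJ' hR' a' t).star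

theorem memLp_top_freeSol (hJ : MeasurableSet J) {R : ℝ} (hR : ∀ y ∈ J, |y| ≤ R) (a : L2)
    (t : ℝ) : MemLp (freeSol J a t) ∞ volume := by
  have hc : Continuous (freeSol J a t) :=
    (continuous_freeSol hJ hR).comp (f := fun x : ℝ => (a, t, x)) (by fun_prop)
  refine memLp_top_of_bound hc.aestronglyMeasurable
    (Real.sqrt (2 * max R 0 * ‖waveOp J 0 0 a‖ ^ 2)) (.of_forall fun x => ?_)
  refine Real.le_sqrt_of_sq_le ?_
  exact norm_freeSol_sq_le hJ (fun y hy => (hR y hy).trans (le_max_left _ _))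
    (le_max_right _ _) a t x

theorem memLp_freeSol_mul (hJ : MeasurableSet J) (hJ' : MeasurableSet J') {R : ℝ}
    (hR : ∀ y ∈ J, |y| ≤ R) (hR' : ∀ y ∈ J', |y| ≤ R) (a a' : L2) (t : ℝ) :
    MemLp (fun x => freeSol J a t x * star (freeSol J' a' t x)) 2 volume :=
  (memLp_freeSol hJ' hR' a' t).star.mul' (memLp_top_freeSol hJ hR a t)

/-- The product of two free solutions in `L²` with a weight `k(p)` on its frequency. The weight
`1/|p|` which the estimate allows is the source of both Strichartz estimates below. -/
theorem lintegral_weight_pairFourier_le (hJ : MeasurableSet J) (hJ' : MeasurableSet J') {R : ℝ}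
    (hR : ∀ y ∈ J, |y| ≤ R) (hR' : ∀ y ∈ J', |y| ≤ R) (a a' : L2) {k : ℝ → ℝ≥0∞}
    (hk : Measurable k) {K : ℝ≥0∞}
    (hK : ∀ p y, p ≠ 0 → y + p ∈ J → y ∈ J' → k p * ENNReal.ofReal (1 / (4 * Real.pi * |p|)) ≤ K) :
    ∫⁻ t, ∫⁻ p, k p * ‖pairFourier J J' a a' t p‖ₑ ^ 2 ≤ K * (‖a‖ₑ ^ 2 * ‖a'‖ₑ ^ 2) := by
  have hm := measurable_pairFourier hJ hJ' hR hR' a a'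
  rw [lintegral_lintegral_swap]
  · have h1 : ∀ᵐ p : ℝ, ∫⁻ t, k p * ‖pairFourier J J' a a' t p‖ₑ ^ 2
        ≤ K * ∫⁻ y, ‖corrProfile J J' a a' p y‖ₑ ^ 2 := by
      filter_upwards [Measure.ae_ne volume 0] with p hp
      have m5 : Measurable fun t => ‖pairFourier J J' a a' t p‖ₑ ^ 2 :=
        ((hm.comp (by fun_prop : Measurable fun t : ℝ => (t, p))).enorm).pow_const 2
      rw [lintegral_const_mul _ m5]
      refine (mul_le_mul_right (lintegral_pairFourier_le hJ hJ' hR hR' a a' hp) _).trans ?_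
      rw [← mul_assoc]
      by_cases hex : ∃ y, y + p ∈ J ∧ y ∈ J'
      · obtain ⟨y, hy1, hy2⟩ := hex
        gcongr
        exact hK p y hp hy1 hy2
      · push Not at hex
        have : ∀ y, corrProfile J J' a a' p y = 0 := by
          intro y
          by_cases hy : y + p ∈ J
          · simp [corrProfile, hex y hy]
          · simp [corrProfile, hy]
        simp [this]
    refine (lintegral_mono_ae h1).trans ?_
    have hmc : Measurable fun p => ∫⁻ y, ‖corrProfile J J' a a' p y‖ₑ ^ 2 :=
      (measurable_corrProfile hJ hJ' a a').lintegral_prod_right'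
    rw [lintegral_const_mul _ hmc]
    refine mul_le_mul_right ?_ _
    exact lintegral_corrProfile hJ hJ' a a'
  · exact ((hk.comp measurable_snd).mul (hm.enorm.pow_const 2)).aemeasurable

/-- **Bilinear Strichartz estimate**: two free solutions whose frequencies are at distance at least
`d` from each other interact weakly in `L²`. -/
theorem bilinear_strichartz (hJ : MeasurableSet J) (hJ' : MeasurableSet J') {R : ℝ}
    (hR : ∀ y ∈ J, |y| ≤ R) (hR' : ∀ y ∈ J', |y| ≤ R) {d : ℝ} (hd : 0 < d)
    (hsep : ∀ y ∈ J, ∀ y' ∈ J', d ≤ |y - y'|) (a a' : L2) :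
    ∫⁻ t, ∫⁻ x, ‖freeSol J a t x‖ₑ ^ 2 * ‖freeSol J' a' t x‖ₑ ^ 2
      ≤ ENNReal.ofReal (1 / d) * (‖a‖ₑ ^ 2 * ‖a'‖ₑ ^ 2) := by
  have h1 : ∀ t, ∫⁻ x, ‖freeSol J a t x‖ₑ ^ 2 * ‖freeSol J' a' t x‖ₑ ^ 2
      = ∫⁻ p, 1 * ‖pairFourier J J' a a' t p‖ₑ ^ 2 := by
    intro t
    simp only [one_mul]
    rw [show (fun p => ‖pairFourier J J' a a' t p‖ₑ ^ 2) = fun p =>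
      ‖𝓕 (fun x => freeSol J a t x * star (freeSol J' a' t x)) p‖ₑ ^ 2 from rfl,
      lintegral_fourier_sq (integrable_freeSol_mul hJ hJ' hR hR' a a' t)
        (memLp_freeSol_mul hJ hJ' hR hR' a a' t)]
    congr 1; ext x
    rw [enorm_mul, mul_pow]; simp [← ofReal_norm]
  simp only [h1]
  refine lintegral_weight_pairFourier_le hJ hJ' hR hR' a a' measurable_const ?_
  intro p y _ hy hy'
  rw [one_mul]
  refine ENNReal.ofReal_le_ofReal ?_
  have h2 := hsep _ hy _ hy'
  rw [add_sub_cancel_left] at h2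
  have h3 : d ≤ 4 * Real.pi * |p| := by
    have := Real.pi_gt_three
    nlinarith [abs_nonneg p]
  exact one_div_le_one_div_of_le hd h3

/-- The Gagliardo-Nirenberg type inequality `‖v‖_{L³}³ ≤ 48 ‖v‖_{L¹} ‖v‖²_{Ḣ^{1/2}}`. On the level
set `{|v| > α}` the part of `v` with frequencies below `α / (4 ‖v‖_{L¹})` is at most `α/2`, so the
rest is at least `α/2`; Chebyshev's inequality and integration in `α` give the claim. -/
theorem lintegral_cube_le {v : ℝ → ℂ} (h1 : Integrable v) (h2 : MemLp v 2 volume) :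
    ∫⁻ x, ‖v x‖ₑ ^ 3 ≤ 48 * (∫⁻ x, ‖v x‖ₑ) * ∫⁻ p, ENNReal.ofReal |p| * ‖𝓕 v p‖ₑ ^ 2 := by
  set K : ℝ := ∫ x, ‖v x‖ with hK
  have hK0 : 0 ≤ K := integral_nonneg fun x => norm_nonneg _
  have hKe : ∫⁻ x, ‖v x‖ₑ = ENNReal.ofReal K := by
    rw [hK, ← ofReal_integral_norm_eq_lintegral_enorm h1]
  rcases hK0.eq_or_lt with hK00 | hKpos
  · have hv : v =ᵐ[volume] 0 := by
      have : ∫⁻ x, ‖v x‖ₑ = 0 := by rw [hKe, ← hK00]; simp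
      rw [lintegral_eq_zero_iff' h1.1.enorm] at this
      filter_upwards [this] with x hx
      simpa using hx
    have : ∫⁻ x, ‖v x‖ₑ ^ 3 = 0 := by
      rw [lintegral_congr_ae (g := fun _ => 0)]
      · simp
      · filter_upwards [hv] with x hx; simp [hx]
    rw [this]; exact zero_le
  set a : L2 := 𝓕 (toL2 v) with ha
  have hav : (a : ℝ → ℂ) =ᵐ[volume] 𝓕 v := by
    rw [ha, toL2_of_memLp h2]; exact fourier_toLp_ae h1 h2
  have hvK : ∀ p, ‖𝓕 v p‖ ≤ K := fun p => by
    rw [Real.fourier_eq]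
    refine (norm_integral_le_integral_norm _).trans (le_of_eq ?_)
    simp [hK, Circle.norm_smul]
  -- the level set at height `α`
  have level : ∀ α : ℝ, 0 < α → volume {x | α < ‖v x‖} * ENNReal.ofReal (α ^ 2) ≤
      4 * ∫⁻ p, (Set.Ici α).indicator 1 (4 * K * |p|) * ‖a p‖ₑ ^ 2 := by
    intro α hα
    set r : ℝ := α / (4 * K) with hr
    have hr0 : 0 < r := by positivity
    set B : Set ℝ := {p | |p| < r} with hB
    have hBm : MeasurableSet B := measurableSet_lt (by fun_prop) (by fun_prop)
    have hBR : ∀ y ∈ B, |y| ≤ r := fun y hy => le_of_lt hy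
    have hlo : ∀ x, ‖freeSol B a 0 x‖ ≤ α / 2 := by
      intro x
      unfold freeSol
      have hb : ∫ y, B.indicator (fun _ => K) y = 2 * r * K := by
        rw [integral_indicator hBm, setIntegral_const, smul_eq_mul]
        congr 1
        have : B = Set.Ioo (-r) r := by ext y; simp [hB, abs_lt]
        rw [Measure.real, this, Real.volume_Ioo, ENNReal.toReal_ofReal (by linarith)]
        ring
      refine (norm_integral_le_of_norm_le (g := B.indicator fun _ => K) ?_ ?_).trans ?_
      · exact (integrableOn_const ((volume_le_of_abs_le hBR).trans_lt
          ENNReal.ofReal_lt_top).ne).integrable_indicator hBm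
      · filter_upwards [hav] with y hy
        by_cases h : y ∈ B
        · rw [norm_mul, hy, Set.indicator_of_mem h]
          calc _ ≤ 1 * K :=
                mul_le_mul (waveSymb_norm_le _ _ _ _) (hvK y) (norm_nonneg _) zero_le_one
            _ = K := one_mul K
        · simp [waveSymb, h]
      · rw [hb, hr]
        apply le_of_eq
        field_simp
        norm_num
    set w : L2 := toL2 v - toL2 (freeSol B a 0) with hw
    have hwae : (w : ℝ → ℂ) =ᵐ[volume] fun x => v x - freeSol B a 0 x := by
      rw [hw, ← toL2_sub h2 (memLp_freeSol hBm hBR a 0)]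
      exact toL2_ae (h2.sub (memLp_freeSol hBm hBR a 0))
    have hwn : ‖w‖ₑ ^ 2 = ∫⁻ p, (Set.Ici α).indicator 1 (4 * K * |p|) * ‖a p‖ₑ ^ 2 := by
      have : w = 𝓕⁻ (a - waveOp B 0 0 a) := by
        rw [hw, toL2_freeSol hBm hBR, ha, fourierInv_L2_sub, fourierInv_fourier_eq]
      rw [this, ← ofReal_norm, ← Lp.norm_fourier_eq, fourier_fourierInv_eq, ofReal_norm,
        ← L2_lintegral_sq]
      refine lintegral_congr_ae ?_
      filter_upwards [Lp.coeFn_sub a (waveOp B 0 0 a), waveOp_ae hBm 0 0 a] with p hp hp2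
      rw [hp, Pi.sub_apply, hp2]
      have hiff : p ∈ B ↔ ¬ (α ≤ 4 * K * |p|) := by
        rw [not_le, hB, Set.mem_ofPred_eq, hr, lt_div_iff₀ (by positivity), mul_comm]
      by_cases h : p ∈ B
      · have h' := hiff.1 h
        simp [waveSymb, h, wavePhase, h']
      · have h' : α ≤ 4 * K * |p| := by by_contra hc; exact h (hiff.2 hc)
        simp [waveSymb, h, h']
    rw [← hwn, ← L2_lintegral_sq]
    have hsub : volume {x | α < ‖v x‖}
        ≤ volume {x | ENNReal.ofReal ((α / 2) ^ 2) ≤ ‖w x‖ₑ ^ 2} := by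
      refine measure_mono_ae ?_
      filter_upwards [hwae] with x hx hxα
      change ENNReal.ofReal ((α / 2) ^ 2) ≤ ‖w x‖ₑ ^ 2
      rw [hx, ← ofReal_norm, ← ENNReal.ofReal_pow (norm_nonneg _)]
      refine ENNReal.ofReal_le_ofReal (pow_le_pow_left₀ (by positivity) ?_ 2)
      have h3 : ‖v x‖ - ‖freeSol B a 0 x‖ ≤ ‖v x - freeSol B a 0 x‖ := norm_sub_norm_le _ _
      have h4 := hlo x
      have h5 : α < ‖v x‖ := hxα
      linarith
    have hch := mul_meas_ge_le_lintegral₀ (μ := volume) (f := fun x => ‖w x‖ₑ ^ 2)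
      ((Lp.aestronglyMeasurable w).enorm.pow_const 2) (ENNReal.ofReal ((α / 2) ^ 2))
    have h6 : ENNReal.ofReal (α ^ 2) = 4 * ENNReal.ofReal ((α / 2) ^ 2) := by
      rw [show (4 : ℝ≥0∞) = ENNReal.ofReal 4 by norm_num, ← ENNReal.ofReal_mul (by norm_num)]
      congr 1; ring
    calc volume {x | α < ‖v x‖} * ENNReal.ofReal (α ^ 2)
        ≤ volume {x | ENNReal.ofReal ((α / 2) ^ 2) ≤ ‖w x‖ₑ ^ 2} *
          (4 * ENNReal.ofReal ((α / 2) ^ 2)) := by rw [h6]; gcongr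
      _ = 4 * (ENNReal.ofReal ((α / 2) ^ 2) *
          volume {x | ENNReal.ofReal ((α / 2) ^ 2) ≤ ‖w x‖ₑ ^ 2}) := by ring
      _ ≤ _ := by gcongr
  have hcake := lintegral_rpow_eq_lintegral_meas_lt_mul volume (f := fun x => ‖v x‖)
    (.of_forall fun x => norm_nonneg _) h1.1.norm.aemeasurable (p := 3) (by norm_num)
  have e1 : ∫⁻ x, ‖v x‖ₑ ^ 3 = ∫⁻ x, ENNReal.ofReal (‖v x‖ ^ (3 : ℝ)) := by
    congr 1; ext x
    rw [← ofReal_norm, ← ENNReal.ofReal_pow (norm_nonneg _)]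
    norm_cast
  have ma : Measurable fun p => ‖a p‖ₑ ^ 2 :=
    ((Lp.stronglyMeasurable a).measurable.enorm).pow_const 2
  have e2 : ∫⁻ α in Set.Ioi (0 : ℝ), volume {x | α < ‖v x‖} * ENNReal.ofReal (α ^ ((3 : ℝ) - 1))
      ≤ ∫⁻ α in Set.Ioi (0 : ℝ), 4 * ∫⁻ p, (Set.Ici α).indicator 1 (4 * K * |p|) * ‖a p‖ₑ ^ 2 := by
    refine setLIntegral_mono' measurableSet_Ioi fun α hα => ?_
    refine le_trans (le_of_eq ?_) (level α hα)
    norm_num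
  have mprod : Measurable fun q : ℝ × ℝ =>
      (Set.Ici q.1).indicator (1 : ℝ → ℝ≥0∞) (4 * K * |q.2|) * ‖a q.2‖ₑ ^ 2 := by
    refine Measurable.mul ?_ (ma.comp measurable_snd)
    have : (fun q : ℝ × ℝ => (Set.Ici q.1).indicator (1 : ℝ → ℝ≥0∞) (4 * K * |q.2|))
        = {q : ℝ × ℝ | q.1 ≤ 4 * K * |q.2|}.indicator 1 := by
      ext q; simp [Set.indicator]
    rw [this]
    exact measurable_one.indicator (measurableSet_le (by fun_prop) (by fun_prop))
  have e3 : ∫⁻ α in Set.Ioi (0 : ℝ), 4 * ∫⁻ p, (Set.Ici α).indicator 1 (4 * K * |p|) * ‖a p‖ₑ ^ 2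
      = 4 * ∫⁻ p, ENNReal.ofReal (4 * K * |p|) * ‖a p‖ₑ ^ 2 := by
    rw [lintegral_const_mul _ mprod.lintegral_prod_right',
      lintegral_lintegral_swap mprod.aemeasurable]
    congr 2; ext p
    dsimp only
    rw [lintegral_mul_const]
    · congr 1
      have : (fun α : ℝ => (Set.Ici α).indicator (1 : ℝ → ℝ≥0∞) (4 * K * |p|))
          = (Set.Iic (4 * K * |p|)).indicator 1 := by
        ext α; simp [Set.indicator]
      rw [this, lintegral_indicator_one measurableSet_Iic, Measure.restrict_apply measurableSet_Iic,
        Set.inter_comm, Set.Ioi_inter_Iic, Real.volume_Ioc, sub_zero]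
    · have : (fun α : ℝ => (Set.Ici α).indicator (1 : ℝ → ℝ≥0∞) (4 * K * |p|))
          = (Set.Iic (4 * K * |p|)).indicator 1 := by
        ext α; simp [Set.indicator]
      rw [this]
      exact measurable_one.indicator measurableSet_Iic
  have e4 : ∫⁻ p, ENNReal.ofReal (4 * K * |p|) * ‖a p‖ₑ ^ 2
      = ENNReal.ofReal (4 * K) * ∫⁻ p, ENNReal.ofReal |p| * ‖𝓕 v p‖ₑ ^ 2 := by
    rw [← lintegral_const_mul' _ _ ENNReal.ofReal_ne_top]
    refine lintegral_congr_ae ?_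
    filter_upwards [hav] with p hp
    rw [hp, ENNReal.ofReal_mul (by positivity), mul_assoc]
  rw [e1, hcake, hKe]
  refine (mul_le_mul_right e2 _).trans ?_
  rw [e3, e4, ENNReal.ofReal_mul (by norm_num)]
  apply le_of_eq
  have h3 : ENNReal.ofReal 3 = 3 := by norm_num
  have h4 : ENNReal.ofReal 4 = 4 := by norm_num
  rw [h3, h4]
  ring

/-- **Strichartz estimate** in `L⁶`. By the computation behind the bilinear estimate `|f|²` has
half a derivative in `L²`, which controls `|f|²` in `L³` together with the conserved `L¹` norm. -/
theorem strichartz_six (hJ : MeasurableSet J) {R : ℝ} (hR : ∀ y ∈ J, |y| ≤ R) (a : L2) :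
    ∫⁻ t, ∫⁻ x, ‖freeSol J a t x‖ₑ ^ 6 ≤ 48 * ‖a‖ₑ ^ 6 := by
  have h1 : ∀ t, ∫⁻ x, ‖freeSol J a t x‖ₑ ^ 6
      ≤ 48 * ‖a‖ₑ ^ 2 * ∫⁻ p, ENNReal.ofReal |p| * ‖pairFourier J J a a t p‖ₑ ^ 2 := by
    intro t
    have h2 := lintegral_cube_le (integrable_freeSol_mul hJ hJ hR hR a a t)
      (memLp_freeSol_mul hJ hJ hR hR a a t)
    have h3 : ∀ x, ‖freeSol J a t x * star (freeSol J a t x)‖ₑ = ‖freeSol J a t x‖ₑ ^ 2 := by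
      intro x; rw [enorm_mul, sq]; simp [← ofReal_norm]
    simp only [h3, ← pow_mul] at h2
    refine h2.trans ?_
    gcongr
    · rw [lintegral_freeSol_sq hJ hR, ← ofReal_norm, ← ofReal_norm]
      gcongr
      exact norm_waveOp_le hJ 0 0 a
    · rfl
  refine (lintegral_mono h1).trans ?_
  have hm : Measurable fun t => ∫⁻ p, ENNReal.ofReal |p| * ‖pairFourier J J a a t p‖ₑ ^ 2 := by
    refine Measurable.lintegral_prod_right' (f := fun q : ℝ × ℝ =>
      ENNReal.ofReal |q.2| * ‖pairFourier J J a a q.1 q.2‖ₑ ^ 2) ?_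
    exact (by fun_prop : Measurable fun q : ℝ × ℝ => ENNReal.ofReal |q.2|).mul
      ((measurable_pairFourier hJ hJ hR hR a a).enorm.pow_const 2)
  rw [lintegral_const_mul _ hm]
  have h4 := lintegral_weight_pairFourier_le hJ hJ hR hR a a (k := fun p => ENNReal.ofReal |p|)
    (by fun_prop) (K := 1) (fun p y hp _ _ => by
      rw [← ENNReal.ofReal_mul (abs_nonneg p), ← ENNReal.ofReal_one]
      refine ENNReal.ofReal_le_ofReal ?_
      have hp' : 0 < |p| := abs_pos.2 hp
      rw [mul_one_div, div_le_one (by positivity)]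
      have := Real.pi_gt_three
      nlinarith)
  rw [one_mul] at h4
  calc _ ≤ 48 * ‖a‖ₑ ^ 2 * (‖a‖ₑ ^ 2 * ‖a‖ₑ ^ 2) := by gcongr
    _ = _ := by ring

end

/-! ### Pairings with free solutions -/

section

variable {J J' : Set ℝ}

theorem inner_waveOp_neg (hJ : MeasurableSet J) (t x : ℝ) (a c : L2) :
    inner ℂ a (waveOp J (-t) (-x) c) = inner ℂ (waveOp J t x a) c := by
  rw [L2.inner_def, L2.inner_def]
  refine integral_congr_ae ?_
  filter_upwards [waveOp_ae hJ (-t) (-x) c, waveOp_ae hJ t x a] with y h1 h2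
  rw [h1, h2]
  by_cases hy : y ∈ J <;> simp [waveSymb, hy]
  rw [← Complex.exp_conj]
  have : (starRingEnd ℂ) ((wavePhase t x y : ℝ) * Complex.I)
      = (wavePhase (-t) (-x) y : ℝ) * Complex.I := by
    simp only [wavePhase, map_mul, Complex.conj_ofReal, Complex.conj_I]
    push_cast; ring
  rw [this]; ring

/-- Pairing the low frequencies of a function `P`, seen in the interaction picture, with a fixed
profile is the same as pairing `P` with a free solution. -/
theorem inner_waveOp_fourier (hJ : MeasurableSet J) {R : ℝ} (hR : ∀ y ∈ J, |y| ≤ R)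
    {P : ℝ → ℂ} (hP : MemLp P 2 volume) (a : L2) (t : ℝ) :
    inner ℂ a (waveOp J (-t) 0 (𝓕 (toL2 P))) = ∫ x, P x * star (freeSol J a t x) := by
  have h0 := inner_waveOp_neg hJ t 0 a (𝓕 (toL2 P))
  rw [neg_zero] at h0
  have h1 : inner ℂ (waveOp J t 0 a) (𝓕 (toL2 P) : L2)
      = inner ℂ (𝓕⁻ (waveOp J t 0 a) : L2) (toL2 P) := by
    rw [← Lp.inner_fourier_eq (𝓕⁻ (waveOp J t 0 a)), fourier_fourierInv_eq]
  rw [h0, h1, L2.inner_def]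
  refine integral_congr_ae ?_
  filter_upwards [freeSol_ae hJ hR a t, toL2_ae hP] with x h2 h3
  rw [h2, h3]; rfl

theorem pairFourier_eq_zero (hJ : MeasurableSet J) (hJ' : MeasurableSet J') {R : ℝ}
    (hR : ∀ y ∈ J, |y| ≤ R) (hR' : ∀ y ∈ J', |y| ≤ R) (a a' : L2) (t p : ℝ)
    (h : ∀ y, y + p ∈ J → y ∉ J') : pairFourier J J' a a' t p = 0 := by
  have h1 : corrProfile J J' a a' p = fun _ => 0 := by
    ext y
    by_cases hy : y + p ∈ J
    · simp [corrProfile, h y hy]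
    · simp [corrProfile, hy]
  rw [pairFourier_eq hJ hJ' hR hR', h1, Real.fourier_eq]
  simp

/-- The product `u₁ \bar{u₂} u₃` of band limited functions has no frequencies outside
`J₁ - J₂ + J₃`. -/
theorem integral_freeSol_quadruple_eq_zero {J₀ J₁ J₂ J₃ : Set ℝ} (h₀ : MeasurableSet J₀)
    (h₁ : MeasurableSet J₁) (h₂ : MeasurableSet J₂) (h₃ : MeasurableSet J₃) {R : ℝ}
    (hR₀ : ∀ y ∈ J₀, |y| ≤ R) (hR₁ : ∀ y ∈ J₁, |y| ≤ R) (hR₂ : ∀ y ∈ J₂, |y| ≤ R)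
    (hR₃ : ∀ y ∈ J₃, |y| ≤ R) (a₀ a₁ a₂ a₃ : L2) (t : ℝ)
    (h : ∀ y₁ ∈ J₁, ∀ y₂ ∈ J₂, ∀ y₃ ∈ J₃, y₁ - y₂ + y₃ ∉ J₀) :
    ∫ x, freeSol J₁ a₁ t x * star (freeSol J₂ a₂ t x) * freeSol J₃ a₃ t x *
      star (freeSol J₀ a₀ t x) = 0 := by
  have i1 := integrable_freeSol_mul h₁ h₀ hR₁ hR₀ a₁ a₀ t
  have m1 := memLp_freeSol_mul h₁ h₀ hR₁ hR₀ a₁ a₀ t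
  have i2 := integrable_freeSol_mul h₂ h₃ hR₂ hR₃ a₂ a₃ t
  have m2 := memLp_freeSol_mul h₂ h₃ hR₂ hR₃ a₂ a₃ t
  have e1 : ∫ x, freeSol J₁ a₁ t x * star (freeSol J₂ a₂ t x) * freeSol J₃ a₃ t x *
      star (freeSol J₀ a₀ t x) = inner ℂ (m2.toLp _) (m1.toLp _) := by
    rw [L2.inner_def]
    refine integral_congr_ae ?_
    filter_upwards [m1.coeFn_toLp, m2.coeFn_toLp] with x hx1 hx2
    rw [hx1, hx2]
    simp only [RCLike.inner_apply, map_mul, RCLike.star_def, RCLike.conj_conj]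
    ring
  rw [e1, ← Lp.inner_fourier_eq, L2.inner_def]
  refine (integral_congr_ae (g := fun _ => 0) ?_).trans (by simp)
  filter_upwards [fourier_toLp_ae i1 m1, fourier_toLp_ae i2 m2] with p hp1 hp2
  rw [hp1, hp2]
  change inner ℂ (pairFourier J₂ J₃ a₂ a₃ t p) (pairFourier J₁ J₀ a₁ a₀ t p) = 0
  by_cases hz : ∀ y, y + p ∈ J₂ → y ∉ J₃
  · rw [pairFourier_eq_zero h₂ h₃ hR₂ hR₃ _ _ _ _ hz]; simp
  · push Not at hz
    obtain ⟨y₃, hy₂, hy₃⟩ := hz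
    rw [pairFourier_eq_zero h₁ h₀ hR₁ hR₀ _ _ _ _ ?_]
    · simp
    · intro y₀ hy₁ hy₀
      refine h _ hy₁ _ hy₂ _ hy₃ ?_
      convert! hy₀ using 1
      ring

end

/-! ### Jointly measurable representatives of curves in `L²` -/

/-- A continuous curve in `L²(ℝ)` has a jointly measurable representative. It is the limit of
difference quotients of the primitives, by Lebesgue's differentiation theorem. -/
theorem exists_measurable_version {U : ℝ → L2} (hU : Continuous U) :
    ∃ V : ℝ → ℝ → ℂ, Measurable (Function.uncurry V) ∧ ∀ t, (U t : ℝ → ℂ) =ᵐ[volume] V t := by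
  have hloc : ∀ t, LocallyIntegrable (U t : ℝ → ℂ) volume := fun t =>
    (Lp.memLp (U t)).locallyIntegrable (by norm_num)
  have hint : ∀ t a b, IntervalIntegrable (U t : ℝ → ℂ) volume a b := fun t a b =>
    ((hloc t).integrableOn_isCompact isCompact_uIcc).intervalIntegrable
  set P : ℝ → ℝ → ℂ := fun t y => ∫ z in (0)..y, U t z with hP
  have hPt : ∀ y, Continuous fun t => P t y := by
    intro y
    have hi : ∀ a b : ℝ, Continuous fun t => ∫ z in Set.Ioc a b, U t z := by
      intro a b
      have : ∀ t, ∫ z in Set.Ioc a b, U t z = inner ℂ (indL2 (Set.Ioc a b)) (U t) := by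
        intro t
        rw [L2.inner_def, ← integral_indicator measurableSet_Ioc]
        refine integral_congr_ae ?_
        have hm : MemLp ((Set.Ioc a b).indicator fun _ => (1 : ℂ)) 2 volume :=
          memLp_indicator_const 2 measurableSet_Ioc 1 (.inr (by simp))
        filter_upwards [toL2_ae hm] with z hz
        rw [indL2, hz]
        by_cases h : z ∈ Set.Ioc a b <;> simp only [h, Set.indicator_of_mem,
          Set.indicator_of_notMem, not_false_eq_true, RCLike.inner_apply] <;> simp
      simp only [this]
      exact continuous_const.inner hU
    simp only [hP, intervalIntegral]
    exact (hi _ _).sub (hi _ _)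
  have hPy : ∀ t, Continuous (P t) := fun t =>
    intervalIntegral.continuous_primitive (hint t) 0
  have hPm : Measurable (Function.uncurry P) :=
    (stronglyMeasurable_uncurry_of_continuous_of_stronglyMeasurable hPt
      (fun t => (hPy t).stronglyMeasurable)).measurable
  set D : ℕ → ℝ × ℝ → ℂ := fun n q =>
    ((n : ℂ) + 1) * (P q.1 (q.2 + 1 / ((n : ℝ) + 1)) - P q.1 q.2) with hD
  have hDm : ∀ n, Measurable (D n) := by
    intro n
    refine Measurable.const_mul (Measurable.sub ?_ hPm) _
    exact hPm.comp (by fun_prop : Measurable fun q : ℝ × ℝ => (q.1, q.2 + 1 / ((n : ℝ) + 1)))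
  refine ⟨fun t y => limUnder atTop fun n => D n (t, y), ?_, fun t => ?_⟩
  · exact (StronglyMeasurable.limUnder fun n => (hDm n).stronglyMeasurable).measurable
  · filter_upwards [_root_.LocallyIntegrable.ae_hasDerivAt_integral (hloc t)] with y hy
    symm
    refine Tendsto.limUnder_eq ?_
    have h1 := (hasDerivAt_iff_tendsto_slope.1 (hy 0))
    have h2 : Tendsto (fun n : ℕ => y + 1 / ((n : ℝ) + 1)) atTop (𝓝[≠] y) := by
      refine tendsto_nhdsWithin_iff.2 ⟨?_, .of_forall fun n => ?_⟩
      · simpa using tendsto_const_nhds.add (tendsto_one_div_add_atTop_nhds_zero_nat (𝕜 := ℝ))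
      · have : (0 : ℝ) < 1 / ((n : ℝ) + 1) := by positivity
        simp only [Set.mem_compl_iff, Set.mem_singleton_iff]
        linarith
    refine (h1.comp h2).congr fun n => ?_
    simp only [Function.comp, slope, hD, hP, vsub_eq_sub, add_sub_cancel_left, one_div, inv_inv]
    rw [← Complex.coe_smul]
    push_cast
    rfl

/-- The Bochner integral of an `L²(ℝ)`-valued function is the pointwise integral of a jointly
measurable representative. -/
theorem integral_L2_ae {μ : Measure ℝ} [SFinite μ] {f : ℝ → L2} (hf : Integrable f μ)
    {g : ℝ → ℝ → ℂ} (hg : Measurable (Function.uncurry g))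
    (hfg : ∀ t, (f t : ℝ → ℂ) =ᵐ[volume] g t) :
    (∀ᵐ y, Integrable (fun t => g t y) μ) ∧
      ((∫ t, f t ∂μ : L2) : ℝ → ℂ) =ᵐ[volume] fun y => ∫ t, g t y ∂μ := by
  have key : ∀ s : Set ℝ, MeasurableSet s → volume s < ∞ →
      Integrable (Function.uncurry g) (μ.prod (volume.restrict s)) := by
    intro s hs hs'
    have : IsFiniteMeasure (volume.restrict s) := ⟨by simpa using hs'⟩
    have hb : ∀ t, Integrable (g t) (volume.restrict s) ∧
        ∫⁻ y in s, ‖g t y‖ₑ ≤ ENNReal.ofReal (‖f t‖) * volume s ^ (1 / 2 : ℝ) := by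
      intro t
      have m1 : MemLp (g t) 2 (volume.restrict s) :=
        ((Lp.memLp (f t)).ae_eq (hfg t)).restrict s
      refine ⟨m1.integrable (by norm_num), ?_⟩
      have h1 := eLpNorm_le_eLpNorm_mul_rpow_measure_univ (p := 1) (q := 2) (by norm_num) m1.1
      have he : 1 / ENNReal.toReal 1 - 1 / ENNReal.toReal 2 = 1 / 2 := by norm_num
      rw [eLpNorm_one_eq_lintegral_enorm, he] at h1
      refine h1.trans ?_
      rw [Measure.restrict_apply_univ]
      have h2 : eLpNorm (g t) 2 (volume.restrict s) ≤ ENNReal.ofReal ‖f t‖ := by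
        refine (eLpNorm_restrict_le _ _ _ _).trans ?_
        rw [← eLpNorm_congr_ae (hfg t), ← Lp.enorm_def, ofReal_norm]
      gcongr
    rw [integrable_prod_iff hg.aestronglyMeasurable]
    refine ⟨.of_forall fun t => (hb t).1, ?_⟩
    refine (hf.norm.mul_const ((volume s ^ (1 / 2 : ℝ)).toReal)).mono
      (hg.stronglyMeasurable.norm.integral_prod_right).aestronglyMeasurable (.of_forall fun t => ?_)
    rw [Real.norm_of_nonneg (integral_nonneg fun y => norm_nonneg _),
      Real.norm_of_nonneg (by positivity)]
    have h3 := (hb t).2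
    rw [← ofReal_integral_norm_eq_lintegral_enorm (hb t).1] at h3
    have h4 : volume s ^ (1 / 2 : ℝ) ≠ ∞ := ENNReal.rpow_ne_top_of_nonneg (by norm_num) hs'.ne
    rw [← ENNReal.ofReal_toReal h4, ← ENNReal.ofReal_mul (norm_nonneg _),
      ENNReal.ofReal_le_ofReal_iff (by positivity)] at h3
    simpa using h3
  constructor
  · have h1 : ∀ n : ℕ, ∀ᵐ y, y ∈ Set.Icc (-(n : ℝ)) n → Integrable (fun t => g t y) μ := by
      intro n
      have h2 := (key (Set.Icc (-(n : ℝ)) n) measurableSet_Icc measure_Icc_lt_top).prod_left_ae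
      exact (ae_restrict_iff' measurableSet_Icc).1 h2
    filter_upwards [ae_all_iff.2 h1] with y hy
    obtain ⟨n, hn⟩ := exists_nat_ge |y|
    exact hy n (abs_le.1 hn)
  · refine ae_eq_of_forall_setIntegral_eq_of_sigmaFinite (fun s hs hs' => ?_) (fun s hs hs' => ?_)
      (fun s hs hs' => ?_)
    · have : IsFiniteMeasure (volume.restrict s) := ⟨by simpa using hs'⟩
      exact ((Lp.memLp _).restrict s).integrable (by norm_num)
    · exact (key s hs hs').integral_prod_right
    · have hin : ∀ a : L2, ∀ c : ℝ → ℂ, (a : ℝ → ℂ) =ᵐ[volume] c →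
          ∫ y in s, c y = inner ℂ (indicatorConstLp 2 hs hs'.ne (1 : ℂ)) a := by
        intro a c hac
        rw [L2.inner_indicatorConstLp_one]
        exact (integral_congr_ae (ae_restrict_of_ae hac)).symm
      rw [hin _ _ (ae_eq_refl _)]
      have h5 : ∫ y in s, ∫ t, g t y ∂μ = ∫ t, (∫ y in s, g t y) ∂μ :=
        (integral_integral_swap (key s hs hs')).symm
      rw [h5]
      have h6 : ∀ t, ∫ y in s, g t y = innerSL ℂ (indicatorConstLp 2 hs hs'.ne (1 : ℂ)) (f t) :=
        fun t => hin _ _ (hfg t)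
      simp only [h6]
      rw [ContinuousLinearMap.integral_comp_comm _ hf]
      rfl

/-! ### The Bourgain norm in the interaction picture -/

/-- The frequencies `|2πy| ≤ N`, on which `lowFreq N` projects. -/
def freqSet (N : ℝ) : Set ℝ := {y | |2 * Real.pi * y| ≤ N}

theorem measurableSet_freqSet (N : ℝ) : MeasurableSet (freqSet N) :=
  measurableSet_le (by fun_prop) measurable_const

theorem abs_le_of_mem_freqSet {N y : ℝ} (h : y ∈ freqSet N) : |y| ≤ N := by
  have h1 : |2 * Real.pi * y| ≤ N := h
  rw [abs_mul, abs_of_pos Real.two_pi_pos] at h1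
  have := Real.pi_gt_three
  nlinarith [abs_nonneg y]

/-- The curve `t ↦ e^{i(2πy)²t} 1_{|2πy| ≤ N} U(t)`, that is, `U` at low frequencies in the
interaction picture of the free evolution. -/
def profile (N : ℝ) (U : ℝ → L2) (t : ℝ) : L2 := waveOp (freqSet N) (-t) 0 (U t)

/-- The profile of `U` localized to times of size `δ` around `δ t₀`. -/
def localProfile (η : ℝ → ℂ) (δ t₀ N : ℝ) (U : ℝ → L2) (t : ℝ) : L2 :=
  η (t / δ - t₀) • profile N U t

/-- The time Fourier transform of the localized profile. -/
def localSpec (η : ℝ → ℂ) (δ t₀ N : ℝ) (U : ℝ → L2) : ℝ → L2 := 𝓕 (localProfile η δ t₀ N U)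

theorem continuous_profile (N : ℝ) {U : ℝ → L2} (hU : Continuous U) :
    Continuous (profile N U) := by
  have h := (continuous_waveOp (measurableSet_freqSet N) (fun y => abs_le_of_mem_freqSet)).comp
    (by fun_prop : Continuous fun t : ℝ => (-t, (0 : ℝ)))
  exact h.clm_apply hU

theorem hasCompactSupport_cutoff {η : ℝ → ℂ} (hηc : HasCompactSupport η) {δ : ℝ} (hδ : 0 < δ)
    (t₀ : ℝ) : HasCompactSupport fun t => η (t / δ - t₀) := by
  have h := hηc.comp_homeomorph ((Homeomorph.mulRight₀ δ⁻¹ (inv_ne_zero hδ.ne')).trans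
    (Homeomorph.addRight (-t₀)))
  exact h

theorem hasCompactSupport_localProfile {η : ℝ → ℂ} (hηc : HasCompactSupport η) {δ : ℝ}
    (hδ : 0 < δ) (t₀ N : ℝ) (U : ℝ → L2) : HasCompactSupport (localProfile η δ t₀ N U) :=
  (hasCompactSupport_cutoff hηc hδ t₀).smul_right

theorem continuous_localProfile {η : ℝ → ℂ} (hη : Continuous η) (δ t₀ N : ℝ) {U : ℝ → L2}
    (hU : Continuous U) : Continuous (localProfile η δ t₀ N U) :=
  (hη.comp (by fun_prop : Continuous fun t : ℝ => t / δ - t₀)).smul (continuous_profile N hU)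

theorem integrable_localProfile {η : ℝ → ℂ} (hη : Continuous η) (hηc : HasCompactSupport η)
    {δ : ℝ} (hδ : 0 < δ) (t₀ N : ℝ) {U : ℝ → L2} (hU : Continuous U) :
    Integrable (localProfile η δ t₀ N U) :=
  (continuous_localProfile hη δ t₀ N hU).integrable_of_hasCompactSupport
    (hasCompactSupport_localProfile hηc hδ t₀ N U)

/-- The dilation `a(y) ↦ a(y/lam)` on `L²`. -/
def dilL2 (lam : ℝ) (a : L2) : L2 := toL2 fun y => a (y / lam)

theorem quasiMeasurePreserving_div {lam : ℝ} (hl : 0 < lam) :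
    Measure.QuasiMeasurePreserving (fun y : ℝ => y / lam) volume volume := by
  refine ⟨by fun_prop, ?_⟩
  have : (fun y : ℝ => y / lam) = fun y => lam⁻¹ * y := by ext y; rw [div_eq_inv_mul]
  rw [this, Real.map_volume_mul_left (inv_ne_zero hl.ne')]
  exact Measure.smul_absolutelyContinuous

theorem lintegral_comp_div (f : ℝ → ℝ≥0∞) {c : ℝ} (hc : 0 < c) :
    ∫⁻ x, f (x / c) = ENNReal.ofReal c * ∫⁻ x, f x := by
  have h := lintegral_comp_mul_left f (inv_ne_zero hc.ne')
  rw [inv_inv, abs_of_pos hc] at h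
  rw [← h]
  congr 1; ext x; rw [div_eq_inv_mul]

theorem memLp_comp_div (a : L2) {lam : ℝ} (hl : 0 < lam) :
    MemLp (fun y => a (y / lam)) 2 volume := by
  refine ⟨(Lp.aestronglyMeasurable a).comp_quasiMeasurePreserving
    (quasiMeasurePreserving_div hl), ?_⟩
  rw [eLpNorm_lt_top_iff_lintegral_rpow_enorm_lt_top (by norm_num) (by norm_num)]
  have h := lintegral_comp_div (fun y => ‖a y‖ₑ ^ 2) hl
  rw [L2_lintegral_sq] at h
  simp only [ENNReal.toReal_ofNat, ENNReal.rpow_ofNat]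
  rw [h]
  exact ENNReal.mul_lt_top ENNReal.ofReal_lt_top (by simp)

theorem dilL2_ae (a : L2) {lam : ℝ} (hl : 0 < lam) :
    (dilL2 lam a : ℝ → ℂ) =ᵐ[volume] fun y => a (y / lam) := toL2_ae (memLp_comp_div a hl)

theorem enorm_dilL2_sub_sq (a c : L2) {lam : ℝ} (hl : 0 < lam) :
    ‖dilL2 lam a - dilL2 lam c‖ₑ ^ 2 = ENNReal.ofReal lam * ‖a - c‖ₑ ^ 2 := by
  rw [← L2_lintegral_sq, ← L2_lintegral_sq, ← lintegral_comp_div _ hl]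
  refine lintegral_congr_ae ?_
  have h := (quasiMeasurePreserving_div hl).ae_eq_comp (Lp.coeFn_sub a c)
  filter_upwards [dilL2_ae a hl, dilL2_ae c hl, Lp.coeFn_sub (dilL2 lam a) (dilL2 lam c), h]
    with y h1 h2 h3 h4
  simp only [Function.comp] at h4
  rw [h3, h4, Pi.sub_apply, Pi.sub_apply, h1, h2]

theorem continuous_dilL2 {lam : ℝ} (hl : 0 < lam) : Continuous (dilL2 lam) := by
  refine (LipschitzWith.of_dist_le_mul (K := ⟨Real.sqrt lam, Real.sqrt_nonneg _⟩)
    fun a c => ?_).continuous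
  rw [dist_eq_norm, dist_eq_norm]
  have h := enorm_dilL2_sub_sq a c hl
  rw [← ofReal_norm, ← ofReal_norm, ← ENNReal.ofReal_pow (norm_nonneg _),
    ← ENNReal.ofReal_pow (norm_nonneg _), ← ENNReal.ofReal_mul hl.le,
    ENNReal.ofReal_eq_ofReal_iff (by positivity) (by positivity)] at h
  have h2 : ‖dilL2 lam a - dilL2 lam c‖ = Real.sqrt (lam * ‖a - c‖ ^ 2) := by
    rw [← h, Real.sqrt_sq (norm_nonneg _)]
  rw [h2, Real.sqrt_mul hl.le, Real.sqrt_sq (norm_nonneg _)]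
  rfl

theorem lowFreq_ae (N : ℝ) (f : ℝ → ℂ) :
    lowFreq N f =ᵐ[volume] freeSol (freqSet N) (𝓕 (toL2 f)) 0 := by
  have h : toL2 ({y : ℝ | |2 * Real.pi * y| ≤ N}.indicator
      (𝓕 (toL2 f) : Lp ℂ 2 (volume : Measure ℝ))) = waveOp (freqSet N) 0 0 (𝓕 (toL2 f)) := by
    rw [← toL2_coe (waveOp (freqSet N) 0 0 (𝓕 (toL2 f)))]
    refine toL2_congr (memLp_indicator (measurableSet_freqSet N) _) ?_
    filter_upwards [waveOp_ae (measurableSet_freqSet N) 0 0 (𝓕 (toL2 f))] with y hy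
    rw [hy]
    change (freqSet N).indicator _ y = _
    by_cases h : y ∈ freqSet N <;> simp [waveSymb, wavePhase, h]
  unfold lowFreq
  rw [h]
  exact freeSol_ae (measurableSet_freqSet N) (fun y => abs_le_of_mem_freqSet) _ 0

theorem mem_freqSet_div {N lam y : ℝ} (hl : 0 < lam) :
    y / lam ∈ freqSet N ↔ y ∈ freqSet (lam * N) := by
  unfold freqSet
  simp only [Set.mem_ofPred_eq]
  rw [← mul_div_assoc, abs_div, abs_of_pos hl, div_le_iff₀ hl, mul_comm N]

theorem freeSol_dilation (N : ℝ) {lam : ℝ} (hl : 0 < lam) (a : L2) (x : ℝ) :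
    (lam : ℂ) * freeSol (freqSet N) a 0 (lam * x)
      = freeSol (freqSet (lam * N)) (dilL2 lam a) 0 x := by
  unfold freeSol
  have h1 : ∫ y, waveSymb (freqSet (lam * N)) 0 x y * dilL2 lam a y
      = ∫ y, (fun z => waveSymb (freqSet N) 0 (lam * x) z * a z) (y / lam) := by
    refine integral_congr_ae ?_
    filter_upwards [dilL2_ae a hl] with y hy
    rw [hy]
    congr 1
    by_cases h : y ∈ freqSet (lam * N)
    · have h' := (mem_freqSet_div hl).2 h
      simp only [waveSymb, h, h', Set.indicator_of_mem, wavePhase]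
      congr 2
      congr 1
      field_simp
      ring
    · have h' := mt (mem_freqSet_div hl).1 h
      simp [waveSymb, h, h']
  have h2 := Measure.integral_comp_div
    (fun z => waveSymb (freqSet N) 0 (lam * x) z * a z) lam
  rw [h1, h2, abs_of_pos hl, Complex.real_smul]

/-- The spatial Fourier transform of the localized, rescaled low frequency part of `u`. -/
theorem fourier_scaled_lowFreq {u : ℝ → ℝ → ℂ} (η : ℝ → ℂ) (t₀ N : ℝ) {lam : ℝ} (hl : 0 < lam)
    (t : ℝ) :
    (𝓕 (toL2 fun x => η (t - t₀) * scaling lam (fun t' => lowFreq N (u t')) t x) : L2)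
      = η (t - t₀) • waveOp (freqSet (lam * N)) 0 0
        (dilL2 lam (𝓕 (toL2 (u (lam ^ 2 * t))))) := by
  set a : L2 := 𝓕 (toL2 (u (lam ^ 2 * t))) with ha
  have hm := measurableSet_freqSet (lam * N)
  have hR : ∀ y ∈ freqSet (lam * N), |y| ≤ lam * N := fun y => abs_le_of_mem_freqSet
  have h1 : (fun x => η (t - t₀) * scaling lam (fun t' => lowFreq N (u t')) t x)
      =ᵐ[volume] (η (t - t₀) • (𝓕⁻ (waveOp (freqSet (lam * N)) 0 0 (dilL2 lam a)) : L2) : L2) := by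
    have hq : Measure.QuasiMeasurePreserving (fun x : ℝ => lam * x) volume volume := by
      refine ⟨by fun_prop, ?_⟩
      rw [Real.map_volume_mul_left hl.ne']
      exact Measure.smul_absolutelyContinuous
    have h2 := hq.ae_eq_comp (lowFreq_ae N (u (lam ^ 2 * t)))
    filter_upwards [h2, freeSol_ae hm hR (dilL2 lam a) 0, Lp.coeFn_smul (η (t - t₀))
      (𝓕⁻ (waveOp (freqSet (lam * N)) 0 0 (dilL2 lam a)) : L2)] with x h3 h4 h5
    simp only [Function.comp] at h3
    rw [h5, Pi.smul_apply, h4, ← freeSol_dilation N hl, smul_eq_mul]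
    simp only [scaling]
    rw [h3]
  rw [← toL2_congr (Lp.memLp _) h1.symm, toL2_coe, FourierTransform.fourier_smul,
    fourier_fourierInv_eq]

/-- Bourgain's norm of the localized rescaled function in terms of the interaction picture. The
shift of the time frequency by `(2πy)²` turns the weight `⟨τ + ξ²⟩` into a weight that does not
depend on the spatial frequency. -/
theorem bourgainNorm_sq {u : ℝ → ℝ → ℂ} (hU : Continuous fun t => (𝓕 (toL2 (u t)) : L2))
    {η : ℝ → ℂ} (hη : Continuous η) (hηc : HasCompactSupport η) (b t₀ N : ℝ) {lam : ℝ}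
    (hl : 0 < lam) :
    bourgainNorm 0 b (fun t x => η (t - t₀) * scaling lam (fun t' => lowFreq N (u t')) t x) ^ 2
      = ENNReal.ofReal ((2 * Real.pi) ^ 2 / lam) *
        ∫⁻ σ, ENNReal.ofReal (bracket (2 * Real.pi * lam ^ 2 * σ) ^ (2 * b)) *
          ‖localSpec η (lam ^ 2) t₀ N (fun t => 𝓕 (toL2 (u t))) σ‖ₑ ^ 2 := by
  set U : ℝ → L2 := fun t => 𝓕 (toL2 (u t)) with hUdef
  obtain ⟨V, hVm, hV⟩ := exists_measurable_version hU
  set A := freqSet N with hA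
  have hAm : MeasurableSet A := measurableSet_freqSet N
  have hδ : 0 < lam ^ 2 := by positivity
  -- the time Fourier transform of the jointly measurable version
  set Φ : ℝ → ℝ → ℂ := fun τ y => ∫ t : ℝ, Complex.exp ((-(2 * Real.pi * t * τ) : ℝ) * Complex.I) *
    (η (t / lam ^ 2 - t₀) * (A.indicator (V t) y)) with hΦ
  have hΦm : Measurable (Function.uncurry Φ) := by
    have : StronglyMeasurable fun q : ℝ × ℝ => ∫ t : ℝ,
        Complex.exp ((-(2 * Real.pi * t * q.1) : ℝ) * Complex.I) *
          (η (t / lam ^ 2 - t₀) * (A.indicator (V t) q.2)) := by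
      refine StronglyMeasurable.integral_prod_right (f := fun (q : ℝ × ℝ) (t : ℝ) =>
        Complex.exp ((-(2 * Real.pi * t * q.1) : ℝ) * Complex.I) *
          (η (t / lam ^ 2 - t₀) * (A.indicator (V t) q.2))) ?_
      apply Measurable.stronglyMeasurable
      refine Measurable.mul (by fun_prop) (Measurable.mul ?_ ?_)
      · exact hη.measurable.comp (by fun_prop)
      · have h : (fun q : (ℝ × ℝ) × ℝ => A.indicator (V q.2) q.1.2)
            = ((fun q : (ℝ × ℝ) × ℝ => q.1.2) ⁻¹' A).indicator
              (fun q => Function.uncurry V (q.2, q.1.2)) := by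
          ext q; rfl
        change Measurable fun q : (ℝ × ℝ) × ℝ => A.indicator (V q.2) q.1.2
        rw [h]
        exact (hVm.comp (by fun_prop)).indicator (hAm.preimage (by fun_prop))
    exact this.measurable
  -- the space-time Fourier transform
  have h1 : ∀ τ : ℝ, ∀ᵐ ξ : ℝ, spaceTimeFourier
      (fun t x => η (t - t₀) * scaling lam (fun t' => lowFreq N (u t')) t x) ξ τ
      = ((lam ^ 2)⁻¹ : ℝ) * Φ (τ / (2 * Real.pi * lam ^ 2)) (ξ / (2 * Real.pi * lam)) := by
    intro τ
    set f : ℝ → L2 := fun t => Complex.exp (-(Complex.I * t * τ)) •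
      (η (t - t₀) • waveOp (freqSet (lam * N)) 0 0 (dilL2 lam (U (lam ^ 2 * t)))) with hf
    set g : ℝ → ℝ → ℂ := fun t y => Complex.exp (-(Complex.I * t * τ)) *
      (η (t - t₀) * A.indicator (V (lam ^ 2 * t)) (y / lam)) with hg
    have hfi : Integrable f := by
      have hc1 : Continuous fun t => waveOp (freqSet (lam * N)) 0 0 (dilL2 lam (U (lam ^ 2 * t))) :=
        (waveOp _ 0 0).continuous.comp ((continuous_dilL2 hl).comp (hU.comp (by fun_prop)))
      have hc2 : Continuous fun t => η (t - t₀) := hη.comp (by fun_prop)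
      have hs2 : HasCompactSupport fun t => η (t - t₀) := by
        simpa using hasCompactSupport_cutoff hηc one_pos t₀
      have hc0 : Continuous fun t : ℝ => Complex.exp (-(Complex.I * t * τ)) := by fun_prop
      have hf' : f = (fun t : ℝ => Complex.exp (-(Complex.I * t * τ))) • ((fun t => η (t - t₀)) •
        fun t => waveOp (freqSet (lam * N)) 0 0 (dilL2 lam (U (lam ^ 2 * t)))) := rfl
      rw [hf']
      exact (hc0.smul (hc2.smul hc1)).integrable_of_hasCompactSupport hs2.smul_right.smul_left
    have hgm : Measurable (Function.uncurry g) := by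
      refine Measurable.mul (by fun_prop) (Measurable.mul ?_ ?_)
      · exact hη.measurable.comp (by fun_prop)
      · have h : (fun q : ℝ × ℝ => A.indicator (V (lam ^ 2 * q.1)) (q.2 / lam))
            = ((fun q : ℝ × ℝ => q.2 / lam) ⁻¹' A).indicator
              (fun q => Function.uncurry V (lam ^ 2 * q.1, q.2 / lam)) := by
          ext q; rfl
        change Measurable fun q : ℝ × ℝ => A.indicator (V (lam ^ 2 * q.1)) (q.2 / lam)
        rw [h]
        exact (hVm.comp (by fun_prop)).indicator (hAm.preimage (by fun_prop))
    have hfg : ∀ t, (f t : ℝ → ℂ) =ᵐ[volume] g t := by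
      intro t
      have hq := (quasiMeasurePreserving_div hl).ae_eq_comp (hV (lam ^ 2 * t))
      filter_upwards [Lp.coeFn_smul (Complex.exp (-(Complex.I * t * τ)))
          (η (t - t₀) • waveOp (freqSet (lam * N)) 0 0 (dilL2 lam (U (lam ^ 2 * t)))),
        Lp.coeFn_smul (η (t - t₀)) (waveOp (freqSet (lam * N)) 0 0 (dilL2 lam (U (lam ^ 2 * t)))),
        waveOp_ae (measurableSet_freqSet (lam * N)) 0 0 (dilL2 lam (U (lam ^ 2 * t))),
        dilL2_ae (U (lam ^ 2 * t)) hl, hq] with y e1 e2 e3 e4 e5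
      simp only [Function.comp] at e5
      rw [hf, e1, Pi.smul_apply, e2, Pi.smul_apply, e3, e4, e5, smul_eq_mul, smul_eq_mul, hg]
      by_cases h : y ∈ freqSet (lam * N)
      · have h' := (mem_freqSet_div hl).2 h
        simp [waveSymb, wavePhase, h, hA, h']
      · have h' := mt (mem_freqSet_div hl).1 h
        simp [waveSymb, h, hA, h']
    have hI := (integral_L2_ae hfi hgm hfg).2
    have hI2 := (quasiMeasurePreserving_div Real.two_pi_pos).ae_eq_comp hI
    filter_upwards [hI2] with ξ hξ
    simp only [Function.comp] at hξ
    unfold spaceTimeFourier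
    simp only [fourier_scaled_lowFreq η t₀ N hl]
    rw [hξ]
    have e6 : ∀ t : ℝ, g t (ξ / (2 * Real.pi)) = (fun s : ℝ =>
        Complex.exp ((-(2 * Real.pi * s * (τ / (2 * Real.pi * lam ^ 2))) : ℝ) * Complex.I) *
          (η (s / lam ^ 2 - t₀) * (A.indicator (V s) (ξ / (2 * Real.pi * lam)))))
            (lam ^ 2 * t) := by
      intro t
      simp only [hg]
      rw [div_div, mul_div_cancel_left₀ _ hδ.ne']
      congr 2
      have : 2 * Real.pi * (lam ^ 2 * t) * (τ / (2 * Real.pi * lam ^ 2)) = t * τ := by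
        have := Real.pi_pos
        field_simp
      rw [this]; push_cast; ring
    simp_rw [e6]
    rw [Measure.integral_comp_mul_left (fun s : ℝ =>
        Complex.exp ((-(2 * Real.pi * s * (τ / (2 * Real.pi * lam ^ 2))) : ℝ) * Complex.I) *
          (η (s / lam ^ 2 - t₀) * (A.indicator (V s) (ξ / (2 * Real.pi * lam))))),
      abs_of_pos (by positivity), Complex.real_smul]
  -- the frequency variables are rescaled
  have h2 : bourgainNorm 0 b
      (fun t x => η (t - t₀) * scaling lam (fun t' => lowFreq N (u t')) t x) ^ 2
      = ∫⁻ τ : ℝ, ∫⁻ ξ : ℝ, ENNReal.ofReal ((lam ^ 2)⁻¹ ^ 2) *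
        (‖Φ (τ / (2 * Real.pi * lam ^ 2)) (ξ / (2 * Real.pi * lam))‖ₑ ^ 2 *
          ENNReal.ofReal (bracket (τ + ξ ^ 2) ^ (2 * b))) := by
    unfold bourgainNorm
    rw [← ENNReal.rpow_natCast, ← ENNReal.rpow_mul]
    norm_num only [ENNReal.rpow_one]
    refine lintegral_congr fun τ => lintegral_congr_ae ?_
    filter_upwards [h1 τ] with ξ hξ
    rw [hξ, enorm_mul, mul_pow, mul_assoc]
    congr 1
    · rw [← ofReal_norm, Complex.norm_real, Real.norm_of_nonneg (by positivity),
        ENNReal.ofReal_pow (by positivity)]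
    · simp
  have h3 : ∀ τ : ℝ, ∫⁻ ξ : ℝ, ENNReal.ofReal ((lam ^ 2)⁻¹ ^ 2) *
        (‖Φ (τ / (2 * Real.pi * lam ^ 2)) (ξ / (2 * Real.pi * lam))‖ₑ ^ 2 *
          ENNReal.ofReal (bracket (τ + ξ ^ 2) ^ (2 * b)))
      = (fun τ' => ENNReal.ofReal ((lam ^ 2)⁻¹ ^ 2) * (ENNReal.ofReal (2 * Real.pi * lam) *
        ∫⁻ y, ‖Φ τ' y‖ₑ ^ 2 * ENNReal.ofReal
          (bracket (2 * Real.pi * lam ^ 2 * (τ' + 2 * Real.pi * y ^ 2)) ^ (2 * b))))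
        (τ / (2 * Real.pi * lam ^ 2)) := by
    intro τ
    rw [lintegral_const_mul' _ _ ENNReal.ofReal_ne_top]
    dsimp only
    have hpos : 0 < 2 * Real.pi * lam := by positivity
    rw [← lintegral_comp_div _ hpos]
    congr 1
    refine lintegral_congr fun ξ => ?_
    congr 4
    have := Real.pi_pos
    field_simp
  have hw : Measurable fun q : ℝ × ℝ => ‖Φ q.1 q.2‖ₑ ^ 2 * ENNReal.ofReal
          (bracket (2 * Real.pi * lam ^ 2 * (q.1 + 2 * Real.pi * q.2 ^ 2)) ^ (2 * b)) := by
    refine (hΦm.enorm.pow_const 2).mul (Measurable.ennreal_ofReal ?_)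
    unfold bracket
    exact Measurable.pow_const (by fun_prop) _
  have h4 : ∫⁻ τ, ∫⁻ y, ‖Φ τ y‖ₑ ^ 2 * ENNReal.ofReal
          (bracket (2 * Real.pi * lam ^ 2 * (τ + 2 * Real.pi * y ^ 2)) ^ (2 * b))
      = ∫⁻ σ, ∫⁻ y, ‖Φ (σ - 2 * Real.pi * y ^ 2) y‖ₑ ^ 2 * ENNReal.ofReal
          (bracket (2 * Real.pi * lam ^ 2 * σ) ^ (2 * b)) := by
    rw [lintegral_lintegral_swap hw.aemeasurable]
    symm
    rw [lintegral_lintegral_swap]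
    · refine lintegral_congr fun y => ?_
      rw [← lintegral_sub_right_eq_self (fun τ => ‖Φ τ y‖ₑ ^ 2 * ENNReal.ofReal
        (bracket (2 * Real.pi * lam ^ 2 * (τ + 2 * Real.pi * y ^ 2)) ^ (2 * b)))
        (2 * Real.pi * y ^ 2)]
      simp only [sub_add_cancel]
    · have := hw.comp (by fun_prop : Measurable fun q : ℝ × ℝ => (q.1 - 2 * Real.pi * q.2 ^ 2, q.2))
      simp only [Function.comp_def, sub_add_cancel] at this
      exact this.aemeasurable
  -- the interaction picture
  have h5 : ∀ σ, ‖localSpec η (lam ^ 2) t₀ N U σ‖ₑ ^ 2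
      = ∫⁻ y, ‖Φ (σ - 2 * Real.pi * y ^ 2) y‖ₑ ^ 2 := by
    intro σ
    rw [← L2_lintegral_sq]
    refine lintegral_congr_ae ?_
    set f : ℝ → L2 := fun t => Complex.exp (((-2 * Real.pi * inner ℝ t σ : ℝ) : ℂ) * Complex.I) •
      localProfile η (lam ^ 2) t₀ N U t with hf
    set g : ℝ → ℝ → ℂ := fun t y =>
      Complex.exp ((-(2 * Real.pi * t * (σ - 2 * Real.pi * y ^ 2)) : ℝ) * Complex.I) *
        (η (t / lam ^ 2 - t₀) * A.indicator (V t) y) with hg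
    have hfi : Integrable f := by
      have hc0 : Continuous fun t : ℝ =>
          Complex.exp (((-2 * Real.pi * inner ℝ t σ : ℝ) : ℂ) * Complex.I) := by fun_prop
      have hf' : f = (fun t : ℝ => Complex.exp (((-2 * Real.pi * inner ℝ t σ : ℝ) : ℂ) *
        Complex.I)) • localProfile η (lam ^ 2) t₀ N U := rfl
      rw [hf']
      exact (hc0.smul (continuous_localProfile hη _ t₀ N hU)).integrable_of_hasCompactSupport
        (hasCompactSupport_localProfile hηc hδ t₀ N U).smul_left
    have hgm : Measurable (Function.uncurry g) := by
      refine Measurable.mul (by fun_prop) (Measurable.mul ?_ ?_)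
      · exact hη.measurable.comp (by fun_prop)
      · have h : (fun q : ℝ × ℝ => A.indicator (V q.1) q.2)
            = ((fun q : ℝ × ℝ => q.2) ⁻¹' A).indicator (Function.uncurry V) := by
          ext q; rfl
        change Measurable fun q : ℝ × ℝ => A.indicator (V q.1) q.2
        rw [h]
        exact hVm.indicator (hAm.preimage (by fun_prop))
    have hfg : ∀ t, (f t : ℝ → ℂ) =ᵐ[volume] g t := by
      intro t
      filter_upwards [
          Lp.coeFn_smul (Complex.exp (((-2 * Real.pi * inner ℝ t σ : ℝ) : ℂ) * Complex.I))
          (localProfile η (lam ^ 2) t₀ N U t),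
        Lp.coeFn_smul (η (t / lam ^ 2 - t₀)) (profile N U t),
        waveOp_ae hAm (-t) 0 (U t), hV t] with y e1 e2 e3 e4
      rw [hf, e1, Pi.smul_apply, localProfile, e2, Pi.smul_apply, profile, e3, e4, smul_eq_mul,
        smul_eq_mul, hg]
      by_cases h : y ∈ A
      · simp only [waveSymb, h, Set.indicator_of_mem]
        have e5 : Complex.exp ((-(2 * Real.pi * t * (σ - 2 * Real.pi * y ^ 2)) : ℝ) * Complex.I)
            = Complex.exp (((-2 * Real.pi * inner ℝ t σ : ℝ) : ℂ) * Complex.I) *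
              Complex.exp ((wavePhase (-t) 0 y : ℝ) * Complex.I) := by
          rw [← Complex.exp_add]
          congr 1
          simp only [wavePhase, RCLike.inner_apply, conj_trivial]
          push_cast; ring
        rw [e5]; ring
      · simp [waveSymb, h]
    have hI := (integral_L2_ae hfi hgm hfg).2
    have e7 : localSpec η (lam ^ 2) t₀ N U σ = ∫ t, f t := by
      rw [localSpec, Real.fourier_eq']
      rfl
    rw [e7]
    filter_upwards [hI] with y hy
    rw [hy]
  rw [h2]
  simp only [h3]
  have hpos : 0 < 2 * Real.pi * lam ^ 2 := by positivity
  rw [lintegral_comp_div (fun τ' => ENNReal.ofReal ((lam ^ 2)⁻¹ ^ 2) *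
    (ENNReal.ofReal (2 * Real.pi * lam) * ∫⁻ y, ‖Φ τ' y‖ₑ ^ 2 * ENNReal.ofReal
      (bracket (2 * Real.pi * lam ^ 2 * (τ' + 2 * Real.pi * y ^ 2)) ^ (2 * b)))) hpos,
    lintegral_const_mul' _ _ ENNReal.ofReal_ne_top, lintegral_const_mul' _ _ ENNReal.ofReal_ne_top,
    h4, ← mul_assoc, ← mul_assoc, ← ENNReal.ofReal_mul (by positivity),
    ← ENNReal.ofReal_mul (by positivity)]
  congr 1
  · congr 1
    field_simp
  · refine lintegral_congr fun σ => ?_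
    rw [h5, lintegral_mul_const' _ _ ENNReal.ofReal_ne_top, mul_comm]

/-! ### Superpositions of free solutions -/

section

theorem sq_lintegral_mul_le {α : Type*} [MeasurableSpace α] {μ : Measure α} {f g : α → ℝ≥0∞}
    (hf : AEMeasurable f μ) (hg : AEMeasurable g μ) :
    (∫⁻ a, f a * g a ∂μ) ^ 2 ≤ (∫⁻ a, f a ^ 2 ∂μ) * ∫⁻ a, g a ^ 2 ∂μ := by
  have h := ENNReal.lintegral_mul_le_Lp_mul_Lq μ Real.HolderConjugate.two_two hf hg
  calc (∫⁻ a, f a * g a ∂μ) ^ 2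
      ≤ ((∫⁻ a, f a ^ (2 : ℝ) ∂μ) ^ (1 / 2 : ℝ) * (∫⁻ a, g a ^ (2 : ℝ) ∂μ) ^ (1 / 2 : ℝ)) ^ 2 := by
        gcongr; exact h
    _ = _ := by
        rw [mul_pow, ← ENNReal.rpow_natCast, ← ENNReal.rpow_mul, ← ENNReal.rpow_natCast,
          ← ENNReal.rpow_mul]
        norm_num

theorem lintegral_superposition_mul {Z : Type*} [MeasurableSpace Z] {ν : Measure Z} [SFinite ν]
    {W : ℝ → ℝ≥0∞} (hW : Measurable W) {F : ℝ → Z → ℝ≥0∞} (hF : Measurable (Function.uncurry F))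
    {H : Z → ℝ≥0∞} (hH : Measurable H) :
    ∫⁻ z, (∫⁻ σ, W σ * F σ z) * H z ∂ν = ∫⁻ σ, W σ * ∫⁻ z, F σ z * H z ∂ν := by
  have hWF : Measurable fun q : ℝ × Z => W q.1 * F q.1 q.2 := (hW.comp measurable_fst).mul hF
  have e1 : ∀ z, (∫⁻ σ, W σ * F σ z) * H z = ∫⁻ σ, W σ * F σ z * H z := fun z =>
    (lintegral_mul_const _ (hWF.comp (by fun_prop : Measurable fun σ : ℝ => (σ, z)))).symm
  simp only [e1]
  have hWFH : Measurable fun q : Z × ℝ => W q.2 * F q.2 q.1 * H q.1 :=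
    (hWF.comp measurable_swap).mul (hH.comp measurable_fst)
  rw [lintegral_lintegral_swap hWFH.aemeasurable]
  refine lintegral_congr fun σ => ?_
  have hFH : Measurable fun z => F σ z * H z :=
    (hF.comp (by fun_prop : Measurable fun z : Z => (σ, z))).mul hH
  rw [← lintegral_const_mul _ hFH]
  simp only [mul_assoc]

/-- A bound for the functions `F σ`, in terms of `n σ`, passes to their superposition. -/
theorem lintegral_superposition_mul_le {Z : Type*} [MeasurableSpace Z] {ν : Measure Z} [SFinite ν]
    {W : ℝ → ℝ≥0∞} (hW : Measurable W) {F : ℝ → Z → ℝ≥0∞} (hF : Measurable (Function.uncurry F))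
    {H : Z → ℝ≥0∞} (hH : Measurable H) {n : ℝ → ℝ≥0∞} (hn : Measurable n) {k X : ℝ≥0∞}
    (h : ∀ σ, ∫⁻ z, F σ z * H z ∂ν ≤ k * n σ) (hX : ∫⁻ σ, W σ * n σ ≤ X) :
    ∫⁻ z, (∫⁻ σ, W σ * F σ z) * H z ∂ν ≤ k * X := by
  rw [lintegral_superposition_mul hW hF hH]
  calc ∫⁻ σ, W σ * ∫⁻ z, F σ z * H z ∂ν ≤ ∫⁻ σ, k * (W σ * n σ) := by
        refine lintegral_mono fun σ => ?_
        dsimp only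
        rw [mul_left_comm]
        gcongr
        exact h σ
    _ = k * ∫⁻ σ, W σ * n σ := lintegral_const_mul _ (hW.mul hn)
    _ ≤ _ := by gcongr

variable {J J' : Set ℝ}

theorem measurable_freeSol_comp {Z : Type*} [TopologicalSpace Z] [MeasurableSpace Z]
    [OpensMeasurableSpace Z] (hJ : MeasurableSet J) {R : ℝ}
    (hR : ∀ y ∈ J, |y| ≤ R) {f : Z → L2 × ℝ × ℝ} (hf : Continuous f) (n : ℕ) :
    Measurable fun z => ‖freeSol J (f z).1 (f z).2.1 (f z).2.2‖ₑ ^ n := by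
  have : Continuous fun z => freeSol J (f z).1 (f z).2.1 (f z).2.2 :=
    (continuous_freeSol hJ hR).comp hf
  exact (this.measurable.enorm).pow_const n

theorem lintegral_time_space (f : ℝ × ℝ → ℝ≥0∞) (hf : Measurable f) :
    ∫⁻ z, f z = ∫⁻ t, ∫⁻ x, f (t, x) := by
  rw [Measure.volume_eq_prod, lintegral_prod _ hf.aemeasurable]

theorem bilinear_strichartz_prod (hJ : MeasurableSet J) (hJ' : MeasurableSet J') {R : ℝ}
    (hR : ∀ y ∈ J, |y| ≤ R) (hR' : ∀ y ∈ J', |y| ≤ R) {d : ℝ} (hd : 0 < d)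
    (hsep : ∀ y ∈ J, ∀ y' ∈ J', d ≤ |y - y'|) (a a' : L2) :
    ∫⁻ z : ℝ × ℝ, ‖freeSol J a z.1 z.2‖ₑ ^ 2 * ‖freeSol J' a' z.1 z.2‖ₑ ^ 2
      ≤ ENNReal.ofReal (1 / d) * (‖a‖ₑ ^ 2 * ‖a'‖ₑ ^ 2) := by
  rw [lintegral_time_space]
  · exact bilinear_strichartz hJ hJ' hR hR' hd hsep a a'
  · exact (measurable_freeSol_comp hJ hR (f := fun z : ℝ × ℝ => (a, z)) (by fun_prop) 2).mul
      (measurable_freeSol_comp hJ' hR' (f := fun z : ℝ × ℝ => (a', z)) (by fun_prop) 2)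

/-- The `L⁶` Strichartz estimate for three different data, by Hölder's inequality. Superpositions
are inserted into each of the factors separately. -/
theorem trilinear_strichartz_prod (hJ : MeasurableSet J) {R : ℝ} (hR : ∀ y ∈ J, |y| ≤ R)
    (a₁ a₂ a₃ : L2) :
    ∫⁻ z : ℝ × ℝ, ‖freeSol J a₁ z.1 z.2‖ₑ ^ 2 * (‖freeSol J a₂ z.1 z.2‖ₑ ^ 2 *
      ‖freeSol J a₃ z.1 z.2‖ₑ ^ 2) ≤ 48 * (‖a₁‖ₑ ^ 2 * (‖a₂‖ₑ ^ 2 * ‖a₃‖ₑ ^ 2)) := by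
  set f : Fin 3 → ℝ × ℝ → ℝ≥0∞ := fun i z => ‖freeSol J (![a₁, a₂, a₃] i) z.1 z.2‖ₑ ^ 6 with hf
  have hm : ∀ i, Measurable (f i) := fun i =>
    measurable_freeSol_comp hJ hR (f := fun z : ℝ × ℝ => (![a₁, a₂, a₃] i, z)) (by fun_prop) 6
  have h := ENNReal.lintegral_prod_norm_pow_le (μ := (volume : Measure (ℝ × ℝ))) Finset.univ
    (f := f) (fun i _ => (hm i).aemeasurable) (p := fun _ => 1 / 3) (by norm_num)
    (fun _ _ => by norm_num)
  have hb : ∀ i, (∫⁻ z, f i z) ^ (1 / 3 : ℝ) ≤ 48 ^ (1 / 3 : ℝ) * ‖![a₁, a₂, a₃] i‖ₑ ^ 2 := by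
    intro i
    have h1 : ∫⁻ z, f i z ≤ 48 * ‖![a₁, a₂, a₃] i‖ₑ ^ 6 := by
      rw [lintegral_time_space _ (hm i)]
      exact strichartz_six hJ hR _
    calc (∫⁻ z, f i z) ^ (1 / 3 : ℝ) ≤ (48 * ‖![a₁, a₂, a₃] i‖ₑ ^ 6) ^ (1 / 3 : ℝ) := by gcongr
      _ = _ := by
        rw [ENNReal.mul_rpow_of_nonneg _ _ (by norm_num), ← ENNReal.rpow_natCast,
          ← ENNReal.rpow_mul]
        norm_num
  simp only [Fin.prod_univ_three] at h
  have e : ∀ c : ℝ≥0∞, (c ^ 6) ^ (1 / 3 : ℝ) = c ^ 2 := by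
    intro c
    rw [← ENNReal.rpow_natCast, ← ENNReal.rpow_mul]; norm_num
  simp only [hf, e] at h
  have e48 : (48 : ℝ≥0∞) = 48 ^ (1 / 3 : ℝ) * 48 ^ (1 / 3 : ℝ) * 48 ^ (1 / 3 : ℝ) := by
    rw [← ENNReal.rpow_add _ _ (by norm_num) (by norm_num),
      ← ENNReal.rpow_add _ _ (by norm_num) (by norm_num)]
    norm_num
  calc _ ≤ _ := by simpa [mul_assoc] using h
    _ ≤ (48 ^ (1 / 3 : ℝ) * ‖a₁‖ₑ ^ 2) * (48 ^ (1 / 3 : ℝ) * ‖a₂‖ₑ ^ 2) *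
        (48 ^ (1 / 3 : ℝ) * ‖a₃‖ₑ ^ 2) := by
        rw [mul_assoc]
        have h0 := hb 0
        have h1 := hb 1
        have h2 := hb 2
        simp only [hf, one_div] at h0 h1 h2 ⊢
        exact mul_le_mul' h0 (mul_le_mul' h1 h2)
    _ = (48 ^ (1 / 3 : ℝ) * 48 ^ (1 / 3 : ℝ) * 48 ^ (1 / 3 : ℝ)) *
        (‖a₁‖ₑ ^ 2 * (‖a₂‖ₑ ^ 2 * ‖a₃‖ₑ ^ 2)) := by ring
    _ = _ := by rw [← e48]

theorem measurable_enorm_sq {Q : ℝ → L2} (hQ : Continuous Q) :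
    Measurable fun σ => ‖Q σ‖ₑ ^ 2 := hQ.enorm.measurable.pow_const 2

/-- The superposition `∫ W(σ) |S_J Q(σ)|² dσ` of the densities of free solutions. -/
def waveMass (W : ℝ → ℝ≥0∞) (Q : ℝ → L2) (J : Set ℝ) (t x : ℝ) : ℝ≥0∞ :=
  ∫⁻ σ, W σ * ‖freeSol J (Q σ) t x‖ₑ ^ 2

section waveMass

variable {W : ℝ → ℝ≥0∞} {Q : ℝ → L2} {R : ℝ}

theorem measurable_freeSol_family (hJ : MeasurableSet J) (hR : ∀ y ∈ J, |y| ≤ R)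
    (hQ : Continuous Q) : Measurable (Function.uncurry fun (σ : ℝ) (z : ℝ × ℝ) =>
      ‖freeSol J (Q σ) z.1 z.2‖ₑ ^ 2) :=
  measurable_freeSol_comp hJ hR (f := fun q : ℝ × ℝ × ℝ => (Q q.1, q.2)) (by fun_prop) 2

theorem measurable_freeSol_sq (hJ : MeasurableSet J) (hR : ∀ y ∈ J, |y| ≤ R) (a : L2) :
    Measurable fun z : ℝ × ℝ => ‖freeSol J a z.1 z.2‖ₑ ^ 2 :=
  measurable_freeSol_comp hJ hR (f := fun z : ℝ × ℝ => (a, z)) (by fun_prop) 2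

theorem measurable_waveMass (hJ : MeasurableSet J) (hR : ∀ y ∈ J, |y| ≤ R)
    (hQ : Continuous Q) (hW : Measurable W) :
    Measurable fun z : ℝ × ℝ => waveMass W Q J z.1 z.2 := by
  have h1 : Measurable fun q : (ℝ × ℝ) × ℝ => ‖freeSol J (Q q.2) q.1.1 q.1.2‖ₑ ^ 2 :=
    measurable_freeSol_comp hJ hR (f := fun q : (ℝ × ℝ) × ℝ => (Q q.2, q.1)) (by fun_prop) 2
  have h2 : Measurable fun q : (ℝ × ℝ) × ℝ => W q.2 := hW.comp measurable_snd
  have h3 : Measurable fun q : (ℝ × ℝ) × ℝ => W q.2 * ‖freeSol J (Q q.2) q.1.1 q.1.2‖ₑ ^ 2 :=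
    Measurable.fun_mul h2 h1
  exact h3.lintegral_prod_right'

/-- An estimate for free solutions passes to superpositions of their densities. -/
theorem lintegral_waveMass_mul_le (hJ : MeasurableSet J) (hR : ∀ y ∈ J, |y| ≤ R)
    (hQ : Continuous Q) (hW : Measurable W) {X : ℝ≥0∞} (hX : ∫⁻ σ, W σ * ‖Q σ‖ₑ ^ 2 ≤ X)
    {H : ℝ × ℝ → ℝ≥0∞} (hH : Measurable H) (k : ℝ≥0∞)
    (h : ∀ σ, ∫⁻ z : ℝ × ℝ, ‖freeSol J (Q σ) z.1 z.2‖ₑ ^ 2 * H z ≤ k * ‖Q σ‖ₑ ^ 2) :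
    ∫⁻ z : ℝ × ℝ, waveMass W Q J z.1 z.2 * H z ≤ k * X :=
  lintegral_superposition_mul_le hW (measurable_freeSol_family hJ hR hQ) hH
    (measurable_enorm_sq hQ) h hX

theorem setLIntegral_time_space_le {I : Set ℝ} (hI : MeasurableSet I) {f : ℝ → ℝ → ℝ≥0∞}
    {g : ℝ × ℝ → ℝ≥0∞} (hg : Measurable g) (h : ∀ t ∈ I, ∀ x, f t x ≤ g (t, x)) :
    ∫⁻ t in I, ∫⁻ x, f t x ≤ ∫⁻ z, g z := by
  rw [lintegral_time_space g hg]
  exact (setLIntegral_mono' hI fun t ht => lintegral_mono fun x => h t ht x).trans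
    (setLIntegral_le_lintegral I _)

end waveMass

/-- On the time interval `I`, the frequencies `|2πy| ≤ M` of `U` are dominated in mean square by a
superposition of free solutions, with total mass at most `X`. -/
def Controlled (I : Set ℝ) (M : ℝ) (U : ℝ → L2) (X : ℝ≥0∞) : Prop :=
  ∃ (Q : ℝ → L2) (W : ℝ → ℝ≥0∞), Continuous Q ∧ Measurable W ∧ ∫⁻ σ, W σ * ‖Q σ‖ₑ ^ 2 ≤ X ∧
    ∀ J ⊆ freqSet M, MeasurableSet J → ∀ t ∈ I, ∀ x,
      ‖freeSol J (U t) 0 x‖ₑ ^ 2 ≤ waveMass W Q J t x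

section Controlled

variable {I : Set ℝ} {M : ℝ} {U : ℝ → L2} {X : ℝ≥0∞}

theorem Controlled.lintegral_sq_le (h : Controlled I M U X) (hJM : J ⊆ freqSet M)
    (hJ : MeasurableSet J) {t : ℝ} (ht : t ∈ I) : ∫⁻ x, ‖freeSol J (U t) 0 x‖ₑ ^ 2 ≤ X := by
  obtain ⟨Q, W, hQ, hW, hX, hb⟩ := h
  have hR : ∀ y ∈ J, |y| ≤ M := fun y hy => abs_le_of_mem_freqSet (hJM hy)
  have hF : Measurable (Function.uncurry fun (σ x : ℝ) => ‖freeSol J (Q σ) t x‖ₑ ^ 2) :=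
    measurable_freeSol_comp hJ hR (f := fun q : ℝ × ℝ => (Q q.1, t, q.2)) (by fun_prop) 2
  have h1 := lintegral_superposition_mul_le (ν := (volume : Measure ℝ)) hW hF
    (H := fun _ => 1) measurable_const (measurable_enorm_sq hQ)
    (k := 1) (X := X) (fun σ => by
      simp only [mul_one, one_mul]
      rw [lintegral_freeSol_sq hJ hR, ← ofReal_norm, ← ofReal_norm]
      gcongr
      exact norm_waveOp_le hJ 0 0 _) hX
  refine (lintegral_mono fun x => hb J hJM hJ t ht x).trans ?_
  simpa [waveMass] using h1

/-- The bilinear Strichartz estimate for a controlled curve and a free solution. -/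
theorem Controlled.lintegral_free_mul_le (h : Controlled I M U X) (hI : MeasurableSet I)
    (hJM : J ⊆ freqSet M) (hJ : MeasurableSet J) (hJ' : MeasurableSet J')
    {R : ℝ} (hR' : ∀ y ∈ J', |y| ≤ R) {d : ℝ} (hd : 0 < d)
    (hsep : ∀ y ∈ J, ∀ y' ∈ J', d ≤ |y - y'|) (a : L2) :
    ∫⁻ t in I, ∫⁻ x, ‖freeSol J (U t) 0 x‖ₑ ^ 2 * ‖freeSol J' a t x‖ₑ ^ 2
      ≤ ENNReal.ofReal (1 / d) * ‖a‖ₑ ^ 2 * X := by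
  obtain ⟨Q, W, hQ, hW, hX, hb⟩ := h
  have hR : ∀ y ∈ J, |y| ≤ max M R := fun y hy =>
    (abs_le_of_mem_freqSet (hJM hy)).trans (le_max_left _ _)
  have hR'' : ∀ y ∈ J', |y| ≤ max M R := fun y hy => (hR' y hy).trans (le_max_right _ _)
  have hH := measurable_freeSol_sq hJ' hR'' a
  have h1 := lintegral_waveMass_mul_le hJ hR hQ hW hX hH (ENNReal.ofReal (1 / d) * ‖a‖ₑ ^ 2)
    (fun σ => (bilinear_strichartz_prod hJ hJ' hR hR'' hd hsep (Q σ) a).trans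
      (le_of_eq (by ring)))
  refine le_trans (setLIntegral_time_space_le hI
    ((measurable_waveMass hJ hR hQ hW).fun_mul hH) fun t ht x => ?_) h1
  exact mul_le_mul_left (hb J hJM hJ t ht x) _

/-- The bilinear Strichartz estimate for two separated pieces of a controlled curve, inserting the
superposition into one factor after the other. -/
theorem Controlled.lintegral_mul_le (h : Controlled I M U X) (hI : MeasurableSet I)
    (hJM : J ⊆ freqSet M) (hJM' : J' ⊆ freqSet M) (hJ : MeasurableSet J) (hJ' : MeasurableSet J')
    {d : ℝ} (hd : 0 < d) (hsep : ∀ y ∈ J, ∀ y' ∈ J', d ≤ |y - y'|) :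
    ∫⁻ t in I, ∫⁻ x, ‖freeSol J (U t) 0 x‖ₑ ^ 2 * ‖freeSol J' (U t) 0 x‖ₑ ^ 2
      ≤ ENNReal.ofReal (1 / d) * X * X := by
  obtain ⟨Q, W, hQ, hW, hX, hb⟩ := h
  have hR : ∀ y ∈ J, |y| ≤ M := fun y hy => abs_le_of_mem_freqSet (hJM hy)
  have hR' : ∀ y ∈ J', |y| ≤ M := fun y hy => abs_le_of_mem_freqSet (hJM' hy)
  have hG' := measurable_waveMass hJ' hR' hQ hW
  have h1 := lintegral_waveMass_mul_le hJ hR hQ hW hX hG' (ENNReal.ofReal (1 / d) * X)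
    (fun σ => by
      have h2 := lintegral_waveMass_mul_le hJ' hR' hQ hW hX (measurable_freeSol_sq hJ hR (Q σ))
        (ENNReal.ofReal (1 / d) * ‖Q σ‖ₑ ^ 2) (fun σ' => by
          refine (le_of_eq (lintegral_congr fun z => mul_comm _ _)).trans
            ((bilinear_strichartz_prod hJ hJ' hR hR' hd hsep (Q σ) (Q σ')).trans (le_of_eq ?_))
          ring)
      refine (le_of_eq (lintegral_congr fun z => mul_comm _ _)).trans (h2.trans (le_of_eq ?_))
      ring)
  refine le_trans (setLIntegral_time_space_le hI
    ((measurable_waveMass hJ hR hQ hW).fun_mul hG') fun t ht x => ?_) h1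
  exact mul_le_mul' (hb J hJM hJ t ht x) (hb J' hJM' hJ' t ht x)

/-- The `L⁶` Strichartz estimate for a controlled curve. -/
theorem Controlled.lintegral_pow_six_le (h : Controlled I M U X) (hI : MeasurableSet I)
    (hJM : J ⊆ freqSet M) (hJ : MeasurableSet J) :
    ∫⁻ t in I, ∫⁻ x, ‖freeSol J (U t) 0 x‖ₑ ^ 6 ≤ 48 * X ^ 3 := by
  obtain ⟨Q, W, hQ, hW, hX, hb⟩ := h
  have hR : ∀ y ∈ J, |y| ≤ M := fun y hy => abs_le_of_mem_freqSet (hJM hy)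
  have hG := measurable_waveMass hJ hR hQ hW
  have hF : ∀ σ, Measurable fun z : ℝ × ℝ => ‖freeSol J (Q σ) z.1 z.2‖ₑ ^ 2 := fun σ =>
    measurable_freeSol_sq hJ hR (Q σ)
  have h1 := lintegral_waveMass_mul_le hJ hR hQ hW hX (hG.fun_mul hG) (48 * X * X)
    (fun σ => by
      have h2 := lintegral_waveMass_mul_le hJ hR hQ hW hX (hG.fun_mul (hF σ))
        (48 * X * ‖Q σ‖ₑ ^ 2) (fun σ' => by
          have h3 := lintegral_waveMass_mul_le hJ hR hQ hW hX ((hF σ).fun_mul (hF σ'))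
            (48 * ‖Q σ‖ₑ ^ 2 * ‖Q σ'‖ₑ ^ 2) (fun σ'' =>
              (trilinear_strichartz_prod hJ hR (Q σ'') (Q σ) (Q σ')).trans
                (le_of_eq (by ring)))
          refine (le_of_eq (lintegral_congr fun z => ?_)).trans (h3.trans (le_of_eq ?_)) <;> ring)
      refine (le_of_eq (lintegral_congr fun z => ?_)).trans (h2.trans (le_of_eq ?_)) <;> ring)
  refine (le_trans (setLIntegral_time_space_le hI (hG.fun_mul (hG.fun_mul hG))
    fun t ht x => ?_) h1).trans (le_of_eq (by ring))
  have h2 := hb J hJM hJ t ht x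
  calc ‖freeSol J (U t) 0 x‖ₑ ^ 6 = ‖freeSol J (U t) 0 x‖ₑ ^ 2 *
        (‖freeSol J (U t) 0 x‖ₑ ^ 2 * ‖freeSol J (U t) 0 x‖ₑ ^ 2) := by ring
    _ ≤ _ := mul_le_mul' h2 (mul_le_mul' h2 h2)

end Controlled

theorem one_le_bracket (x : ℝ) : 1 ≤ bracket x := by
  unfold bracket
  exact Real.one_le_sqrt.2 (by nlinarith [sq_nonneg x])

theorem bracket_pos (x : ℝ) : 0 < bracket x := zero_lt_one.trans_le (one_le_bracket x)

theorem measurable_bracket : Measurable bracket := by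
  unfold bracket; fun_prop

theorem integrable_bracket_rpow {b : ℝ} (hb : 1 / 2 < b) :
    Integrable fun x : ℝ => bracket x ^ (-(2 * b)) := by
  have h := integrable_rpow_neg_one_add_norm_sq (E := ℝ) (μ := volume) (r := 2 * b)
    (by simp; linarith)
  refine h.congr (.of_forall fun x => ?_)
  simp only [bracket, Real.sqrt_eq_rpow, Real.norm_eq_abs, sq_abs]
  rw [← Real.rpow_mul (by positivity)]
  congr 1; ring

/-- **Transference**: where the cutoff function does not vanish, `U` is a superposition of free
solutions, by Fourier inversion in time in the interaction picture. Since `b > 1/2`, the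
Cauchy-Schwarz inequality bounds it in mean square. -/
theorem exists_controlled {η : ℝ → ℂ} (hη : Continuous η) (hηc : HasCompactSupport η)
    (hη0 : η 0 ≠ 0) {b : ℝ} (hb : 1 / 2 < b) :
    ∃ ε > 0, ∃ κ > 0, ∀ (δ t₀ M : ℝ) (U : ℝ → L2), 0 < δ → Continuous U →
      ∀ Z : ℝ≥0∞, Z ≠ ∞ →
      ∫⁻ σ, ENNReal.ofReal (bracket (2 * Real.pi * δ * σ) ^ (2 * b)) *
        ‖localSpec η δ t₀ M U σ‖ₑ ^ 2 ≤ Z →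
      Controlled (Set.Icc (δ * t₀ - ε * δ) (δ * t₀ + ε * δ)) M U
        (ENNReal.ofReal (κ / δ) * Z) := by
  obtain ⟨ε, hε, hεη⟩ : ∃ ε > 0, ∀ r, |r| ≤ ε → ‖η 0‖ / 2 ≤ ‖η r‖ := by
    have h0 : ‖η 0‖ / 2 < ‖η 0‖ := half_lt_self (norm_pos_iff.2 hη0)
    have h1 := hη.norm.continuousAt.eventually (lt_mem_nhds h0)
    obtain ⟨ε, hε, h2⟩ := Metric.eventually_nhds_iff.1 h1
    refine ⟨ε / 2, by positivity, fun r hr => (h2 ?_).le⟩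
    rw [Real.dist_eq, sub_zero]; linarith
  set c := ‖η 0‖ / 2 with hc
  have hcpos : 0 < c := by have := norm_pos_iff.2 hη0; positivity
  set K := ∫ x : ℝ, bracket x ^ (-(2 * b)) with hK
  have hK0 : 0 ≤ K := integral_nonneg fun x => (Real.rpow_pos_of_pos (bracket_pos x) _).le
  refine ⟨ε, hε, (c ^ 2)⁻¹ * (K + 1), by positivity, fun δ t₀ M U hδ hU Z hZ hZle => ?_⟩
  set Q := localSpec η δ t₀ M U with hQ
  have hfi := integrable_localProfile hη hηc hδ t₀ M hU
  have hQc : Continuous Q := VectorFourier.fourierIntegral_continuous Real.continuous_fourierChar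
      (by exact continuous_inner) hfi
  set w : ℝ → ℝ≥0∞ := fun σ => ENNReal.ofReal (bracket (2 * Real.pi * δ * σ) ^ (2 * b)) with hw
  have hwm : Measurable w := by
    refine Measurable.ennreal_ofReal (Measurable.pow_const ?_ _)
    exact measurable_bracket.comp (by fun_prop)
  set v : ℝ → ℝ≥0∞ := fun σ => ENNReal.ofReal (bracket (2 * Real.pi * δ * σ) ^ (-b)) with hv
  set v' : ℝ → ℝ≥0∞ := fun σ => ENNReal.ofReal (bracket (2 * Real.pi * δ * σ) ^ b) with hv'
  have hvm : Measurable v := by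
    refine Measurable.ennreal_ofReal (Measurable.pow_const ?_ _)
    exact measurable_bracket.comp (by fun_prop)
  have hvm' : Measurable v' := by
    refine Measurable.ennreal_ofReal (Measurable.pow_const ?_ _)
    exact measurable_bracket.comp (by fun_prop)
  have hvv : ∀ σ, v σ * v' σ = 1 := by
    intro σ
    have hp := bracket_pos (2 * Real.pi * δ * σ)
    rw [hv, hv']
    dsimp only
    rw [← ENNReal.ofReal_mul (Real.rpow_nonneg hp.le _), ← Real.rpow_add hp]
    simp
  have hvw : ∀ σ, v' σ ^ 2 = w σ := by
    intro σ
    have hp := bracket_pos (2 * Real.pi * δ * σ)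
    rw [hw, hv']
    dsimp only
    rw [← ENNReal.ofReal_pow (Real.rpow_nonneg hp.le _), ← Real.rpow_natCast, ← Real.rpow_mul hp.le]
    congr 2; push_cast; ring
  have hv2 : ∫⁻ σ, v σ ^ 2 ≤ ENNReal.ofReal ((K + 1) / δ) := by
    have e1 : ∀ σ, v σ ^ 2 = (fun x => ENNReal.ofReal (bracket x ^ (-(2 * b))))
        (2 * Real.pi * δ * σ) := by
      intro σ
      have hp := bracket_pos (2 * Real.pi * δ * σ)
      rw [hv]
      dsimp only
      rw [← ENNReal.ofReal_pow (Real.rpow_nonneg hp.le _), ← Real.rpow_natCast,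
        ← Real.rpow_mul hp.le]
      congr 2; push_cast; ring
    have hpos : 0 < 2 * Real.pi * δ := by have := Real.pi_pos; positivity
    simp only [e1]
    rw [lintegral_comp_mul_left (fun x => ENNReal.ofReal (bracket x ^ (-(2 * b)))) hpos.ne',
      ← ofReal_integral_eq_lintegral_ofReal (integrable_bracket_rpow hb)
        (.of_forall fun x => (Real.rpow_pos_of_pos (bracket_pos x) _).le),
      ← ENNReal.ofReal_mul (abs_nonneg _)]
    refine ENNReal.ofReal_le_ofReal ?_
    rw [abs_of_pos (inv_pos.2 hpos), inv_mul_eq_div]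
    have h6 : δ ≤ 2 * Real.pi * δ := by have := Real.pi_gt_three; nlinarith
    exact div_le_div₀ (by linarith) (by linarith) hδ h6
  have hCS : ∀ f : ℝ → ℝ≥0∞, Measurable f →
      (∫⁻ σ, f σ) ^ 2 ≤ ENNReal.ofReal ((K + 1) / δ) * ∫⁻ σ, w σ * f σ ^ 2 := by
    intro f hf
    have h1 := sq_lintegral_mul_le (μ := volume) hvm.aemeasurable (hvm'.mul hf).aemeasurable
    simp only [Pi.mul_apply, ← mul_assoc, hvv, one_mul, mul_pow, hvw] at h1
    exact h1.trans (by gcongr)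
  have hQi : Integrable Q := by
    refine ⟨hQc.aestronglyMeasurable, ?_⟩
    have h1 := hCS (fun σ => ‖Q σ‖ₑ) hQc.enorm.measurable
    have h2 : (∫⁻ σ, ‖Q σ‖ₑ) ^ 2 < ∞ := h1.trans_lt
      (ENNReal.mul_lt_top ENNReal.ofReal_lt_top (hZle.trans_lt hZ.lt_top))
    rw [HasFiniteIntegral]
    by_contra hcon
    rw [not_lt, top_le_iff] at hcon
    rw [hcon] at h2
    simp at h2
  refine ⟨Q, fun σ => ENNReal.ofReal ((c ^ 2)⁻¹ * ((K + 1) / δ)) * w σ, hQc,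
    hwm.const_mul _, ?_, ?_⟩
  · simp only [mul_assoc]
    rw [lintegral_const_mul' _ _ ENNReal.ofReal_ne_top, mul_div_assoc]
    gcongr
  · intro J hJM hJ t ht x
    have hR : ∀ y ∈ J, |y| ≤ M := fun y hy => abs_le_of_mem_freqSet (hJM hy)
    have hcη : c ≤ ‖η (t / δ - t₀)‖ := by
      refine hεη _ ?_
      rw [abs_le, neg_le_sub_iff_le_add, sub_le_iff_le_add, div_le_iff₀ hδ, ← sub_le_iff_le_add,
        le_div_iff₀ hδ]
      constructor
      · nlinarith [ht.1]
      · nlinarith [ht.2]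
    have hinv : localProfile η δ t₀ M U t = 𝓕⁻ Q t :=
      (hfi.fourierInv_fourier_eq hQi (continuous_localProfile hη δ t₀ M hU).continuousAt).symm
    have e1 : freeSol J (localProfile η δ t₀ M U t) t x
        = η (t / δ - t₀) * freeSol J (U t) 0 x := by
      rw [localProfile, ← freeSolL_apply hJ hR, map_smul, freeSolL_apply hJ hR, profile,
        freeSol_waveOp (measurableSet_freqSet M), Set.inter_eq_left.2 hJM, add_neg_cancel,
        add_zero, smul_eq_mul]
    have e2 : freeSol J (localProfile η δ t₀ M U t) t x
        = ∫ σ, Complex.exp ((2 * Real.pi * inner ℝ σ t : ℝ) * Complex.I) * freeSol J (Q σ) t x := by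
      rw [hinv, Real.fourierInv_eq', ← freeSolL_apply hJ hR,
        ← ContinuousLinearMap.integral_comp_comm]
      · refine integral_congr_ae (.of_forall fun σ => ?_)
        dsimp only
        rw [map_smul, freeSolL_apply hJ hR, smul_eq_mul]
      · refine hQi.norm.mono' ?_ (.of_forall fun σ => ?_)
        · have hc0 : Continuous fun σ : ℝ =>
              Complex.exp ((2 * Real.pi * inner ℝ σ t : ℝ) * Complex.I) := by fun_prop
          exact (hc0.smul hQc).aestronglyMeasurable
        · rw [norm_smul, Complex.norm_exp_ofReal_mul_I, one_mul]
    have h3 : ‖η (t / δ - t₀)‖ₑ * ‖freeSol J (U t) 0 x‖ₑ ≤ ∫⁻ σ, ‖freeSol J (Q σ) t x‖ₑ := by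
      rw [← enorm_mul, ← e1, e2]
      refine (enorm_integral_le_lintegral_enorm _).trans (le_of_eq ?_)
      congr 1; ext σ
      rw [enorm_mul, ← ofReal_norm, Complex.norm_exp_ofReal_mul_I]; simp
    have hfm : Measurable fun σ => ‖freeSol J (Q σ) t x‖ₑ := by
      simpa using measurable_freeSol_comp hJ hR (f := fun σ : ℝ => (Q σ, t, x)) (by fun_prop) 1
    have h4 := (pow_le_pow_left₀ zero_le h3 2).trans (hCS _ hfm)
    simp only [waveMass, mul_assoc]
    rw [lintegral_const_mul' _ _ ENNReal.ofReal_ne_top, ENNReal.ofReal_mul (by positivity),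
      mul_assoc]
    refine le_trans ?_ (mul_le_mul_right h4 _)
    rw [mul_pow, ← mul_assoc]
    refine le_mul_of_one_le_left zero_le ?_
    rw [← ofReal_norm, ← ENNReal.ofReal_pow (norm_nonneg _), ← ENNReal.ofReal_mul (by positivity),
      ← ENNReal.ofReal_one]
    refine ENNReal.ofReal_le_ofReal ?_
    rw [inv_mul_eq_div, one_le_div (by positivity)]
    gcongr

end

/-! ### Cubic interactions at low frequency -/

/-- The frequencies `|2πy| ≤ N` of `P`, in the interaction picture at time `t`. -/
def force (N t : ℝ) (P : ℝ → ℂ) : L2 := waveOp (freqSet N) (-t) 0 (𝓕 (toL2 P))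

theorem inner_force (N t : ℝ) {P : ℝ → ℂ} (hP : MemLp P 2 volume) (a : L2) :
    inner ℂ a (force N t P) = ∫ x, P x * star (freeSol (freqSet N) a t x) :=
  inner_waveOp_fourier (measurableSet_freqSet N) (fun _ => abs_le_of_mem_freqSet) hP a t

theorem enorm_inner_force_le (N t : ℝ) {P : ℝ → ℂ} (hP : MemLp P 2 volume) (a : L2) :
    ‖inner ℂ a (force N t P)‖ₑ ≤ ∫⁻ x, ‖P x‖ₑ * ‖freeSol (freqSet N) a t x‖ₑ := by
  rw [inner_force N t hP]
  refine (enorm_integral_le_lintegral_enorm _).trans (le_of_eq ?_)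
  congr 1; ext x
  rw [enorm_mul, ← ofReal_norm (star _), norm_star, ofReal_norm]

theorem enorm_force_sq_le_toL2 (N t : ℝ) {P : ℝ → ℂ} (hP : MemLp P 2 volume) :
    ‖force N t P‖ₑ ^ 2 ≤ ∫⁻ x, ‖P x‖ₑ ^ 2 := by
  rw [← enorm_toL2_sq hP, ← ofReal_norm, ← ofReal_norm, ← Lp.norm_fourier_eq (toL2 P)]
  gcongr
  exact norm_waveOp_le (measurableSet_freqSet N) _ _ _

/-- Bernstein's inequality: the frequencies `|2πy| ≤ N` of an integrable function have `L²` norm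
at most `(2N)^{1/2}` times its `L¹` norm. -/
theorem enorm_force_sq_le (N t : ℝ) (hN : 0 ≤ N) {P : ℝ → ℂ} (hP : MemLp P 2 volume) :
    ‖force N t P‖ₑ ^ 2 ≤ ENNReal.ofReal (2 * N) * (∫⁻ x, ‖P x‖ₑ) ^ 2 := by
  set c := force N t P with hc
  by_cases h0 : ‖c‖ₑ = 0
  · rw [h0]; simp
  have h1 : ‖c‖ₑ * ‖c‖ₑ ≤ ENNReal.ofReal (Real.sqrt (2 * N)) * (∫⁻ x, ‖P x‖ₑ) * ‖c‖ₑ := by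
    have h2 := enorm_inner_force_le N t hP c
    rw [← hc, ← ofReal_norm, inner_self_eq_norm_sq_to_K, norm_pow, RCLike.norm_ofReal, abs_norm,
      pow_two, ENNReal.ofReal_mul (norm_nonneg _),
      ofReal_norm] at h2
    refine h2.trans ?_
    have h3 : ∀ x, ‖freeSol (freqSet N) c t x‖ₑ ≤ ENNReal.ofReal (Real.sqrt (2 * N)) * ‖c‖ₑ := by
      intro x
      rw [← ofReal_norm, ← ofReal_norm, ← ENNReal.ofReal_mul (Real.sqrt_nonneg _)]
      refine ENNReal.ofReal_le_ofReal ?_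
      have h4 := norm_freeSol_sq_le (measurableSet_freqSet N) (fun _ => abs_le_of_mem_freqSet)
        hN c t x
      have h5 := norm_waveOp_le (measurableSet_freqSet N) 0 0 c
      refine (sq_le_sq₀ (norm_nonneg _) (by positivity)).1 ?_
      rw [mul_pow, Real.sq_sqrt (by positivity)]
      exact h4.trans (by gcongr)
    calc _ ≤ ∫⁻ x, ‖P x‖ₑ * (ENNReal.ofReal (Real.sqrt (2 * N)) * ‖c‖ₑ) :=
          lintegral_mono fun x => by dsimp only; gcongr; exact h3 x
      _ = _ := by
          rw [lintegral_mul_const' _ _ (ENNReal.mul_ne_top ENNReal.ofReal_ne_top enorm_ne_top)]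
          ring
  have h2 := (ENNReal.mul_le_mul_iff_left h0 enorm_ne_top).1 h1
  calc ‖c‖ₑ ^ 2 ≤ (ENNReal.ofReal (Real.sqrt (2 * N)) * ∫⁻ x, ‖P x‖ₑ) ^ 2 := by gcongr
    _ = _ := by
      rw [mul_pow, ← ENNReal.ofReal_pow (Real.sqrt_nonneg _), Real.sq_sqrt (by positivity)]

/-- The cubic product `u₁ \bar{u₂} u₃` of the parts of `a` with frequencies in `J₁`, `J₂`, `J₃`. -/
def triple (J₁ J₂ J₃ : Set ℝ) (a : L2) (x : ℝ) : ℂ :=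
  freeSol J₁ a 0 x * star (freeSol J₂ a 0 x) * freeSol J₃ a 0 x

theorem memLp_triple {J₁ J₂ J₃ : Set ℝ} (h₁ : MeasurableSet J₁) (h₂ : MeasurableSet J₂)
    (h₃ : MeasurableSet J₃) {R : ℝ} (hR₁ : ∀ y ∈ J₁, |y| ≤ R) (hR₂ : ∀ y ∈ J₂, |y| ≤ R)
    (hR₃ : ∀ y ∈ J₃, |y| ≤ R) (a : L2) : MemLp (triple J₁ J₂ J₃ a) 2 volume :=
  (memLp_top_freeSol h₃ hR₃ a 0).mul' (memLp_freeSol_mul h₁ h₂ hR₁ hR₂ a a 0)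

theorem enorm_triple (J₁ J₂ J₃ : Set ℝ) (a : L2) (x : ℝ) : ‖triple J₁ J₂ J₃ a x‖ₑ
    = ‖freeSol J₁ a 0 x‖ₑ * ‖freeSol J₂ a 0 x‖ₑ * ‖freeSol J₃ a 0 x‖ₑ := by
  rw [triple, enorm_mul, enorm_mul, ← ofReal_norm (star _), norm_star, ofReal_norm]

section Trilinear

variable {I : Set ℝ} {M N : ℝ} {U : ℝ → L2} {X : ℝ≥0∞} {J J₁ J₂ J₃ : Set ℝ} {d : ℝ}

theorem measurable_piece (hU : Continuous U) (hJM : J ⊆ freqSet M) (hJ : MeasurableSet J) :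
    Measurable fun z : ℝ × ℝ => ‖freeSol J (U z.1) 0 z.2‖ₑ := by
  have h := measurable_freeSol_comp hJ (fun y hy => abs_le_of_mem_freqSet (hJM hy))
    (f := fun z : ℝ × ℝ => (U z.1, (0 : ℝ), z.2)) (by fun_prop) 1
  simpa using h

theorem measurable_free (hJM : J ⊆ freqSet M) (hJ : MeasurableSet J) (a : L2) :
    Measurable fun z : ℝ × ℝ => ‖freeSol J a z.1 z.2‖ₑ := by
  have h := measurable_freeSol_comp hJ (fun y hy => abs_le_of_mem_freqSet (hJM hy))
    (f := fun z : ℝ × ℝ => (a, z.1, z.2)) (by fun_prop) 1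
  simpa using h

theorem sq_lintegral_lintegral_mul_le {f g : ℝ × ℝ → ℝ≥0∞} (hf : Measurable f) (hg : Measurable g) :
    (∫⁻ t in I, ∫⁻ x, f (t, x) * g (t, x)) ^ 2 ≤
      (∫⁻ t in I, ∫⁻ x, f (t, x) ^ 2) * ∫⁻ t in I, ∫⁻ x, g (t, x) ^ 2 := by
  have h := sq_lintegral_mul_le (μ := (volume.restrict I).prod volume) hf.aemeasurable
    hg.aemeasurable
  rwa [lintegral_prod _ (hf.fun_mul hg).aemeasurable,
    lintegral_prod _ (hf.pow_const 2).aemeasurable,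
    lintegral_prod _ (hg.pow_const 2).aemeasurable] at h

/-- Two bilinear estimates: a piece against the free solution, and the two other pieces against
each other. -/
theorem Controlled.trilinear_pairing_le (h : Controlled I M U X) (hI : MeasurableSet I)
    (hU : Continuous U) (hM₁ : J₁ ⊆ freqSet M) (hM₂ : J₂ ⊆ freqSet M) (hM₃ : J₃ ⊆ freqSet M)
    (h₁ : MeasurableSet J₁) (h₂ : MeasurableSet J₂) (h₃ : MeasurableSet J₃) (hd : 0 < d)
    (hs : ∀ y ∈ J₁, ∀ y' ∈ freqSet N, d ≤ |y - y'|) (hs' : ∀ y ∈ J₂, ∀ y' ∈ J₃, d ≤ |y - y'|)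
    (a : L2) :
    (∫⁻ t in I, ∫⁻ x, ‖freeSol J₁ (U t) 0 x‖ₑ * ‖freeSol J₂ (U t) 0 x‖ₑ *
      ‖freeSol J₃ (U t) 0 x‖ₑ * ‖freeSol (freqSet N) a t x‖ₑ) ^ 2
      ≤ ENNReal.ofReal (1 / d) ^ 2 * X ^ 3 * ‖a‖ₑ ^ 2 := by
  have m₁ := measurable_piece hU hM₁ h₁
  have m₂ := measurable_piece hU hM₂ h₂
  have m₃ := measurable_piece hU hM₃ h₃
  have m₀ := measurable_free le_rfl (measurableSet_freqSet N) a
  have h4 := sq_lintegral_lintegral_mul_le (I := I) (m₁.fun_mul m₀) (m₂.fun_mul m₃)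
  simp only [mul_pow] at h4
  have h5 := h.lintegral_free_mul_le hI hM₁ h₁ (measurableSet_freqSet N)
    (fun _ => abs_le_of_mem_freqSet) hd hs a
  have h6 := h.lintegral_mul_le hI hM₂ hM₃ h₂ h₃ hd hs'
  refine le_trans (le_of_eq ?_) (h4.trans ((mul_le_mul' h5 h6).trans (le_of_eq (by ring))))
  congr 1
  refine lintegral_congr fun t => lintegral_congr fun x => ?_
  ring

/-- The mass of one piece times the bilinear estimate for the two others. -/
theorem Controlled.trilinear_sq_le (h : Controlled I M U X) (hI : MeasurableSet I)
    (hU : Continuous U) (hM₁ : J₁ ⊆ freqSet M) (hM₂ : J₂ ⊆ freqSet M) (hM₃ : J₃ ⊆ freqSet M)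
    (h₁ : MeasurableSet J₁) (h₂ : MeasurableSet J₂) (h₃ : MeasurableSet J₃) (hd : 0 < d)
    (hs' : ∀ y ∈ J₂, ∀ y' ∈ J₃, d ≤ |y - y'|) :
    ∫⁻ t in I, (∫⁻ x, ‖freeSol J₁ (U t) 0 x‖ₑ * ‖freeSol J₂ (U t) 0 x‖ₑ *
      ‖freeSol J₃ (U t) 0 x‖ₑ) ^ 2 ≤ ENNReal.ofReal (1 / d) * X ^ 3 := by
  have m₁ := measurable_piece hU hM₁ h₁
  have m₂ := measurable_piece hU hM₂ h₂
  have m₃ := measurable_piece hU hM₃ h₃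
  calc _ ≤ ∫⁻ t in I, X * ∫⁻ x, ‖freeSol J₂ (U t) 0 x‖ₑ ^ 2 * ‖freeSol J₃ (U t) 0 x‖ₑ ^ 2 := by
        refine setLIntegral_mono' hI fun t ht => ?_
        have p₁ := m₁.comp (by fun_prop : Measurable fun x : ℝ => (t, x))
        have p₂ := m₂.comp (by fun_prop : Measurable fun x : ℝ => (t, x))
        have p₃ := m₃.comp (by fun_prop : Measurable fun x : ℝ => (t, x))
        have h4 := sq_lintegral_mul_le (μ := volume) p₁.aemeasurable
          (p₂.fun_mul p₃).aemeasurable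
        simp only [Function.comp, mul_pow, ← mul_assoc] at h4
        exact h4.trans (mul_le_mul_left (h.lintegral_sq_le hM₁ h₁ ht) _)
    _ = X * ∫⁻ t in I, ∫⁻ x, ‖freeSol J₂ (U t) 0 x‖ₑ ^ 2 * ‖freeSol J₃ (U t) 0 x‖ₑ ^ 2 :=
        lintegral_const_mul _
          (((m₂.pow_const 2).fun_mul (m₃.pow_const 2)).lintegral_prod_right')
    _ ≤ X * (ENNReal.ofReal (1 / d) * X * X) := by
        gcongr; exact h.lintegral_mul_le hI hM₂ hM₃ h₂ h₃ hd hs'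
    _ = _ := by ring

/-- The product of pieces with frequencies in `J₁`, `J₂`, `J₃` either does not reach the
frequencies `|2πy| ≤ N`, or one of the pieces is at distance `d` from these frequencies and the two
others are at distance `d` from each other. -/
def Transversal (N d : ℝ) (J₁ J₂ J₃ : Set ℝ) : Prop :=
  (∀ y₁ ∈ J₁, ∀ y₂ ∈ J₂, ∀ y₃ ∈ J₃, y₁ - y₂ + y₃ ∉ freqSet N) ∨
  ((∀ y ∈ J₁, ∀ y' ∈ freqSet N, d ≤ |y - y'|) ∧ ∀ y ∈ J₂, ∀ y' ∈ J₃, d ≤ |y - y'|) ∨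
  ((∀ y ∈ J₂, ∀ y' ∈ freqSet N, d ≤ |y - y'|) ∧ ∀ y ∈ J₁, ∀ y' ∈ J₃, d ≤ |y - y'|) ∨
  ((∀ y ∈ J₃, ∀ y' ∈ freqSet N, d ≤ |y - y'|) ∧ ∀ y ∈ J₁, ∀ y' ∈ J₂, d ≤ |y - y'|)

theorem force_triple_eq_zero (hM₁ : J₁ ⊆ freqSet M) (hM₂ : J₂ ⊆ freqSet M)
    (hM₃ : J₃ ⊆ freqSet M) (h₁ : MeasurableSet J₁) (h₂ : MeasurableSet J₂) (h₃ : MeasurableSet J₃)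
    (h : ∀ y₁ ∈ J₁, ∀ y₂ ∈ J₂, ∀ y₃ ∈ J₃, y₁ - y₂ + y₃ ∉ freqSet N) (t : ℝ) (a : L2) :
    force N t (triple J₁ J₂ J₃ a) = 0 := by
  have hR : ∀ {J}, J ⊆ freqSet M → ∀ y ∈ J, |y| ≤ max M N := fun hJ y hy =>
    (abs_le_of_mem_freqSet (hJ hy)).trans (le_max_left _ _)
  refine ext_inner_left ℂ fun c => ?_
  rw [inner_zero_right, inner_force N t (memLp_triple h₁ h₂ h₃ (hR hM₁) (hR hM₂) (hR hM₃) a)]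
  have h4 := integral_freeSol_quadruple_eq_zero (measurableSet_freqSet N) h₁ h₂ h₃
    (fun y hy => (abs_le_of_mem_freqSet hy).trans (le_max_right M N)) (hR hM₁) (hR hM₂) (hR hM₃)
    (waveOp (freqSet N) t 0 c) a a a 0 h
  simp only [freeSol_waveOp (measurableSet_freqSet N), Set.inter_self, zero_add, add_zero] at h4
  exact h4

/-- A transversal interaction gains `1/d` when tested against a fixed profile, which amounts to
testing the product against a free solution. It gains `(N/d)^{1/2}` in `L²`, by Bernstein's
inequality. -/
theorem Controlled.force_triple_le (h : Controlled I M U X) (hI : MeasurableSet I)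
    (hU : Continuous U) (hM₁ : J₁ ⊆ freqSet M) (hM₂ : J₂ ⊆ freqSet M) (hM₃ : J₃ ⊆ freqSet M)
    (h₁ : MeasurableSet J₁) (h₂ : MeasurableSet J₂) (h₃ : MeasurableSet J₃) (hd : 0 < d)
    (hN : 0 ≤ N) (hT : Transversal N d J₁ J₂ J₃) :
    (∀ a : L2, (∫⁻ t in I, ‖inner ℂ a (force N t (triple J₁ J₂ J₃ (U t)))‖ₑ) ^ 2
      ≤ ENNReal.ofReal (1 / d) ^ 2 * X ^ 3 * ‖a‖ₑ ^ 2) ∧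
    ∫⁻ t in I, ‖force N t (triple J₁ J₂ J₃ (U t))‖ₑ ^ 2
      ≤ ENNReal.ofReal (2 * N) * (ENNReal.ofReal (1 / d) * X ^ 3) := by
  have hR : ∀ {J}, J ⊆ freqSet M → ∀ y ∈ J, |y| ≤ M := fun hJ y hy => abs_le_of_mem_freqSet (hJ hy)
  have hP : ∀ t, MemLp (triple J₁ J₂ J₃ (U t)) 2 volume := fun t =>
    memLp_triple h₁ h₂ h₃ (hR hM₁) (hR hM₂) (hR hM₃) (U t)
  -- the two estimates only see the absolute values, so that the pieces may be permuted
  have key : ∀ {K₁ K₂ K₃ : Set ℝ}, K₁ ⊆ freqSet M → K₂ ⊆ freqSet M → K₃ ⊆ freqSet M →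
      MeasurableSet K₁ → MeasurableSet K₂ → MeasurableSet K₃ →
      (∀ y ∈ K₁, ∀ y' ∈ freqSet N, d ≤ |y - y'|) → (∀ y ∈ K₂, ∀ y' ∈ K₃, d ≤ |y - y'|) →
      (∀ t x, ‖triple J₁ J₂ J₃ (U t) x‖ₑ
        = ‖freeSol K₁ (U t) 0 x‖ₑ * ‖freeSol K₂ (U t) 0 x‖ₑ * ‖freeSol K₃ (U t) 0 x‖ₑ) →
      (∀ a : L2, (∫⁻ t in I, ‖inner ℂ a (force N t (triple J₁ J₂ J₃ (U t)))‖ₑ) ^ 2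
        ≤ ENNReal.ofReal (1 / d) ^ 2 * X ^ 3 * ‖a‖ₑ ^ 2) ∧
      ∫⁻ t in I, ‖force N t (triple J₁ J₂ J₃ (U t))‖ₑ ^ 2
        ≤ ENNReal.ofReal (2 * N) * (ENNReal.ofReal (1 / d) * X ^ 3) := by
    intro K₁ K₂ K₃ k₁ k₂ k₃ m₁ m₂ m₃ s s' he
    constructor
    · intro a
      refine le_trans ?_ (h.trilinear_pairing_le hI hU k₁ k₂ k₃ m₁ m₂ m₃ hd s s' a)
      gcongr with t
      refine (enorm_inner_force_le N t (hP t) a).trans (le_of_eq ?_)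
      simp only [he]
    · calc _ ≤ ∫⁻ t in I, ENNReal.ofReal (2 * N) * (∫⁻ x, ‖triple J₁ J₂ J₃ (U t) x‖ₑ) ^ 2 :=
            lintegral_mono fun t => enorm_force_sq_le N t hN (hP t)
        _ = ENNReal.ofReal (2 * N) * ∫⁻ t in I, (∫⁻ x, ‖triple J₁ J₂ J₃ (U t) x‖ₑ) ^ 2 :=
            lintegral_const_mul' _ _ ENNReal.ofReal_ne_top
        _ ≤ _ := by
            gcongr
            simp only [he]
            exact h.trilinear_sq_le hI hU k₁ k₂ k₃ m₁ m₂ m₃ hd s'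
  rcases hT with hT | ⟨s, s'⟩ | ⟨s, s'⟩ | ⟨s, s'⟩
  · simp only [force_triple_eq_zero hM₁ hM₂ hM₃ h₁ h₂ h₃ hT]
    simp
  · exact key hM₁ hM₂ hM₃ h₁ h₂ h₃ s s' fun t x => enorm_triple _ _ _ _ _
  · exact key hM₂ hM₁ hM₃ h₂ h₁ h₃ s s' fun t x => by rw [enorm_triple]; ring
  · exact key hM₃ hM₁ hM₂ h₃ h₁ h₂ s s' fun t x => by rw [enorm_triple]; ring

end Trilinear

/-- If `ξ₁ - ξ₂ + ξ₃` is small although one of the frequencies is large, then one of them is away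
from zero while the two others are away from each other. -/
theorem resonance_cases {x y z : ℝ} (h : |x - y + z| ≤ 1 / 16)
    (h1 : 1 / 2 < |x| ∨ 1 / 2 < |y| ∨ 1 / 2 < |z|) :
    (9 / 64 ≤ |x| ∧ 3 / 32 ≤ |y - z|) ∨ (9 / 64 ≤ |y| ∧ 3 / 32 ≤ |x - z|) ∨
      (9 / 64 ≤ |z| ∧ 3 / 32 ≤ |x - y|) := by
  have e := abs_le.1 h
  rcases h1 with h1 | h1 | h1
  · left
    refine ⟨by linarith, ?_⟩
    by_contra! hc
    have := abs_lt.1 hc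
    rcases lt_abs.1 h1 with h2 | h2 <;> linarith
  · by_cases hc : 3 / 32 ≤ |x - z|
    · exact Or.inr (Or.inl ⟨by linarith, hc⟩)
    · left
      have := abs_lt.1 (not_le.1 hc)
      rcases lt_abs.1 h1 with h2 | h2
      · exact ⟨le_abs.2 (Or.inl (by linarith)), le_abs.2 (Or.inl (by linarith))⟩
      · exact ⟨le_abs.2 (Or.inr (by linarith)), le_abs.2 (Or.inr (by linarith))⟩
  · right; right
    refine ⟨by linarith, ?_⟩
    by_contra! hc
    have := abs_lt.1 hc
    rcases lt_abs.1 h1 with h2 | h2 <;> linarith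

section Pieces

/-- The label of a frequency below `M`: its cell of length `M/64`, and whether it is below
`M/2`. -/
def label (M y : ℝ) : ℤ × Bool :=
  open Classical in (⌊64 * (2 * Real.pi * y / M)⌋, decide (y ∈ freqSet (M / 2)))

/-- The frequencies below `M` with label `p`. -/
def piece (M : ℝ) (p : ℤ × Bool) : Set ℝ := {y ∈ freqSet M | label M y = p}

/-- The labels that occur. -/
def labels : Finset (ℤ × Bool) := Finset.Icc (-64) 64 ×ˢ Finset.univ

/-- The labels of frequencies below `M/2`. -/
def innerLabels : Finset (ℤ × Bool) := labels.filter fun p => p.2 = true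

theorem measurable_label (M : ℝ) : Measurable (label M) := by
  refine Measurable.prodMk ?_ ?_
  · exact Int.measurable_floor.comp (by fun_prop)
  · exact measurable_to_bool (by
      have : (fun y => open Classical in decide (y ∈ freqSet (M / 2))) ⁻¹' {true}
        = freqSet (M / 2) := by ext; simp
      rw [this]; exact measurableSet_freqSet _)

theorem measurableSet_piece (M : ℝ) (p : ℤ × Bool) : MeasurableSet (piece M p) :=
  (measurableSet_freqSet M).inter (measurable_label M (measurableSet_singleton p))

theorem piece_subset (M : ℝ) (p : ℤ × Bool) : piece M p ⊆ freqSet M := fun _ h => h.1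

theorem freqSet_subset {M M' : ℝ} (h : M ≤ M') : freqSet M ⊆ freqSet M' := fun _ hy =>
  le_trans (b := M) hy h

theorem abs_div_le_one {M y : ℝ} (hM : 0 < M) (hy : y ∈ freqSet M) :
    |2 * Real.pi * y / M| ≤ 1 := by
  rw [abs_div, abs_of_pos hM, div_le_one hM]; exact hy

theorem label_mem {M y : ℝ} (hM : 0 < M) (hy : y ∈ freqSet M) : label M y ∈ labels := by
  have h := abs_le.1 (abs_div_le_one hM hy)
  simp only [labels, label, Finset.mem_product, Finset.mem_Icc, Finset.mem_univ, and_true]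
  constructor
  · rw [Int.le_floor]; push_cast; linarith [h.1]
  · have h2 := Int.floor_le (64 * (2 * Real.pi * y / M))
    have : ((⌊64 * (2 * Real.pi * y / M)⌋ : ℤ) : ℝ) ≤ (64 : ℤ) := by push_cast; linarith [h.2]
    exact_mod_cast this

-- the 258 labels are never enumerated
attribute [irreducible] labels

theorem label_mem_inner {M y : ℝ} (hM : 0 < M) (hy : y ∈ freqSet (M / 2)) :
    label M y ∈ innerLabels := by
  refine Finset.mem_filter.2 ⟨label_mem hM (freqSet_subset (by linarith) hy), ?_⟩
  simp [label, hy]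

theorem abs_sub_le_of_mem_piece {M y y' : ℝ} {p : ℤ × Bool} (hy : y ∈ piece M p)
    (hy' : y' ∈ piece M p) : |2 * Real.pi * y / M - 2 * Real.pi * y' / M| ≤ 1 / 64 := by
  have h : ⌊64 * (2 * Real.pi * y / M)⌋ = ⌊64 * (2 * Real.pi * y' / M)⌋ :=
    congrArg Prod.fst (hy.2.trans hy'.2.symm)
  have := Int.abs_sub_lt_one_of_floor_eq_floor h
  rw [abs_lt] at this
  rw [abs_le]
  constructor <;> linarith [this.1, this.2]

theorem freeSol_eq_sum {ι : Type*} [DecidableEq ι] (J : Set ℝ) {R : ℝ}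
    (hR : ∀ y ∈ J, |y| ≤ R) (g : ℝ → ι) (s : Finset ι)
    (hm : ∀ p, MeasurableSet {y ∈ J | g y = p}) (hs : ∀ y ∈ J, g y ∈ s) (a : L2) (t x : ℝ) :
    freeSol J a t x = ∑ p ∈ s, freeSol {y ∈ J | g y = p} a t x := by
  unfold freeSol
  rw [← integral_finsetSum s fun p _ => integrable_waveSymb_mul (hm p)
    (fun y hy => hR y hy.1) t x a]
  refine integral_congr_ae (.of_forall fun y => ?_)
  dsimp only
  rw [← Finset.sum_mul]
  congr 1
  by_cases hy : y ∈ J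
  · rw [Finset.sum_eq_single_of_mem (g y) (hs y hy)]
    · simp [waveSymb, hy]
    · intro p _ hp
      simp [waveSymb, hp.symm]
  · simp [waveSymb, hy]

theorem freeSol_freqSet_eq_sum {M : ℝ} (hM : 0 < M) (a : L2) (t x : ℝ) :
    freeSol (freqSet M) a t x = ∑ p ∈ labels, freeSol (piece M p) a t x :=
  freeSol_eq_sum _ (fun _ => abs_le_of_mem_freqSet) (label M) labels
    (measurableSet_piece M) (fun _ => label_mem hM) a t x

theorem freeSol_freqSet_half_eq_sum {M : ℝ} (hM : 0 < M) (a : L2) (t x : ℝ) :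
    freeSol (freqSet (M / 2)) a t x = ∑ p ∈ innerLabels, freeSol (piece M p) a t x := by
  rw [freeSol_eq_sum _ (fun _ => abs_le_of_mem_freqSet) (label M)
    innerLabels (fun p => (measurableSet_freqSet _).inter
      (measurable_label M (measurableSet_singleton p))) (fun _ => label_mem_inner hM) a t x]
  refine Finset.sum_congr rfl fun p hp => ?_
  congr 1
  ext y
  have h2 := (Finset.mem_filter.1 hp).2
  constructor
  · exact fun h => ⟨freqSet_subset (by linarith) h.1, h.2⟩
  · rintro ⟨h, h3⟩
    have h4 := congrArg Prod.snd h3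
    rw [h2] at h4
    exact ⟨by simpa [label] using h4, h3⟩

/-- The triples of labels in which some frequency is above `M/2`. -/
def outerTriples : Finset ((ℤ × Bool) × (ℤ × Bool) × (ℤ × Bool)) :=
  (labels ×ˢ labels ×ˢ labels) \ (innerLabels ×ˢ innerLabels ×ˢ innerLabels)

/-- Every product of pieces in which a frequency is above `M/2` occurs exactly once, since each
piece lies on one side of `M/2`. -/
theorem triple_sub_triple_eq_sum {M : ℝ} (hM : 0 < M) (a : L2) (x : ℝ) :
    triple (freqSet M) (freqSet M) (freqSet M) a x
      - triple (freqSet (M / 2)) (freqSet (M / 2)) (freqSet (M / 2)) a x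
      = ∑ q ∈ outerTriples, triple (piece M q.1) (piece M q.2.1) (piece M q.2.2) a x := by
  have hsub : innerLabels ⊆ labels := Finset.filter_subset _ _
  have key : ∀ s : Finset (ℤ × Bool), (∑ p ∈ s, freeSol (piece M p) a 0 x) *
      star (∑ p ∈ s, freeSol (piece M p) a 0 x) * (∑ p ∈ s, freeSol (piece M p) a 0 x)
      = ∑ q ∈ s ×ˢ s ×ˢ s, triple (piece M q.1) (piece M q.2.1) (piece M q.2.2) a x := by
    intro s
    simp only [triple, Finset.sum_product, star_sum]
    rw [Finset.sum_mul_sum]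
    simp only [Finset.sum_mul]
    exact Finset.sum_congr rfl fun i _ => Finset.sum_congr rfl fun j _ => Finset.mul_sum _ _ _
  rw [outerTriples, Finset.sum_sdiff_eq_sub (Finset.product_subset_product hsub
    (Finset.product_subset_product hsub hsub)), ← key, ← key]
  simp only [triple, freeSol_freqSet_eq_sum hM, freeSol_freqSet_half_eq_sum hM]

/-- Cells of length `M/64` are short enough for their separation to be read off from
any of their points. -/
theorem transversal_piece {M N : ℝ} (hN : 0 < N) (hMN : 16 * N ≤ M)
    {q : (ℤ × Bool) × (ℤ × Bool) × (ℤ × Bool)} (hq : q ∈ outerTriples) :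
    Transversal N (M / 128) (piece M q.1) (piece M q.2.1) (piece M q.2.2) := by
  have hM : 0 < M := by linarith
  by_cases hres : ∀ y₁ ∈ piece M q.1, ∀ y₂ ∈ piece M q.2.1, ∀ y₃ ∈ piece M q.2.2,
      y₁ - y₂ + y₃ ∉ freqSet N
  · exact Or.inl hres
  right
  push Not at hres
  obtain ⟨y₁, h₁, y₂, h₂, y₃, h₃, hy⟩ := hres
  have hpi := Real.pi_gt_three
  have hpi4 := Real.pi_le_four
  -- normalized frequencies
  have hsmall : ∀ y ∈ freqSet N, |2 * Real.pi * y / M| ≤ 1 / 16 := by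
    intro y hy
    rw [abs_div, abs_of_pos hM, div_le_iff₀ hM]
    have : |2 * Real.pi * y| ≤ N := hy
    linarith
  have hout : ∀ {y p}, y ∈ piece M p → p ∉ innerLabels → 1 / 2 < |2 * Real.pi * y / M| := by
    intro y p hyp hp
    by_contra! hc
    refine hp ?_
    rw [← hyp.2]
    refine label_mem_inner hM ?_
    change |2 * Real.pi * y| ≤ M / 2
    rw [abs_div, abs_of_pos hM, div_le_iff₀ hM] at hc
    linarith
  have hsep : ∀ {p p' : ℤ × Bool} {y y' : ℝ}, y ∈ piece M p → y' ∈ piece M p' →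
      3 / 32 ≤ |2 * Real.pi * y / M - 2 * Real.pi * y' / M| →
      ∀ z ∈ piece M p, ∀ z' ∈ piece M p', M / 128 ≤ |z - z'| := by
    intro p p' y y' hy hy' h z hz z' hz'
    have e1 := abs_le.1 (abs_sub_le_of_mem_piece hy hz)
    have e2 := abs_le.1 (abs_sub_le_of_mem_piece hy' hz')
    have e3 : 1 / 16 ≤ |2 * Real.pi * z / M - 2 * Real.pi * z' / M| := by
      rcases le_abs.1 h with h | h
      · exact le_abs.2 (Or.inl (by linarith))
      · exact le_abs.2 (Or.inr (by linarith))
    rw [← sub_div, ← mul_sub, abs_div, abs_of_pos hM, le_div_iff₀ hM, abs_mul,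
      abs_of_pos Real.two_pi_pos] at e3
    nlinarith [abs_nonneg (z - z')]
  have hsep0 : ∀ {p : ℤ × Bool} {y : ℝ}, y ∈ piece M p → 9 / 64 ≤ |2 * Real.pi * y / M| →
      ∀ z ∈ piece M p, ∀ z' ∈ freqSet N, M / 128 ≤ |z - z'| := by
    intro p y hy h z hz z' hz'
    have e1 := abs_le.1 (abs_sub_le_of_mem_piece hy hz)
    have e2 := abs_le.1 (hsmall z' hz')
    have e3 : 1 / 16 ≤ |2 * Real.pi * z / M - 2 * Real.pi * z' / M| := by
      rcases le_abs.1 h with h | h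
      · exact le_abs.2 (Or.inl (by linarith))
      · exact le_abs.2 (Or.inr (by linarith))
    rw [← sub_div, ← mul_sub, abs_div, abs_of_pos hM, le_div_iff₀ hM, abs_mul,
      abs_of_pos Real.two_pi_pos] at e3
    nlinarith [abs_nonneg (z - z')]
  have hsum : |2 * Real.pi * y₁ / M - 2 * Real.pi * y₂ / M + 2 * Real.pi * y₃ / M| ≤ 1 / 16 := by
    have := hsmall _ hy
    rwa [mul_add, mul_sub, add_div, sub_div] at this
  have hlarge : 1 / 2 < |2 * Real.pi * y₁ / M| ∨ 1 / 2 < |2 * Real.pi * y₂ / M| ∨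
      1 / 2 < |2 * Real.pi * y₃ / M| := by
    have := (Finset.mem_sdiff.1 hq).2
    simp only [Finset.mem_product, not_and_or] at this
    rcases this with h | h | h
    · exact Or.inl (hout h₁ h)
    · exact Or.inr (Or.inl (hout h₂ h))
    · exact Or.inr (Or.inr (hout h₃ h))
  rcases resonance_cases hsum hlarge with ⟨e, e'⟩ | ⟨e, e'⟩ | ⟨e, e'⟩
  · exact Or.inl ⟨hsep0 h₁ e, hsep h₂ h₃ e'⟩
  · exact Or.inr (Or.inl ⟨hsep0 h₂ e, hsep h₁ h₃ e'⟩)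
  · exact Or.inr (Or.inr ⟨hsep0 h₃ e, hsep h₁ h₂ e'⟩)

end Pieces

/-- The frequencies `|2πy| ≤ N` of the cubic nonlinearity evaluated at the frequencies
`|2πy| ≤ M` of `U`, in the interaction picture. -/
def lowCubic (N M : ℝ) (U : ℝ → L2) (t : ℝ) : L2 :=
  force N t (triple (freqSet M) (freqSet M) (freqSet M) (U t))

theorem sq_sum_le_card_mul {ι : Type*} (s : Finset ι) (f : ι → ℝ≥0∞) :
    (∑ i ∈ s, f i) ^ 2 ≤ s.card * ∑ i ∈ s, f i ^ 2 := by
  have h := ENNReal.inner_le_Lp_mul_Lq s (fun _ => 1) f Real.HolderConjugate.two_two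
  simp only [one_mul, ENNReal.one_rpow, Finset.sum_const, nsmul_eq_mul, mul_one] at h
  calc _ ≤ _ := pow_le_pow_left₀ zero_le h 2
    _ = _ := by
        rw [mul_pow, ← ENNReal.rpow_natCast, ← ENNReal.rpow_mul, ← ENNReal.rpow_natCast,
          ← ENNReal.rpow_mul]
        norm_num

theorem toL2_sum {ι : Type*} (s : Finset ι) {f : ι → ℝ → ℂ} (hf : ∀ i, MemLp (f i) 2 volume) :
    toL2 (fun x => ∑ i ∈ s, f i x) = ∑ i ∈ s, toL2 (f i) := by
  classical
  have hs : ∀ s : Finset ι, MemLp (fun x => ∑ i ∈ s, f i x) 2 volume := fun s =>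
    memLp_finsetSum s fun i _ => hf i
  induction s using Finset.induction_on with
  | empty =>
    have : MemLp (fun _ : ℝ => (0 : ℂ)) 2 volume := MemLp.zero
    simp only [Finset.sum_empty]
    rw [toL2_of_memLp this]
    exact MemLp.toLp_zero this
  | insert i s hi ih =>
    rw [Finset.sum_insert hi, ← ih, toL2_of_memLp (hs _), toL2_of_memLp (hs s),
      toL2_of_memLp (hf i), ← MemLp.toLp_add]
    refine MemLp.toLp_congr _ _ (.of_forall fun x => ?_)
    simp [Finset.sum_insert hi]

theorem force_sub {N t : ℝ} {P P' : ℝ → ℂ} (hP : MemLp P 2 volume) (hP' : MemLp P' 2 volume) :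
    force N t P - force N t P' = force N t fun x => P x - P' x := by
  have h : toL2 (fun x => P x - P' x) = toL2 P - toL2 P' := toL2_sub hP hP'
  rw [force, force, force, h, fourier_L2_sub, map_sub]

theorem force_sum {ι : Type*} (s : Finset ι) {N t : ℝ} {P : ι → ℝ → ℂ}
    (hP : ∀ i, MemLp (P i) 2 volume) :
    force N t (fun x => ∑ i ∈ s, P i x) = ∑ i ∈ s, force N t (P i) := by
  have h : ∀ f : ι → L2, (𝓕 (∑ i ∈ s, f i) : L2) = ∑ i ∈ s, 𝓕 (f i) := fun f =>
    map_sum (Lp.fourierTransformₗᵢ ℝ ℂ) f s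
  simp only [force]
  rw [toL2_sum s hP, h, map_sum]

theorem lowCubic_sub_eq_sum {N M : ℝ} (hM : 0 < M) (U : ℝ → L2) (t : ℝ) :
    lowCubic N M U t - lowCubic N (M / 2) U t = ∑ q ∈ outerTriples,
      force N t (triple (piece M q.1) (piece M q.2.1) (piece M q.2.2) (U t)) := by
  have hR : ∀ p, ∀ y ∈ piece M p, |y| ≤ M := fun p y hy =>
    abs_le_of_mem_freqSet (piece_subset M p hy)
  have hF : ∀ M', MemLp (triple (freqSet M') (freqSet M') (freqSet M') (U t)) 2 volume := fun M' =>
    memLp_triple (measurableSet_freqSet _) (measurableSet_freqSet _) (measurableSet_freqSet _)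
      (fun _ => abs_le_of_mem_freqSet) (fun _ => abs_le_of_mem_freqSet)
      (fun _ => abs_le_of_mem_freqSet) _
  rw [lowCubic, lowCubic, force_sub (hF M) (hF (M / 2)), ← force_sum]
  · simp only [triple_sub_triple_eq_sum hM]
  · exact fun q => memLp_triple (measurableSet_piece _ _) (measurableSet_piece _ _)
      (measurableSet_piece _ _) (hR _) (hR _) (hR _) _

/-- The nonlinearity in `L²`, by the `L⁶` Strichartz estimate. -/
theorem Controlled.lowCubic_le {I : Set ℝ} {M N : ℝ} {U : ℝ → L2} {X : ℝ≥0∞}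
    (h : Controlled I M U X) (hI : MeasurableSet I) :
    ∫⁻ t in I, ‖lowCubic N M U t‖ₑ ^ 2 ≤ 48 * X ^ 3 := by
  refine le_trans ?_ (h.lintegral_pow_six_le hI le_rfl (measurableSet_freqSet M))
  refine lintegral_mono fun t => ?_
  refine (enorm_force_sq_le_toL2 N t (memLp_triple (measurableSet_freqSet M)
    (measurableSet_freqSet _) (measurableSet_freqSet _) (fun _ => abs_le_of_mem_freqSet)
    (fun _ => abs_le_of_mem_freqSet) (fun _ => abs_le_of_mem_freqSet) _)).trans (le_of_eq ?_)
  refine lintegral_congr fun x => ?_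
  rw [enorm_triple]; ring

theorem add_sq_le_two_mul (a b : ℝ≥0∞) : (a + b) ^ 2 ≤ 2 * (a ^ 2 + b ^ 2) := by
  have h := sq_sum_le_card_mul Finset.univ ![a, b]
  simpa [Fin.sum_univ_two] using h

/-- The product of a continuous curve in `L²` with a locally bounded continuous function is
continuous in `L²`, by dominated convergence. -/
theorem continuous_toL2_mul {V W : ℝ → ℝ → ℂ} (hV : ∀ t, MemLp (V t) 2 volume)
    (hVc : Continuous fun t => toL2 (V t)) (hW : Continuous (Function.uncurry W))
    (hb : ∀ t₀, ∃ C : ℝ, ∀ᶠ t in 𝓝 t₀, ∀ x, ‖W t x‖ ≤ C) :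
    (∀ t, MemLp (fun x => W t x * V t x) 2 volume) ∧
      Continuous fun t => toL2 fun x => W t x * V t x := by
  have hWt : ∀ t, Continuous (W t) := fun t => hW.comp (f := fun x => (t, x)) (by fun_prop)
  have hm : ∀ t, MemLp (fun x => W t x * V t x) 2 volume := by
    intro t
    obtain ⟨C, hC⟩ := hb t
    exact (hV t).mul' (memLp_top_of_bound (hWt t).aestronglyMeasurable C
      (.of_forall fun x => hC.self_of_nhds x))
  refine ⟨hm, continuous_iff_continuousAt.2 fun t₀ => ?_⟩
  obtain ⟨C, hC⟩ := hb t₀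
  have hsq : ∀ {f g : ℝ → ℂ}, MemLp f 2 volume → MemLp g 2 volume →
      ‖toL2 f - toL2 g‖ₑ ^ 2 = ∫⁻ x, ‖f x - g x‖ₑ ^ 2 := fun hf hg => by
    rw [← toL2_sub hf hg]; exact enorm_toL2_sq (hf.sub hg)
  -- a measurable representative of `V t₀`
  set v : ℝ → ℂ := (toL2 (V t₀) : ℝ → ℂ) with hv
  have hvm : Measurable v := (Lp.stronglyMeasurable (toL2 (V t₀))).measurable
  have hWv : ∀ t, Measurable fun x => (‖W t x - W t₀ x‖ₑ * ‖v x‖ₑ) ^ 2 := fun t =>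
    ((((hWt t).sub (hWt t₀)).enorm.measurable.fun_mul hvm.enorm).pow_const 2)
  have hlim : Tendsto (fun t => 2 * (ENNReal.ofReal C ^ 2 * ‖toL2 (V t) - toL2 (V t₀)‖ₑ ^ 2
      + ∫⁻ x, (‖W t x - W t₀ x‖ₑ * ‖v x‖ₑ) ^ 2)) (𝓝 t₀) (𝓝 0) := by
    have h1 : Tendsto (fun t => ‖toL2 (V t) - toL2 (V t₀)‖ₑ) (𝓝 t₀) (𝓝 0) := by
      have hc : Continuous fun t => ‖toL2 (V t) - toL2 (V t₀)‖ₑ :=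
        (hVc.sub continuous_const).enorm
      simpa using hc.tendsto t₀
    have h2 : Tendsto (fun t => ∫⁻ x, (‖W t x - W t₀ x‖ₑ * ‖v x‖ₑ) ^ 2) (𝓝 t₀)
        (𝓝 (∫⁻ _ : ℝ, 0)) := by
      refine tendsto_lintegral_filter_of_dominated_convergence
        (fun x => (ENNReal.ofReal (2 * C) * ‖v x‖ₑ) ^ 2) ?_ ?_ ?_ ?_
      · exact .of_forall hWv
      · filter_upwards [hC] with t ht
        refine .of_forall fun x => ?_
        gcongr
        rw [← ofReal_norm]
        refine ENNReal.ofReal_le_ofReal ((norm_sub_le _ _).trans ?_)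
        linarith [ht x, hC.self_of_nhds x]
      · simp only [mul_pow]
        rw [lintegral_const_mul' _ _ (ENNReal.pow_ne_top ENNReal.ofReal_ne_top),
          hv, L2_lintegral_sq]
        exact ENNReal.mul_ne_top (ENNReal.pow_ne_top ENNReal.ofReal_ne_top) (by simp)
      · refine .of_forall fun x => ?_
        have h3 : Tendsto (fun t => ‖W t x - W t₀ x‖ₑ) (𝓝 t₀) (𝓝 0) := by
          have h4 : Continuous fun t => ‖W t x - W t₀ x‖ₑ :=
            ((hW.comp (f := fun t => (t, x)) (by fun_prop)).sub continuous_const).enorm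
          simpa using h4.tendsto t₀
        have h5 := ((ENNReal.continuous_pow 2).tendsto _).comp
          (ENNReal.Tendsto.mul_const h3 (b := ‖v x‖ₑ) (Or.inr enorm_ne_top))
        simpa [Function.comp_def] using h5
    have h3 := ENNReal.Tendsto.const_mul (a := 2) ((ENNReal.Tendsto.const_mul
      (a := ENNReal.ofReal C ^ 2) (((ENNReal.continuous_pow 2).tendsto _).comp h1)
      (Or.inr (by finiteness))).add h2)
      (Or.inr (by norm_num))
    simpa [Function.comp_def] using h3
  have hle : ∀ᶠ t in 𝓝 t₀, ‖(toL2 fun x => W t x * V t x) - toL2 fun x => W t₀ x * V t₀ x‖ₑ ^ 2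
      ≤ 2 * (ENNReal.ofReal C ^ 2 * ‖toL2 (V t) - toL2 (V t₀)‖ₑ ^ 2
      + ∫⁻ x, (‖W t x - W t₀ x‖ₑ * ‖v x‖ₑ) ^ 2) := by
    filter_upwards [hC] with t ht
    rw [hsq (hm t) (hm t₀), hsq (hV t) (hV t₀), ← lintegral_const_mul' _ _ (by finiteness),
      ← lintegral_add_right _ (hWv t), ← lintegral_const_mul' _ _ (by norm_num)]
    refine lintegral_mono_ae ?_
    filter_upwards [toL2_ae (hV t₀)] with x hx
    have e : W t x * V t x - W t₀ x * V t₀ x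
        = W t x * (V t x - V t₀ x) + (W t x - W t₀ x) * V t₀ x := by ring
    rw [e, hv, hx, ← mul_pow, ← enorm_mul (W t x - W t₀ x)]
    refine le_trans ?_ (add_sq_le_two_mul _ _)
    gcongr
    refine (enorm_add_le _ _).trans ?_
    gcongr
    rw [enorm_mul]
    gcongr
    rw [← ofReal_norm]
    exact ENNReal.ofReal_le_ofReal (ht x)
  have h5 := tendsto_of_tendsto_of_tendsto_of_le_of_le' tendsto_const_nhds hlim
    (.of_forall fun _ => zero_le) hle
  have h6 := (ENNReal.continuous_rpow_const (y := 1 / 2)).tendsto (0 : ℝ≥0∞)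
  have h7 := h6.comp h5
  refine tendsto_iff_edist_tendsto_0.2 ?_
  simp only [edist_eq_enorm_sub]
  refine Tendsto.congr (fun t => ?_) (by simpa using h7)
  simp only [Function.comp]
  rw [← ENNReal.rpow_natCast, ← ENNReal.rpow_mul]
  norm_num

theorem continuous_force (N : ℝ) {P : ℝ → ℝ → ℂ} (hP : Continuous fun t => toL2 (P t)) :
    Continuous fun t => force N t (P t) := by
  have h := (continuous_waveOp (measurableSet_freqSet N) (fun y => abs_le_of_mem_freqSet)).comp
    (by fun_prop : Continuous fun t : ℝ => (-t, (0 : ℝ)))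
  exact h.clm_apply ((Lp.fourierTransformₗᵢ ℝ ℂ).continuous.comp hP)

theorem continuous_toL2_freeSol {J : Set ℝ} (hJ : MeasurableSet J) {R : ℝ} (hR : ∀ y ∈ J, |y| ≤ R)
    {U : ℝ → L2} (hU : Continuous U) : Continuous fun t => toL2 (freeSol J (U t) 0) := by
  simp only [toL2_freeSol hJ hR]
  exact (Lp.fourierTransformₗᵢ ℝ ℂ).symm.continuous.comp ((waveOp J 0 0).continuous.comp hU)

theorem continuous_toL2_triple {J₁ J₂ J₃ : Set ℝ} (h₁ : MeasurableSet J₁) (h₂ : MeasurableSet J₂)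
    (h₃ : MeasurableSet J₃) {R : ℝ} (hR₁ : ∀ y ∈ J₁, |y| ≤ R) (hR₂ : ∀ y ∈ J₂, |y| ≤ R)
    (hR₃ : ∀ y ∈ J₃, |y| ≤ R) {U : ℝ → L2} (hU : Continuous U) :
    Continuous fun t => toL2 (triple J₁ J₂ J₃ (U t)) := by
  have hc : ∀ {J : Set ℝ}, MeasurableSet J → (∀ y ∈ J, |y| ≤ R) →
      Continuous (Function.uncurry fun t x => freeSol J (U t) 0 x) := fun hJ hR =>
    (continuous_freeSol hJ hR).comp (f := fun z : ℝ × ℝ => (U z.1, (0 : ℝ), z.2)) (by fun_prop)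
  have hbd : ∀ {J : Set ℝ}, MeasurableSet J → (∀ y ∈ J, |y| ≤ R) → ∀ t x,
      ‖freeSol J (U t) 0 x‖ ≤ Real.sqrt (2 * max R 0 * ‖U t‖ ^ 2) := fun hJ hR t x => by
    refine Real.le_sqrt_of_sq_le ((norm_freeSol_sq_le hJ (fun y hy => (hR y hy).trans
      (le_max_left _ _)) (le_max_right _ _) _ _ _).trans ?_)
    gcongr
    exact norm_waveOp_le hJ _ _ _
  refine (continuous_toL2_mul (V := fun t => freeSol J₃ (U t) 0)
    (W := fun t x => freeSol J₁ (U t) 0 x * star (freeSol J₂ (U t) 0 x))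
    (fun t => memLp_freeSol h₃ hR₃ _ _) (continuous_toL2_freeSol h₃ hR₃ hU)
    ((hc h₁ hR₁).mul (hc h₂ hR₂).star) fun t₀ => ⟨(2 * max R 0 * (‖U t₀‖ + 1) ^ 2), ?_⟩).2
  filter_upwards [(hU.norm.tendsto t₀).eventually_le_const (lt_add_one _)] with t ht x
  have hs := Real.sq_sqrt (by positivity : 0 ≤ 2 * max R 0 * ‖U t‖ ^ 2)
  calc _ ≤ Real.sqrt (2 * max R 0 * ‖U t‖ ^ 2) * Real.sqrt (2 * max R 0 * ‖U t‖ ^ 2) := by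
        rw [norm_mul, norm_star]
        exact mul_le_mul (hbd h₁ hR₁ t x) (hbd h₂ hR₂ t x) (norm_nonneg _) (Real.sqrt_nonneg _)
    _ = 2 * max R 0 * ‖U t‖ ^ 2 := by rw [← pow_two, hs]
    _ ≤ _ := by gcongr

theorem continuous_lowCubic (N M : ℝ) {U : ℝ → L2} (hU : Continuous U) :
    Continuous (lowCubic N M U) :=
  continuous_force N (continuous_toL2_triple (measurableSet_freqSet M) (measurableSet_freqSet M)
    (measurableSet_freqSet M) (fun _ => abs_le_of_mem_freqSet) (fun _ => abs_le_of_mem_freqSet)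
    (fun _ => abs_le_of_mem_freqSet) hU)

/-- The gain for high-high interactions into the frequencies below `N`: a full power of `M` in
the weak norm, and half a power in `L²`. -/
theorem Controlled.lowCubic_sub_le {I : Set ℝ} {M N : ℝ} {U : ℝ → L2} {X : ℝ≥0∞}
    (h : Controlled I M U X) (hI : MeasurableSet I) (hU : Continuous U) (hN : 0 < N)
    (hMN : 16 * N ≤ M) :
    (∀ a : L2, (∫⁻ t in I, ‖inner ℂ a (lowCubic N M U t - lowCubic N (M / 2) U t)‖ₑ) ^ 2
      ≤ outerTriples.card ^ 2 * (ENNReal.ofReal (128 / M) ^ 2 * X ^ 3) * ‖a‖ₑ ^ 2) ∧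
    ∫⁻ t in I, ‖lowCubic N M U t - lowCubic N (M / 2) U t‖ₑ ^ 2
      ≤ outerTriples.card ^ 2 * (ENNReal.ofReal (2 * N) * (ENNReal.ofReal (128 / M) * X ^ 3)) := by
  have hM : 0 < M := by linarith
  have hb := fun q (hq : q ∈ outerTriples) => h.force_triple_le hI hU (piece_subset M q.1)
    (piece_subset M q.2.1) (piece_subset M q.2.2) (measurableSet_piece M _)
    (measurableSet_piece M _) (measurableSet_piece M _) (d := M / 128) (by positivity) hN.le
    (transversal_piece hN hMN hq)
  have hc : ∀ q : (ℤ × Bool) × (ℤ × Bool) × (ℤ × Bool), Continuous fun t =>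
      force N t (triple (piece M q.1) (piece M q.2.1) (piece M q.2.2) (U t)) := fun q =>
    continuous_force N (continuous_toL2_triple (measurableSet_piece M _) (measurableSet_piece M _)
      (measurableSet_piece M _) (fun y hy => abs_le_of_mem_freqSet (piece_subset M _ hy))
      (fun y hy => abs_le_of_mem_freqSet (piece_subset M _ hy))
      (fun y hy => abs_le_of_mem_freqSet (piece_subset M _ hy)) hU)
  simp only [one_div_div] at hb
  simp only [lowCubic_sub_eq_sum hM, inner_sum]
  constructor
  · intro a
    calc _ ≤ (∑ q ∈ outerTriples, ∫⁻ t in I, ‖inner ℂ a (force N t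
          (triple (piece M q.1) (piece M q.2.1) (piece M q.2.2) (U t)))‖ₑ) ^ 2 := by
          rw [← lintegral_finsetSum _ fun q _ => ?_]
          · gcongr with t
            exact enorm_sum_le _ _
          · exact ((continuous_const.inner (hc q)).enorm).measurable
      _ ≤ outerTriples.card * ∑ q ∈ outerTriples, (∫⁻ t in I, ‖inner ℂ a (force N t
          (triple (piece M q.1) (piece M q.2.1) (piece M q.2.2) (U t)))‖ₑ) ^ 2 :=
          sq_sum_le_card_mul _ _
      _ ≤ outerTriples.card * ∑ q ∈ outerTriples,
          ENNReal.ofReal (128 / M) ^ 2 * X ^ 3 * ‖a‖ₑ ^ 2 := by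
          gcongr with q hq
          exact (hb q hq).1 a
      _ = _ := by rw [Finset.sum_const, nsmul_eq_mul]; ring
  · calc _ ≤ ∫⁻ t in I, outerTriples.card * ∑ q ∈ outerTriples, ‖force N t
          (triple (piece M q.1) (piece M q.2.1) (piece M q.2.2) (U t))‖ₑ ^ 2 := by
          refine lintegral_mono fun t => le_trans ?_ (sq_sum_le_card_mul _ _)
          gcongr
          exact enorm_sum_le _ _
      _ = outerTriples.card * ∑ q ∈ outerTriples, ∫⁻ t in I, ‖force N t
          (triple (piece M q.1) (piece M q.2.1) (piece M q.2.2) (U t))‖ₑ ^ 2 := by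
          rw [lintegral_const_mul' _ _ (by finiteness), lintegral_finsetSum _ fun q _ => ?_]
          exact (hc q).enorm.measurable.pow_const 2
      _ ≤ outerTriples.card * ∑ q ∈ outerTriples,
          ENNReal.ofReal (2 * N) * (ENNReal.ofReal (128 / M) * X ^ 3) := by
          gcongr with q hq
          exact (hb q hq).2
      _ = _ := by rw [Finset.sum_const, nsmul_eq_mul]; ring

/-! ### The dual modulation weight and summation of dyadic blocks -/

theorem abs_le_bracket (x : ℝ) : |x| ≤ bracket x :=
  Real.abs_le_sqrt (by linarith)

/-- As `2b - 2 > -1`, the weight is integrable at zero even with `|r|` in place of `⟨r⟩`. -/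
theorem setLIntegral_bracket_le {b L : ℝ} (hb : 1 / 2 < b) (hb1 : b < 1) (hL : 0 < L) :
    ∫⁻ r, {r : ℝ | |r| ≤ L}.indicator (fun r => ENNReal.ofReal (bracket r ^ (2 * b - 2))) r
      ≤ ENNReal.ofReal (2 * L ^ (2 * b - 1) / (2 * b - 1)) := by
  set g : ℝ → ℝ≥0∞ := (Set.Iic L).indicator fun r => ENNReal.ofReal (r ^ (2 * b - 2)) with hg
  have hgm : Measurable g := by
    refine Measurable.indicator ?_ measurableSet_Iic
    fun_prop
  have hpos : ∫⁻ r in Set.Ioi 0, g r ≤ ENNReal.ofReal (L ^ (2 * b - 1) / (2 * b - 1)) := by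
    rw [hg, setLIntegral_indicator measurableSet_Iic, Set.inter_comm, Set.Ioi_inter_Iic]
    have hint := (intervalIntegral.intervalIntegrable_rpow' (a := 0) (b := L)
      (r := 2 * b - 2) (by linarith))
    rw [intervalIntegrable_iff_integrableOn_Ioc_of_le hL.le] at hint
    rw [← ofReal_integral_eq_lintegral_ofReal hint]
    · rw [← intervalIntegral.integral_of_le hL.le, integral_rpow (Or.inl (by linarith)),
        Real.zero_rpow (by linarith)]
      refine le_of_eq ?_
      congr 1; ring_nf
    · filter_upwards [ae_restrict_mem measurableSet_Ioc] with r hr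
      exact Real.rpow_nonneg hr.1.le _
  have hneg : ∫⁻ r in Set.Iio 0, g (-r) = ∫⁻ r in Set.Ioi 0, g r := by
    have h := (Measure.measurePreserving_neg (volume : Measure ℝ)).setLIntegral_comp_preimage
      (measurableSet_Ioi (a := (0 : ℝ))) hgm
    simpa using h
  calc _ ≤ (∫⁻ r in Set.Iio 0, g (-r)) + ∫⁻ r in Set.Ioi 0, g r := by
        rw [← lintegral_indicator measurableSet_Iio, ← lintegral_indicator measurableSet_Ioi,
          ← lintegral_add_right _ (hgm.indicator measurableSet_Ioi)]
        refine lintegral_mono_ae ?_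
        filter_upwards [compl_mem_ae_iff.2 (measure_singleton (0 : ℝ))] with r hr
        by_cases hrL : |r| ≤ L
        · rw [Set.indicator_of_mem (by exact hrL)]
          have hr0 : r ≠ 0 := hr
          have h1 : bracket r ^ (2 * b - 2) ≤ |r| ^ (2 * b - 2) :=
            Real.rpow_le_rpow_of_nonpos (abs_pos.2 hr0) (abs_le_bracket r) (by linarith)
          refine (ENNReal.ofReal_le_ofReal h1).trans ?_
          rcases lt_or_gt_of_ne hr0 with h | h
          · rw [abs_of_neg h] at hrL ⊢
            simp [hg, h, hrL, not_lt.2 h.le]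
          · rw [abs_of_pos h] at hrL ⊢
            simp [hg, h, hrL, not_lt.2 h.le]
        · rw [Set.indicator_of_notMem (by exact hrL)]
          exact zero_le
    _ ≤ ENNReal.ofReal (L ^ (2 * b - 1) / (2 * b - 1))
        + ENNReal.ofReal (L ^ (2 * b - 1) / (2 * b - 1)) := by
        rw [hneg]; gcongr
    _ = _ := by
        have : 0 ≤ L ^ (2 * b - 1) / (2 * b - 1) :=
          div_nonneg (Real.rpow_nonneg hL.le _) (by linarith)
        rw [← ENNReal.ofReal_add this this]
        congr 1; ring

/-- The weight `⟨2πδσ⟩^{2b-2}`. -/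
def dualWeight (b δ σ : ℝ) : ℝ≥0∞ :=
  ENNReal.ofReal (bracket (2 * Real.pi * δ * σ) ^ (2 * b - 2))

theorem measurable_dualWeight (b δ : ℝ) : Measurable (dualWeight b δ) := by
  refine Measurable.ennreal_ofReal (Measurable.pow_const ?_ _)
  exact measurable_bracket.comp (by fun_prop)

theorem dualWeight_le_one {b : ℝ} (hb1 : b < 1) (δ σ : ℝ) : dualWeight b δ σ ≤ 1 := by
  rw [dualWeight, ← ENNReal.ofReal_one]
  refine ENNReal.ofReal_le_ofReal ?_
  exact Real.rpow_le_one_of_one_le_of_nonpos (one_le_bracket _) (by linarith)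

/-- Interpolation between a supremum bound at modulations below `L` and an `L²` bound at
modulations above `L`. -/
theorem lintegral_dualWeight_le {b δ L : ℝ} (hb : 1 / 2 < b) (hb1 : b < 1) (hδ : 0 < δ)
    (hL : 0 < L) {f : ℝ → ℝ≥0∞} {A B : ℝ≥0∞} (hA : ∀ σ, f σ ≤ A)
    (hB : ∫⁻ σ, f σ ≤ B) :
    ∫⁻ σ, dualWeight b δ σ * f σ ≤ ENNReal.ofReal (2 / (2 * b - 1) * L ^ (2 * b - 1) / δ) * A
      + ENNReal.ofReal (L ^ (2 * b - 2)) * B := by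
  have hc : 0 < 2 * Real.pi * δ := by have := Real.pi_pos; positivity
  set S : Set ℝ := {r : ℝ | |r| ≤ L} with hS
  set φ : ℝ → ℝ≥0∞ := S.indicator fun r => ENNReal.ofReal (bracket r ^ (2 * b - 2)) with hφ
  have hSm : MeasurableSet S := measurableSet_le (by fun_prop) measurable_const
  have hφm : Measurable φ :=
    ((measurable_bracket.pow_const _).ennreal_ofReal).indicator hSm
  calc _ ≤ ∫⁻ σ, (φ (2 * Real.pi * δ * σ) * A + ENNReal.ofReal (L ^ (2 * b - 2)) * f σ) := by
        refine lintegral_mono fun σ => ?_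
        dsimp only
        by_cases h : 2 * Real.pi * δ * σ ∈ S
        · refine le_add_right ?_
          rw [hφ, Set.indicator_of_mem h, dualWeight]
          gcongr
          exact hA σ
        · refine le_add_left ?_
          rw [dualWeight]
          gcongr ENNReal.ofReal ?_ * _
          have h' : L < |2 * Real.pi * δ * σ| := not_le.1 h
          exact Real.rpow_le_rpow_of_nonpos hL (h'.le.trans (abs_le_bracket _)) (by linarith)
    _ = (∫⁻ σ, φ (2 * Real.pi * δ * σ)) * A + ENNReal.ofReal (L ^ (2 * b - 2)) * ∫⁻ σ, f σ := by
        have hm : Measurable fun σ => φ (2 * Real.pi * δ * σ) := hφm.comp (by fun_prop)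
        rw [lintegral_add_left (hm.mul_const A), lintegral_mul_const _ hm,
          lintegral_const_mul' _ _ ENNReal.ofReal_ne_top]
    _ ≤ _ := by
        gcongr
        rw [lintegral_comp_mul_left φ hc.ne', abs_of_pos (inv_pos.2 hc)]
        calc _ ≤ ENNReal.ofReal (2 * Real.pi * δ)⁻¹ *
              ENNReal.ofReal (2 * L ^ (2 * b - 1) / (2 * b - 1)) := by
              gcongr; exact setLIntegral_bracket_le hb hb1 hL
          _ ≤ _ := by
              rw [← ENNReal.ofReal_mul (by positivity)]
              refine ENNReal.ofReal_le_ofReal ?_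
              have h1 : 0 ≤ 2 * L ^ (2 * b - 1) / (2 * b - 1) :=
                div_nonneg (by positivity) (by linarith)
              have h2 : (2 * Real.pi * δ)⁻¹ ≤ δ⁻¹ := by
                gcongr; have := Real.pi_gt_three; nlinarith
              calc _ ≤ δ⁻¹ * (2 * L ^ (2 * b - 1) / (2 * b - 1)) := by gcongr
                _ = _ := by ring

section Cover

variable {n : ℕ} {I : Fin n → Set ℝ}

theorem lintegral_le_sum_cover (hI : ∀ i, MeasurableSet (I i)) {f : ℝ → ℝ≥0∞}
    (hf : ∀ t, f t ≠ 0 → ∃ i, t ∈ I i) : ∫⁻ t, f t ≤ ∑ i, ∫⁻ t in I i, f t := by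
  have h : (⋃ i, I i).indicator f = f := by
    refine Set.indicator_eq_self.2 fun t ht => ?_
    exact Set.mem_iUnion.2 (hf t ht)
  rw [← h, lintegral_indicator (MeasurableSet.iUnion hI), h]
  exact (lintegral_iUnion_le _ _).trans (le_of_eq (tsum_fintype _))

/-- Plancherel's theorem in time, with the localized curve bounded on each interval of a cover. -/
theorem lintegral_fourier_cover_le (hI : ∀ i, MeasurableSet (I i)) {ψ : ℝ → ℂ} {H : ℝ → L2}
    (hψ : Continuous ψ) (hH : Continuous H) (hψc : HasCompactSupport ψ) {a : ℝ}
    (ha : ∀ t, ‖ψ t‖ ≤ a) (hcov : ∀ t, ψ t ≠ 0 → ∃ i, t ∈ I i) {B : ℝ≥0∞}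
    (hB : ∀ i, ∫⁻ t in I i, ‖H t‖ₑ ^ 2 ≤ B) :
    ∫⁻ σ, ‖𝓕 (fun t => ψ t • H t) σ‖ₑ ^ 2 ≤ ENNReal.ofReal a ^ 2 * (n * B) := by
  have hi : Integrable fun t => ψ t • H t :=
    (hψ.smul hH).integrable_of_hasCompactSupport hψc.smul_right
  refine (lintegral_fourier_sq_le hi).trans ?_
  refine (lintegral_le_sum_cover hI (fun t ht => hcov t ?_)).trans ?_
  · rintro h; simp [h] at ht
  calc _ ≤ ∑ i, ENNReal.ofReal a ^ 2 * B := by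
        gcongr with i
        refine le_trans ?_ (mul_le_mul_right (hB i) _)
        rw [← lintegral_const_mul' _ _ (by finiteness)]
        refine lintegral_mono fun t => ?_
        dsimp only
        rw [enorm_smul, mul_pow]
        gcongr
        rw [← ofReal_norm]
        exact ENNReal.ofReal_le_ofReal (ha t)
    _ = _ := by
        rw [Finset.sum_const, nsmul_eq_mul, Finset.card_univ, Fintype.card_fin]; ring

/-- The time Fourier transform of a localized curve, bounded by covering its support. -/
theorem lintegral_dualWeight_fourier_le {b δ L : ℝ} (hb : 1 / 2 < b) (hb1 : b < 1) (hδ : 0 < δ)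
    (hL : 0 < L) (hI : ∀ i, MeasurableSet (I i)) {ψ : ℝ → ℂ} {H : ℝ → L2} (hψ : Continuous ψ)
    (hH : Continuous H) (hψc : HasCompactSupport ψ) {a : ℝ} (ha : ∀ t, ‖ψ t‖ ≤ a)
    (hcov : ∀ t, ψ t ≠ 0 → ∃ i, t ∈ I i) {A B : ℝ≥0∞}
    (hA : ∀ i, ∀ c : L2, (∫⁻ t in I i, ‖inner ℂ c (H t)‖ₑ) ^ 2 ≤ A * ‖c‖ₑ ^ 2)
    (hB : ∀ i, ∫⁻ t in I i, ‖H t‖ₑ ^ 2 ≤ B) :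
    ∫⁻ σ, dualWeight b δ σ * ‖𝓕 (fun t => ψ t • H t) σ‖ₑ ^ 2
      ≤ ENNReal.ofReal (2 / (2 * b - 1) * L ^ (2 * b - 1) / δ) *
          (ENNReal.ofReal a ^ 2 * (n ^ 2 * A))
        + ENNReal.ofReal (L ^ (2 * b - 2)) * (ENNReal.ofReal a ^ 2 * (n * B)) := by
  have hi : Integrable fun t => ψ t • H t :=
    (hψ.smul hH).integrable_of_hasCompactSupport hψc.smul_right
  have hae : ∀ t, ‖ψ t‖ₑ ≤ ENNReal.ofReal a := fun t => by
    rw [← ofReal_norm]; exact ENNReal.ofReal_le_ofReal (ha t)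
  refine lintegral_dualWeight_le hb hb1 hδ hL (fun σ => ?_) ?_
  · set c := 𝓕 (fun t => ψ t • H t) σ with hcdef
    by_cases h0 : ‖c‖ₑ = 0
    · rw [h0]; simp
    have h1 : ‖c‖ₑ ^ 2 ≤ ENNReal.ofReal a * ∑ i, ∫⁻ t in I i, ‖inner ℂ c (H t)‖ₑ := by
      calc ‖c‖ₑ ^ 2 = ‖inner ℂ c c‖ₑ := by
            rw [← ofReal_norm (inner ℂ c c), inner_self_eq_norm_sq_to_K, norm_pow,
              RCLike.norm_ofReal, abs_norm, ENNReal.ofReal_pow (norm_nonneg _), ofReal_norm]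
        _ ≤ ∫⁻ t, ‖ψ t‖ₑ * ‖inner ℂ c (H t)‖ₑ := by
            have hc' : c = ∫ t, Complex.exp ((-2 * Real.pi * inner ℝ t σ : ℝ) * Complex.I) •
                (ψ t • H t) := Real.fourier_eq' _ _
            have hi' : Integrable fun t => Complex.exp ((-2 * Real.pi * inner ℝ t σ : ℝ) *
                Complex.I) • (ψ t • H t) := by
              have hc0 : Continuous fun t : ℝ =>
                Complex.exp ((-2 * Real.pi * inner ℝ t σ : ℝ) * Complex.I) := by fun_prop
              refine hi.norm.mono' (hc0.smul (hψ.smul hH)).aestronglyMeasurable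
                (.of_forall fun t => ?_)
              rw [norm_smul, Complex.norm_exp_ofReal_mul_I, one_mul]
            have e : inner ℂ c c = ∫ t, inner ℂ c (Complex.exp ((-2 * Real.pi * inner ℝ t σ : ℝ) *
                Complex.I) • (ψ t • H t)) :=
              (congrArg (inner ℂ c) hc').trans (integral_inner hi' c).symm
            rw [e]
            refine (enorm_integral_le_lintegral_enorm _).trans (le_of_eq ?_)
            refine lintegral_congr fun t => ?_
            rw [inner_smul_right, inner_smul_right, enorm_mul, enorm_mul, ← ofReal_norm,
              Complex.norm_exp_ofReal_mul_I]
            simp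
        _ ≤ ∫⁻ t, ENNReal.ofReal a * ((⋃ i, I i).indicator (fun t => ‖inner ℂ c (H t)‖ₑ) t) := by
            refine lintegral_mono fun t => ?_
            dsimp only
            by_cases ht : ψ t = 0
            · simp [ht]
            · rw [Set.indicator_of_mem (Set.mem_iUnion.2 (hcov t ht))]
              gcongr; exact hae t
        _ = ENNReal.ofReal a * ∫⁻ t in ⋃ i, I i, ‖inner ℂ c (H t)‖ₑ := by
            rw [lintegral_const_mul' _ _ ENNReal.ofReal_ne_top,
              lintegral_indicator (MeasurableSet.iUnion hI)]
        _ ≤ _ := by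
            gcongr
            exact (lintegral_iUnion_le _ _).trans (le_of_eq (tsum_fintype _))
    have h2 : ‖c‖ₑ ^ 2 * ‖c‖ₑ ^ 2 ≤ ENNReal.ofReal a ^ 2 * (n ^ 2 * A) * ‖c‖ₑ ^ 2 := by
      calc ‖c‖ₑ ^ 2 * ‖c‖ₑ ^ 2 = (‖c‖ₑ ^ 2) ^ 2 := by ring
        _ ≤ (ENNReal.ofReal a * ∑ i, ∫⁻ t in I i, ‖inner ℂ c (H t)‖ₑ) ^ 2 := by gcongr
        _ ≤ ENNReal.ofReal a ^ 2 * (n * ∑ i, (∫⁻ t in I i, ‖inner ℂ c (H t)‖ₑ) ^ 2) := by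
            rw [mul_pow]
            gcongr
            simpa using sq_sum_le_card_mul (Finset.univ : Finset (Fin n))
              (fun i => ∫⁻ t in I i, ‖inner ℂ c (H t)‖ₑ)
        _ ≤ ENNReal.ofReal a ^ 2 * (n * ∑ _i : Fin n, A * ‖c‖ₑ ^ 2) := by
            gcongr with i
            exact hA i c
        _ = _ := by
            rw [Finset.sum_const, nsmul_eq_mul, Finset.card_univ, Fintype.card_fin]; ring
    exact (ENNReal.mul_le_mul_iff_left (by simpa using h0) (by finiteness)).1 h2
  · exact lintegral_fourier_cover_le hI hψ hH hψc ha hcov hB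

end Cover

/-- An interval of radius `ρ` is covered by at most `ρ/r + 1` intervals of radius `r`. -/
theorem exists_cover (c : ℝ) {ρ r : ℝ} (hρ : 0 ≤ ρ) (hr : 0 < r) :
    ∃ (n : ℕ) (x : Fin n → ℝ), (n : ℝ) ≤ ρ / r + 1 ∧
      ∀ t, |t - c| ≤ ρ → ∃ i, t ∈ Set.Icc (x i - r) (x i + r) := by
  refine ⟨⌊ρ / r⌋₊ + 1, fun i => c - ρ + 2 * r * i + r, ?_, fun t ht => ?_⟩
  · push_cast
    linarith [Nat.floor_le (div_nonneg hρ hr.le)]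
  · have ht' := abs_le.1 ht
    have h0 : 0 ≤ (t - (c - ρ)) / (2 * r) := div_nonneg (by linarith) (by linarith)
    have h1 : (t - (c - ρ)) / (2 * r) ≤ ρ / r := by
      rw [div_le_div_iff₀ (by linarith) hr]; nlinarith
    refine ⟨⟨⌊(t - (c - ρ)) / (2 * r)⌋₊, Nat.lt_succ_of_le (Nat.floor_le_floor h1)⟩, ?_⟩
    have h2 := Nat.floor_le h0
    have h3 := Nat.lt_floor_add_one ((t - (c - ρ)) / (2 * r))
    rw [le_div_iff₀ (by linarith)] at h2
    rw [div_lt_iff₀ (by linarith)] at h3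
    constructor <;> dsimp only <;> linarith

theorem sq_tsum_mul_le (f g : ℕ → ℝ≥0∞) :
    (∑' k, f k * g k) ^ 2 ≤ (∑' k, f k ^ 2) * ∑' k, g k ^ 2 := by
  have h := sq_lintegral_mul_le (μ := Measure.count) (f := f) (g := g)
    (measurable_of_countable f).aemeasurable (measurable_of_countable g).aemeasurable
  simpa only [lintegral_count] using h

/-- The weighted `L²` norm of a series whose terms decay geometrically. -/
theorem lintegral_sq_tsum_le {w : ℝ → ℝ≥0∞} (hw : Measurable w) {f : ℕ → ℝ → ℝ≥0∞}
    (hf : ∀ k, Measurable (f k)) {q B : ℝ≥0∞} (hq0 : q ≠ 0) (hq : q < 1)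
    (h : ∀ k, ∫⁻ σ, w σ * f k σ ^ 2 ≤ B * (q ^ k) ^ 4) :
    ∫⁻ σ, w σ * (∑' k, f k σ) ^ 2 ≤ B * ((1 - q ^ 2)⁻¹) ^ 2 := by
  have hqt : q ≠ ∞ := (hq.trans ENNReal.one_lt_top).ne
  have hqq : ∀ k, q ^ k * (q ^ k)⁻¹ = 1 := fun k =>
    ENNReal.mul_inv_cancel (pow_ne_zero _ hq0) (ENNReal.pow_ne_top hqt)
  have hgeo : ∑' k, (q ^ k) ^ 2 = (1 - q ^ 2)⁻¹ := by
    have : ∀ k : ℕ, (q ^ k) ^ 2 = (q ^ 2) ^ k := fun k => by rw [← pow_mul, ← pow_mul, mul_comm]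
    simp only [this]
    exact ENNReal.tsum_geometric _
  calc _ ≤ ∫⁻ σ, (1 - q ^ 2)⁻¹ * ∑' k, w σ * (((q ^ k)⁻¹) ^ 2 * f k σ ^ 2) := by
        refine lintegral_mono fun σ => ?_
        have h1 := sq_tsum_mul_le (fun k => q ^ k) fun k => (q ^ k)⁻¹ * f k σ
        simp only [← mul_assoc, hqq, one_mul, hgeo] at h1
        dsimp only
        rw [ENNReal.tsum_mul_left, mul_left_comm]
        gcongr
        simpa only [mul_pow] using h1
    _ ≤ (1 - q ^ 2)⁻¹ * ∑' k, ((q ^ k)⁻¹) ^ 2 * (B * (q ^ k) ^ 4) := by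
        have hm : ∀ k, Measurable fun σ => w σ * (((q ^ k)⁻¹) ^ 2 * f k σ ^ 2) := fun k =>
          hw.fun_mul (((hf k).pow_const 2).const_mul _)
        rw [lintegral_const_mul _ (Measurable.tsum hm), lintegral_tsum fun k =>
          (hm k).aemeasurable]
        gcongr with k
        calc _ = ((q ^ k)⁻¹) ^ 2 * ∫⁻ σ, w σ * f k σ ^ 2 := by
              rw [← lintegral_const_mul _ (hw.fun_mul ((hf k).pow_const 2))]
              simp only [mul_left_comm]
          _ ≤ _ := by gcongr; exact h k
    _ = (1 - q ^ 2)⁻¹ * (B * ∑' k, (q ^ k) ^ 2) := by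
        have e : ∀ k, ((q ^ k)⁻¹) ^ 2 * (B * (q ^ k) ^ 4) = B * (q ^ k) ^ 2 := fun k => by
          calc _ = B * (q ^ k) ^ 2 * (q ^ k * (q ^ k)⁻¹) ^ 2 := by ring
            _ = _ := by rw [hqq]; ring
        simp only [e, ENNReal.tsum_mul_left]
    _ = _ := by rw [hgeo]; ring

/-- The time Fourier transform of a limit of curves is bounded by the telescoping series. -/
theorem enorm_fourier_le_tsum {ψ : ℝ → ℂ} (hψ : Continuous ψ) (hψc : HasCompactSupport ψ)
    {S : ℕ → ℝ → L2} (hS : ∀ k, Continuous (S k)) {H : ℝ → L2} {B : ℝ}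
    (hB : ∀ k t, ψ t ≠ 0 → ‖S k t‖ ≤ B) (hlim : ∀ t, Tendsto (fun k => S k t) atTop (𝓝 (H t)))
    (σ : ℝ) : ‖𝓕 (fun t => ψ t • H t) σ‖ₑ ≤ ‖𝓕 (fun t => ψ t • S 0 t) σ‖ₑ
      + ∑' k, ‖𝓕 (fun t => ψ t • (S (k + 1) t - S k t)) σ‖ₑ := by
  have hi : ∀ k, Integrable fun t => ψ t • S k t := fun k =>
    (hψ.smul (hS k)).integrable_of_hasCompactSupport hψc.smul_right
  have hstep : ∀ k, 𝓕 (fun t => ψ t • (S (k + 1) t - S k t)) σ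
      = 𝓕 (fun t => ψ t • S (k + 1) t) σ - 𝓕 (fun t => ψ t • S k t) σ := by
    intro k
    simp only [Real.fourier_eq, smul_sub]
    exact integral_sub ((Real.fourierIntegral_convergent_iff σ).2 (hi _))
      ((Real.fourierIntegral_convergent_iff σ).2 (hi _))
  have hpart : ∀ k, ‖𝓕 (fun t => ψ t • S k t) σ‖ₑ ≤ ‖𝓕 (fun t => ψ t • S 0 t) σ‖ₑ
      + ∑ i ∈ Finset.range k, ‖𝓕 (fun t => ψ t • (S (i + 1) t - S i t)) σ‖ₑ := by
    intro k
    induction k with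
    | zero => simp
    | succ k ih =>
      rw [Finset.sum_range_succ, ← add_assoc]
      refine le_trans ?_ (add_le_add_left ih _)
      rw [hstep]
      refine le_trans (le_of_eq ?_) (enorm_add_le _ _)
      rw [add_sub_cancel]
  have hconv : Tendsto (fun k => 𝓕 (fun t => ψ t • S k t) σ) atTop
      (𝓝 (𝓕 (fun t => ψ t • H t) σ)) := by
    simp only [Real.fourier_eq']
    refine tendsto_integral_of_dominated_convergence (fun t => ‖ψ t‖ * B) (fun k => ?_) ?_
      (fun k => .of_forall fun t => ?_) (.of_forall fun t => ?_)
    · have hc0 : Continuous fun t : ℝ =>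
        Complex.exp ((-2 * Real.pi * inner ℝ t σ : ℝ) * Complex.I) := by fun_prop
      exact (hc0.smul (hψ.smul (hS k))).aestronglyMeasurable
    · exact (hψ.norm.integrable_of_hasCompactSupport hψc.norm).mul_const B
    · rw [norm_smul, Complex.norm_exp_ofReal_mul_I, one_mul, norm_smul]
      by_cases h : ψ t = 0
      · simp [h]
      · gcongr; exact hB k t h
    · exact (((hlim t).const_smul (ψ t))).const_smul _
  refine le_of_tendsto hconv.enorm (.of_forall fun k => ?_)
  refine (hpart k).trans ?_
  gcongr
  exact ENNReal.sum_le_tsum _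

/-- The number of intervals of length comparable to `(μN)^{4s}` that cover one of length
comparable to `N^{4s}`. -/
theorem cover_count_le {s ε R N μ : ℝ} (hs0 : s ≤ 0) (hε : 0 < ε) (hN : 0 < N)
    (hμ : 1 ≤ μ) :
    R * N ^ (4 * s) / (ε * (μ * N) ^ (4 * s)) + 1 ≤ (R / ε + 1) * μ ^ (-(4 * s)) := by
  have hμ0 : 0 < μ := by linarith
  have h1 : (1 : ℝ) ≤ μ ^ (-(4 * s)) := Real.one_le_rpow hμ (by linarith)
  have h2 : R * N ^ (4 * s) / (ε * (μ * N) ^ (4 * s)) = R / ε * μ ^ (-(4 * s)) := by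
    rw [Real.mul_rpow hμ0.le hN.le, Real.rpow_neg hμ0.le]
    have := Real.rpow_pos_of_pos hN (4 * s)
    have := Real.rpow_pos_of_pos hμ0 (4 * s)
    field_simp
  rw [h2]
  linarith

/-- The weak norm at modulations below `μ^{1+4s}`, after rescaling. -/
theorem weak_exponent {s b N μ : ℝ} (hs : -(1 / 2) ≤ s) (hN : 1 ≤ N) (hμ : 1 ≤ μ) :
    (μ ^ (1 + 4 * s)) ^ (2 * b - 1) / N ^ (4 * s) * (μ ^ (-(4 * s))) ^ 2 *
      ((μ * N)⁻¹) ^ 2 * (μ * N) ^ (-(6 * s))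
      ≤ N ^ (-(6 * s)) * μ ^ (-(3 - 2 * b + (18 - 8 * b) * s)) := by
  have hμ0 : 0 < μ := by linarith
  have hN0 : 0 < N := by linarith
  have h1 : N ^ (-(4 * s) - 2) ≤ 1 := Real.rpow_le_one_of_one_le_of_nonpos hN (by linarith)
  have e : (μ ^ (1 + 4 * s)) ^ (2 * b - 1) / N ^ (4 * s) * (μ ^ (-(4 * s))) ^ 2 *
      ((μ * N)⁻¹) ^ 2 * (μ * N) ^ (-(6 * s))
      = N ^ (-(6 * s)) * μ ^ (-(3 - 2 * b + (18 - 8 * b) * s)) * N ^ (-(4 * s) - 2) := by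
    have e1 : μ ^ (-(3 - 2 * b + (18 - 8 * b) * s))
        = μ ^ ((1 + 4 * s) * (2 * b - 1)) * (μ ^ (-(4 * s)) * μ ^ (-(4 * s))) *
          μ ^ (-2 : ℝ) * μ ^ (-(6 * s)) := by
      rw [← Real.rpow_add hμ0, ← Real.rpow_add hμ0, ← Real.rpow_add hμ0, ← Real.rpow_add hμ0]
      congr 1; ring
    have e2 : ∀ x : ℝ, 0 < x → x ^ (-2 : ℝ) = (x⁻¹) ^ 2 := fun x hx => by
      rw [Real.rpow_neg hx.le, inv_pow]; norm_cast
    rw [e1, sub_eq_add_neg (-(4 * s)), Real.rpow_add hN0, e2 _ hμ0, e2 _ hN0,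
      ← Real.rpow_mul hμ0.le,
      Real.mul_rpow hμ0.le hN0.le, Real.rpow_neg hN0.le (4 * s), mul_inv]
    ring
  rw [e]
  refine mul_le_of_le_one_right ?_ h1
  positivity

/-- The `L²` norm at modulations above `μ^{1+4s}`, after rescaling. -/
theorem strong_exponent {s b N μ : ℝ} (hN : 1 ≤ N) (hμ : 1 ≤ μ) :
    (μ ^ (1 + 4 * s)) ^ (2 * b - 2) * μ ^ (-(4 * s)) * N * (μ * N)⁻¹ * (μ * N) ^ (-(6 * s))
      = N ^ (-(6 * s)) * μ ^ (-(3 - 2 * b + (18 - 8 * b) * s)) := by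
  have hμ0 : 0 < μ := by linarith
  have hN0 : 0 < N := by linarith
  have e1 : μ ^ (-(3 - 2 * b + (18 - 8 * b) * s))
      = μ ^ ((1 + 4 * s) * (2 * b - 2)) * μ ^ (-(4 * s)) * μ ^ (-1 : ℝ) * μ ^ (-(6 * s)) := by
    rw [← Real.rpow_add hμ0, ← Real.rpow_add hμ0, ← Real.rpow_add hμ0]
    congr 1; ring
  rw [e1, Real.rpow_neg_one, ← Real.rpow_mul hμ0.le, Real.mul_rpow hμ0.le hN0.le]
  field_simp

/-- At each frequency `M ≥ 1`, the curve `U` is controlled on all time intervals of length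
`2ε M^{4s}`, with mass `K M^{-2s} Y`. -/
def WindowBound (s ε K : ℝ) (U : ℝ → L2) (Y : ℝ≥0∞) : Prop :=
  ∀ M : ℝ, 1 ≤ M → ∀ c, Controlled (Set.Icc (c - ε * M ^ (4 * s)) (c + ε * M ^ (4 * s))) M U
    (ENNReal.ofReal (K * M ^ (-(2 * s))) * Y)

theorem ofReal_mass_pow {s K M : ℝ} (hK : 0 ≤ K) (hM : 0 < M) (Y : ℝ≥0∞) :
    (ENNReal.ofReal (K * M ^ (-(2 * s))) * Y) ^ 3
      = ENNReal.ofReal (K ^ 3 * M ^ (-(6 * s))) * Y ^ 3 := by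
  rw [mul_pow, ← ENNReal.ofReal_pow (by positivity), mul_pow, ← Real.rpow_natCast (M ^ _),
    ← Real.rpow_mul hM.le]
  congr 4; push_cast; ring

/-- One dyadic block of the nonlinearity, with the gain of a power of `μ = M/N`. -/
theorem exists_cubic_step {s b ε K R a : ℝ} (hs : -(1 / 2) ≤ s) (hs0 : s ≤ 0) (hb : 1 / 2 < b)
    (hb1 : b < 1) (hε : 0 < ε) (hK : 0 ≤ K) (hR : 0 ≤ R) (ha0 : 0 ≤ a) :
    ∃ C : ℝ, 0 ≤ C ∧ ∀ (N μ c : ℝ) (ψ : ℝ → ℂ) (U : ℝ → L2) (Y : ℝ≥0∞), 1 ≤ N → 16 ≤ μ →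
      Continuous U → WindowBound s ε K U Y → Continuous ψ → HasCompactSupport ψ →
      (∀ t, ‖ψ t‖ ≤ a) → (∀ t, ψ t ≠ 0 → |t - c| ≤ R * N ^ (4 * s)) →
      ∫⁻ σ, dualWeight b (N ^ (4 * s)) σ * ‖𝓕 (fun t => ψ t •
        (lowCubic N (μ * N) U t - lowCubic N (μ * N / 2) U t)) σ‖ₑ ^ 2
        ≤ ENNReal.ofReal (C * (N ^ (-(6 * s)) * μ ^ (-(3 - 2 * b + (18 - 8 * b) * s)))) *
          Y ^ 3 := by
  set κ : ℝ := (outerTriples.card : ℝ) with hκ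
  set ν : ℝ := R / ε + 1 with hν
  have hν0 : 0 ≤ ν := by positivity
  have hb' : 0 < 2 * b - 1 := by linarith
  set C₁ : ℝ := 2 / (2 * b - 1) * a ^ 2 * ν ^ 2 * κ ^ 2 * 128 ^ 2 * K ^ 3 with hC₁
  set C₂ : ℝ := a ^ 2 * ν * κ ^ 2 * 256 * K ^ 3 with hC₂
  refine ⟨C₁ + C₂, by positivity, fun N μ c ψ U Y hN hμ hU hW hψ hψc ha hsupp => ?_⟩
  have hN0 : 0 < N := by linarith
  have hμ0 : 0 < μ := by linarith
  have hM : 1 ≤ μ * N := by nlinarith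
  have hM0 : 0 < μ * N := by linarith
  have hδ : 0 < N ^ (4 * s) := Real.rpow_pos_of_pos hN0 _
  have hδM : 0 < (μ * N) ^ (4 * s) := Real.rpow_pos_of_pos hM0 _
  obtain ⟨n, x, hn, hx⟩ := exists_cover c (ρ := R * N ^ (4 * s)) (r := ε * (μ * N) ^ (4 * s))
    (by positivity) (by positivity)
  have hn' : (n : ℝ) ≤ ν * μ ^ (-(4 * s)) := hn.trans (cover_count_le hs0 hε hN0 (by linarith))
  have hb2 := fun i => (hW (μ * N) hM (x i)).lowCubic_sub_le measurableSet_Icc hU hN0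
    (by nlinarith : 16 * N ≤ μ * N)
  have hcont : Continuous fun t => lowCubic N (μ * N) U t - lowCubic N (μ * N / 2) U t :=
    (continuous_lowCubic N _ hU).sub (continuous_lowCubic N _ hU)
  -- the power of `μ` at which the contributions of low and high modulations balance
  refine (lintegral_dualWeight_fourier_le (L := μ ^ (1 + 4 * s)) hb hb1 hδ
    (Real.rpow_pos_of_pos hμ0 _) (fun i => measurableSet_Icc) hψ hcont hψc ha
    (fun t ht => hx t (hsupp t ht)) (fun i => (hb2 i).1) (fun i => (hb2 i).2)).trans ?_
  rw [ofReal_mass_pow hK hM0, ← ENNReal.ofReal_natCast n, ← ENNReal.ofReal_natCast]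
  set L : ℝ := μ ^ (1 + 4 * s) with hL
  have hL0 : 0 < L := Real.rpow_pos_of_pos hμ0 _
  set m : ℝ := (μ * N) ^ (-(6 * s)) with hm
  have hm0 : 0 < m := Real.rpow_pos_of_pos hM0 _
  have hg : 0 < μ ^ (-(4 * s)) := Real.rpow_pos_of_pos hμ0 _
  have hw := weak_exponent (s := s) (b := b) hs hN (by linarith : 1 ≤ μ)
  have hst := strong_exponent (s := s) (b := b) hN (by linarith : 1 ≤ μ)
  rw [← hL, ← hm] at hw hst
  have r1 : 2 / (2 * b - 1) * L ^ (2 * b - 1) / N ^ (4 * s) * (a ^ 2 * ((n : ℝ) ^ 2 * (κ ^ 2 *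
      ((128 / (μ * N)) ^ 2 * (K ^ 3 * m)))))
      ≤ C₁ * (N ^ (-(6 * s)) * μ ^ (-(3 - 2 * b + (18 - 8 * b) * s))) := by
    calc _ ≤ 2 / (2 * b - 1) * L ^ (2 * b - 1) / N ^ (4 * s) * (a ^ 2 *
          ((ν * μ ^ (-(4 * s))) ^ 2 * (κ ^ 2 * ((128 / (μ * N)) ^ 2 * (K ^ 3 * m))))) := by
          gcongr
      _ = C₁ * (L ^ (2 * b - 1) / N ^ (4 * s) * (μ ^ (-(4 * s))) ^ 2 *
          ((μ * N)⁻¹) ^ 2 * m) := by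
          rw [hC₁]; ring
      _ ≤ _ := by gcongr
  have r2 : L ^ (2 * b - 2) * (a ^ 2 * (n * (κ ^ 2 * (2 * N * (128 / (μ * N) * (K ^ 3 * m))))))
      ≤ C₂ * (N ^ (-(6 * s)) * μ ^ (-(3 - 2 * b + (18 - 8 * b) * s))) := by
    calc _ ≤ L ^ (2 * b - 2) * (a ^ 2 * (ν * μ ^ (-(4 * s)) * (κ ^ 2 *
          (2 * N * (128 / (μ * N) * (K ^ 3 * m)))))) := by gcongr
      _ = C₂ * (L ^ (2 * b - 2) * μ ^ (-(4 * s)) * N * (μ * N)⁻¹ * m) := by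
          rw [hC₂]; ring
      _ = _ := by rw [hst]
  rw [← hκ, add_mul, ENNReal.ofReal_add (by positivity) (by positivity), add_mul]
  refine add_le_add ?_ ?_
  · refine le_trans (le_of_eq ?_) (mul_le_mul_left (ENNReal.ofReal_le_ofReal r1) _)
    rw [ENNReal.ofReal_mul (p := 2 / (2 * b - 1) * L ^ (2 * b - 1) / N ^ (4 * s)) (by positivity),
      ENNReal.ofReal_mul (p := a ^ 2) (by positivity),
      ENNReal.ofReal_mul (p := (n : ℝ) ^ 2) (by positivity),
      ENNReal.ofReal_mul (p := κ ^ 2) (by positivity),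
      ENNReal.ofReal_mul (p := (128 / (μ * N)) ^ 2) (by positivity), ENNReal.ofReal_pow ha0,
      ENNReal.ofReal_pow (p := (n : ℝ)) (by positivity),
      ENNReal.ofReal_pow (p := κ) (by positivity),
      ENNReal.ofReal_pow (p := 128 / (μ * N)) (by positivity)]
    ring
  · refine le_trans (le_of_eq ?_) (mul_le_mul_left (ENNReal.ofReal_le_ofReal r2) _)
    rw [ENNReal.ofReal_mul (p := L ^ (2 * b - 2)) (by positivity),
      ENNReal.ofReal_mul (p := a ^ 2) (by positivity),
      ENNReal.ofReal_mul (p := (n : ℝ)) (by positivity),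
      ENNReal.ofReal_mul (p := κ ^ 2) (by positivity),
      ENNReal.ofReal_mul (q := 128 / (μ * N) * (K ^ 3 * m)) (by positivity),
      ENNReal.ofReal_mul (q := K ^ 3 * m) (by positivity),
      ENNReal.ofReal_pow ha0, ENNReal.ofReal_pow (p := κ) (by positivity)]
    ring

/-- **The forcing term**: the nonlinearity, restricted to the frequencies below `N` and localized
to times of size `N^{4s}`, in the norm dual to the modulation weight. -/
theorem exists_cubic_bound {s b ε K R a : ℝ} (hs : -(1 / 2) ≤ s) (hs0 : s ≤ 0) (hb : 1 / 2 < b)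
    (hb1 : b < 1) (hE : 0 < 3 - 2 * b + (18 - 8 * b) * s) (hε : 0 < ε) (hK : 0 ≤ K) (hR : 0 ≤ R)
    (ha0 : 0 ≤ a) :
    ∃ C : ℝ, 0 ≤ C ∧ ∀ (N c B : ℝ) (ψ : ℝ → ℂ) (U H : ℝ → L2) (Y : ℝ≥0∞), 1 ≤ N →
      Continuous U → WindowBound s ε K U Y → Continuous ψ → HasCompactSupport ψ →
      (∀ t, ‖ψ t‖ ≤ a) → (∀ t, ψ t ≠ 0 → |t - c| ≤ R * N ^ (4 * s)) →
      (∀ (k : ℕ) t, ψ t ≠ 0 → ‖lowCubic N (8 * 2 ^ k * N) U t‖ ≤ B) →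
      (∀ t, Tendsto (fun k : ℕ => lowCubic N (8 * 2 ^ k * N) U t) atTop (𝓝 (H t))) →
      ∫⁻ σ, dualWeight b (N ^ (4 * s)) σ * ‖𝓕 (fun t => ψ t • H t) σ‖ₑ ^ 2
        ≤ ENNReal.ofReal (C * N ^ (-(6 * s))) * Y ^ 3 := by
  obtain ⟨C₁, hC₁, hstep⟩ := exists_cubic_step hs hs0 hb hb1 hε hK hR ha0
  set E := 3 - 2 * b + (18 - 8 * b) * s with hEdef
  set ν : ℝ := R / ε + 1 with hν
  have hν0 : 0 ≤ ν := by positivity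
  -- the norms of the blocks decay like `r ^ (2k)`; half of this decay is spent on the
  -- Cauchy-Schwarz inequality for the sum over `k`
  set r : ℝ := 2 ^ (-(E / 4)) with hr
  have hr0 : 0 < r := by positivity
  have hr1 : r < 1 := Real.rpow_lt_one_of_one_lt_of_neg (by norm_num) (by linarith)
  set C₀ : ℝ := a ^ 2 * (ν * 8 ^ (-(4 * s)) * (48 * (K ^ 3 * 8 ^ (-(6 * s))))) with hC₀
  set G : ℝ := ((1 - r ^ 2)⁻¹) ^ 2 with hG
  have hr2 : 0 < 1 - r ^ 2 := by nlinarith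
  refine ⟨2 * (C₀ + C₁ * G), by positivity,
    fun N c B ψ U H Y hN hU hW hψ hψc ha hsupp hB hlim => ?_⟩
  have hN0 : 0 < N := by linarith
  have hlow : ∫⁻ σ, ‖𝓕 (fun t => ψ t • lowCubic N (8 * 2 ^ 0 * N) U t) σ‖ₑ ^ 2
      ≤ ENNReal.ofReal (C₀ * N ^ (-(6 * s))) * Y ^ 3 := by
    have hM0 : 0 < 8 * N := by positivity
    have hδM : 0 < (8 * N) ^ (4 * s) := Real.rpow_pos_of_pos hM0 _
    obtain ⟨n, x, hn, hx⟩ := exists_cover c (ρ := R * N ^ (4 * s)) (r := ε * (8 * N) ^ (4 * s))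
      (by positivity) (by positivity)
    have hn' : (n : ℝ) ≤ ν * 8 ^ (-(4 * s)) :=
      hn.trans (cover_count_le hs0 hε hN0 (by norm_num))
    rw [pow_zero, mul_one]
    refine (lintegral_fourier_cover_le (fun i => measurableSet_Icc) hψ
      (continuous_lowCubic N _ hU) hψc ha (fun t ht => hx t (hsupp t ht))
      (fun i => (hW (8 * N) (by linarith) (x i)).lowCubic_le measurableSet_Icc)).trans ?_
    rw [ofReal_mass_pow hK hM0, ← ENNReal.ofReal_natCast n]
    have r1 : a ^ 2 * (n * (48 * (K ^ 3 * (8 * N) ^ (-(6 * s))))) ≤ C₀ * N ^ (-(6 * s)) := by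
      rw [Real.mul_rpow (by norm_num) hN0.le]
      calc _ ≤ a ^ 2 * (ν * 8 ^ (-(4 * s)) *
              (48 * (K ^ 3 * (8 ^ (-(6 * s)) * N ^ (-(6 * s)))))) := by
            gcongr
        _ = _ := by rw [hC₀]; ring
    refine le_trans (le_of_eq ?_) (mul_le_mul_left (ENNReal.ofReal_le_ofReal r1) _)
    rw [ENNReal.ofReal_mul (p := a ^ 2) (by positivity), ENNReal.ofReal_mul (p := (n : ℝ))
      (by positivity), ENNReal.ofReal_mul (p := 48) (by norm_num), ENNReal.ofReal_pow ha0,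
      ENNReal.ofReal_ofNat]
    ring
  -- the first difference passes from `8N` to `16N`, so that all of them satisfy `M ≥ 16N`
  set S : ℕ → ℝ → L2 := fun k => lowCubic N (8 * 2 ^ k * N) U with hS
  have hSc : ∀ k, Continuous (S k) := fun k => continuous_lowCubic N _ hU
  have hdc : ∀ k, Continuous (𝓕 fun t => ψ t • (S (k + 1) t - S k t)) := fun k =>
    VectorFourier.fourierIntegral_continuous Real.continuous_fourierChar
      (by exact continuous_inner)
      ((hψ.smul ((hSc _).sub (hSc _))).integrable_of_hasCompactSupport hψc.smul_right)
  have h0c : Continuous (𝓕 fun t => ψ t • S 0 t) :=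
    VectorFourier.fourierIntegral_continuous Real.continuous_fourierChar
      (by exact continuous_inner)
      ((hψ.smul (hSc _)).integrable_of_hasCompactSupport hψc.smul_right)
  have hblock : ∀ k, ∫⁻ σ, dualWeight b (N ^ (4 * s)) σ *
      ‖𝓕 (fun t => ψ t • (S (k + 1) t - S k t)) σ‖ₑ ^ 2
      ≤ (ENNReal.ofReal (C₁ * N ^ (-(6 * s))) * Y ^ 3) * (ENNReal.ofReal r ^ k) ^ 4 := by
    intro k
    have h1 := hstep N (16 * 2 ^ k) c ψ U Y hN (by
      have : (1 : ℝ) ≤ 2 ^ k := one_le_pow₀ (by norm_num)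
      linarith) hU hW hψ hψc ha hsupp
    have e1 : 8 * 2 ^ (k + 1) * N = 16 * 2 ^ k * N := by ring
    have e2 : 8 * 2 ^ k * N = 16 * 2 ^ k * N / 2 := by ring
    simp only [hS, e1, e2]
    refine h1.trans ?_
    rw [mul_right_comm, ← ENNReal.ofReal_pow hr0.le, ← ENNReal.ofReal_pow (by positivity),
      ← ENNReal.ofReal_mul (by positivity), mul_assoc C₁]
    gcongr
    rw [Real.mul_rpow (by norm_num) (by positivity)]
    have e3 : ((2 : ℝ) ^ k) ^ (-E) = (r ^ k) ^ 4 := by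
      rw [hr, ← Real.rpow_natCast 2 k, ← Real.rpow_mul (by norm_num), ← Real.rpow_natCast _ k,
        ← Real.rpow_mul (by norm_num), ← Real.rpow_natCast _ 4, ← Real.rpow_mul (by norm_num)]
      congr 1; push_cast; ring
    rw [e3]
    refine mul_le_of_le_one_left (by positivity) ?_
    exact Real.rpow_le_one_of_one_le_of_nonpos (by norm_num) (by linarith)
  have hsum := lintegral_sq_tsum_le (measurable_dualWeight b (N ^ (4 * s)))
    (fun k => (hdc k).enorm.measurable) (q := ENNReal.ofReal r)
    (B := ENNReal.ofReal (C₁ * N ^ (-(6 * s))) * Y ^ 3) (by simpa using hr0)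
    (by rw [← ENNReal.ofReal_one]; exact (ENNReal.ofReal_lt_ofReal_iff one_pos).2 hr1) hblock
  have hG' : ((1 - ENNReal.ofReal r ^ 2)⁻¹) ^ 2 = ENNReal.ofReal G := by
    rw [hG, ← ENNReal.ofReal_pow hr0.le, ← ENNReal.ofReal_one,
      ← ENNReal.ofReal_sub _ (by positivity), ← ENNReal.ofReal_inv_of_pos hr2,
      ← ENNReal.ofReal_pow (by positivity)]
  calc _ ≤ ∫⁻ σ, 2 * (‖𝓕 (fun t => ψ t • S 0 t) σ‖ₑ ^ 2 + dualWeight b (N ^ (4 * s)) σ *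
        (∑' k, ‖𝓕 (fun t => ψ t • (S (k + 1) t - S k t)) σ‖ₑ) ^ 2) := by
        refine lintegral_mono fun σ => ?_
        have h1 := enorm_fourier_le_tsum hψ hψc hSc hB hlim σ
        calc _ ≤ dualWeight b (N ^ (4 * s)) σ * (2 * (‖𝓕 (fun t => ψ t • S 0 t) σ‖ₑ ^ 2 +
              (∑' k, ‖𝓕 (fun t => ψ t • (S (k + 1) t - S k t)) σ‖ₑ) ^ 2)) := by
              gcongr
              exact (pow_le_pow_left₀ zero_le h1 2).trans (add_sq_le_two_mul _ _)
          _ = 2 * (dualWeight b (N ^ (4 * s)) σ * ‖𝓕 (fun t => ψ t • S 0 t) σ‖ₑ ^ 2 +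
              dualWeight b (N ^ (4 * s)) σ *
              (∑' k, ‖𝓕 (fun t => ψ t • (S (k + 1) t - S k t)) σ‖ₑ) ^ 2) := by ring
          _ ≤ _ := by
              gcongr
              exact mul_le_of_le_one_left zero_le (dualWeight_le_one hb1 _ _)
    _ = 2 * ((∫⁻ σ, ‖𝓕 (fun t => ψ t • S 0 t) σ‖ₑ ^ 2) + ∫⁻ σ, dualWeight b (N ^ (4 * s)) σ *
        (∑' k, ‖𝓕 (fun t => ψ t • (S (k + 1) t - S k t)) σ‖ₑ) ^ 2) := by
        rw [lintegral_const_mul' _ _ (by norm_num),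
          lintegral_add_left (h0c.enorm.measurable.pow_const 2)]
    _ ≤ 2 * (ENNReal.ofReal (C₀ * N ^ (-(6 * s))) * Y ^ 3 +
        ENNReal.ofReal (C₁ * N ^ (-(6 * s))) * Y ^ 3 * ENNReal.ofReal G) := by
        rw [← hG']
        gcongr
    _ = _ := by
        rw [mul_right_comm (ENNReal.ofReal (C₁ * N ^ (-(6 * s)))),
          ← ENNReal.ofReal_mul (by positivity), ← add_mul,
          ← ENNReal.ofReal_add (by positivity) (by positivity), ← mul_assoc]
        congr 1
        rw [← ENNReal.ofReal_ofNat, ← ENNReal.ofReal_mul (by norm_num)]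
        congr 1; ring

/-! ### Sobolev norms and smooth functions -/

theorem sobolevNorm_sq (s : ℝ) (f : ℝ → ℂ) : sobolevNorm s f ^ 2 = ENNReal.ofReal (2 * Real.pi) *
    ∫⁻ y, ENNReal.ofReal (bracket (2 * Real.pi * y) ^ (2 * s)) *
      ‖(𝓕 (toL2 f) : L2) y‖ₑ ^ 2 := by
  rw [← lintegral_comp_div _ Real.two_pi_pos, sobolevNorm, ← ENNReal.rpow_natCast,
    ← ENNReal.rpow_mul]
  norm_num
  refine lintegral_congr fun ξ => ?_
  rw [spaceFourier, mul_div_cancel₀ _ Real.two_pi_pos.ne', mul_comm]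

theorem enorm_fourier_toL2 (f : ℝ → ℂ) : ‖(𝓕 (toL2 f) : L2)‖ₑ = ‖toL2 f‖ₑ := by
  rw [← ofReal_norm, ← ofReal_norm, Lp.norm_fourier_eq]

theorem lintegral_pow_four_le_sobolevNorm (f : ℝ → ℂ) :
    ∫⁻ y, ENNReal.ofReal (bracket (2 * Real.pi * y) ^ (4 : ℝ)) * ‖(𝓕 (toL2 f) : L2) y‖ₑ ^ 2
      ≤ sobolevNorm 10 f ^ 2 := by
  rw [sobolevNorm_sq]
  refine le_trans (lintegral_mono fun y => ?_) (le_mul_of_one_le_left zero_le ?_)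
  · gcongr
    · exact one_le_bracket _
    · norm_num
  · rw [← ENNReal.ofReal_one]
    exact ENNReal.ofReal_le_ofReal (by linarith [Real.pi_gt_three])

theorem enorm_toL2_le_sobolevNorm (f : ℝ → ℂ) : ‖toL2 f‖ₑ ≤ sobolevNorm 10 f := by
  rw [← ENNReal.pow_le_pow_left_iff two_ne_zero, ← enorm_fourier_toL2, ← L2_lintegral_sq]
  refine (lintegral_mono fun y => ?_).trans (lintegral_pow_four_le_sobolevNorm f)
  refine le_mul_of_one_le_left zero_le ?_
  rw [← ENNReal.ofReal_one]
  exact ENNReal.ofReal_le_ofReal (Real.one_le_rpow (one_le_bracket _) (by norm_num))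

theorem measurable_bracket_two_pi (p : ℝ) :
    Measurable fun y : ℝ => ENNReal.ofReal (bracket (2 * Real.pi * y) ^ p) := by
  refine Measurable.ennreal_ofReal (Measurable.pow_const ?_ _)
  exact measurable_bracket.comp (by fun_prop)

/-- Sobolev's inequality on the Fourier side: the Cauchy-Schwarz inequality with
`⟨ξ⟩² = ⟨ξ⟩^{-8} ⟨ξ⟩^{10}`. -/
theorem exists_lintegral_le_sobolevNorm : ∃ C : ℝ, 0 ≤ C ∧ ∀ f : ℝ → ℂ,
    ∫⁻ y, ENNReal.ofReal (bracket (2 * Real.pi * y) ^ (2 : ℝ)) * ‖(𝓕 (toL2 f) : L2) y‖ₑ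
      ≤ ENNReal.ofReal C * sobolevNorm 10 f := by
  set K := ∫ x : ℝ, bracket x ^ (-(2 * 8 : ℝ)) with hK
  have hK0 : 0 ≤ K := integral_nonneg fun x => (Real.rpow_pos_of_pos (bracket_pos x) _).le
  refine ⟨Real.sqrt K, Real.sqrt_nonneg _, fun f => ?_⟩
  rw [← ENNReal.pow_le_pow_left_iff two_ne_zero, mul_pow, ← ENNReal.ofReal_pow (Real.sqrt_nonneg _),
    Real.sq_sqrt hK0]
  set g : ℝ → ℂ := ((𝓕 (toL2 f) : L2) : ℝ → ℂ) with hg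
  have hgm : Measurable g := (Lp.stronglyMeasurable (𝓕 (toL2 f) : L2)).measurable
  have h1 := sq_lintegral_mul_le (μ := volume) (measurable_bracket_two_pi (-8)).aemeasurable
    ((measurable_bracket_two_pi 10).fun_mul hgm.enorm).aemeasurable
  have e1 : ∀ y, ENNReal.ofReal (bracket (2 * Real.pi * y) ^ (-8 : ℝ)) *
      (ENNReal.ofReal (bracket (2 * Real.pi * y) ^ (10 : ℝ)) * ‖g y‖ₑ)
      = ENNReal.ofReal (bracket (2 * Real.pi * y) ^ (2 : ℝ)) * ‖g y‖ₑ := fun y => by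
    have hp := bracket_pos (2 * Real.pi * y)
    rw [← mul_assoc, ← ENNReal.ofReal_mul (by positivity), ← Real.rpow_add hp]
    norm_num
  have e2 : ∀ y (p : ℝ), ENNReal.ofReal (bracket (2 * Real.pi * y) ^ p) ^ 2
      = ENNReal.ofReal (bracket (2 * Real.pi * y) ^ (2 * p)) := fun y p => by
    have hp := bracket_pos (2 * Real.pi * y)
    rw [← ENNReal.ofReal_pow (by positivity), ← Real.rpow_natCast, ← Real.rpow_mul hp.le,
      mul_comm p]
    norm_num
  simp only [e1, mul_pow, e2] at h1
  refine h1.trans ?_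
  rw [sobolevNorm_sq, ← mul_assoc]
  refine mul_le_mul_left ?_ _
  have hpos := Real.two_pi_pos
  have h2 := lintegral_comp_mul_left (fun x => ENNReal.ofReal (bracket x ^ (2 * -8 : ℝ))) hpos.ne'
  have e3 : ∀ x : ℝ, bracket x ^ (2 * -8 : ℝ) = bracket x ^ (-(2 * 8 : ℝ)) := fun x => by norm_num
  rw [h2]
  simp only [e3]
  rw [← ofReal_integral_eq_lintegral_ofReal (integrable_bracket_rpow (by norm_num))
      (.of_forall fun x => (Real.rpow_pos_of_pos (bracket_pos x) _).le),
      ← ENNReal.ofReal_mul (abs_nonneg _), ← ENNReal.ofReal_mul hK0]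
  refine ENNReal.ofReal_le_ofReal ?_
  have hi : |(2 * Real.pi)⁻¹| ≤ 2 * Real.pi := by
    rw [abs_of_pos (inv_pos.2 hpos), inv_le_iff_one_le_mul₀ hpos]
    nlinarith [Real.pi_gt_three]
  rw [← hK, mul_comm]
  gcongr

/-- Twice continuously differentiable functions in `H^{10}(ℝ)`: the regularity of a solution at each
time. -/
structure Smooth (f : ℝ → ℂ) : Prop where
  contDiff : ContDiff ℝ 2 f
  memLp : MemLp f 2 volume
  finite : sobolevNorm 10 f < ∞

/-- The symbol `-(2πy)²` of the second derivative. -/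
def lapSymb (y : ℝ) : ℂ := ((-(2 * Real.pi * y) ^ 2 : ℝ) : ℂ)

theorem norm_lapSymb (y : ℝ) : ‖lapSymb y‖ = (2 * Real.pi * y) ^ 2 := by
  rw [lapSymb, Complex.norm_real, Real.norm_eq_abs, abs_neg, abs_of_nonneg (sq_nonneg _)]

theorem continuous_lapSymb : Continuous lapSymb := by unfold lapSymb; fun_prop

theorem norm_lapSymb_le (y : ℝ) : ‖lapSymb y‖ ≤ bracket (2 * Real.pi * y) ^ (2 : ℝ) := by
  rw [norm_lapSymb, ← sq_abs, Real.rpow_two]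
  gcongr
  exact abs_le_bracket _

section Smooth

variable {f : ℝ → ℂ}

theorem Smooth.integrable (hf : Smooth f) : Integrable ((𝓕 (toL2 f) : L2) : ℝ → ℂ) := by
  obtain ⟨C, -, hC⟩ := exists_lintegral_le_sobolevNorm
  refine ⟨Lp.aestronglyMeasurable _, ?_⟩
  refine lt_of_le_of_lt (lintegral_mono fun y => ?_)
    ((hC f).trans_lt (ENNReal.mul_lt_top ENNReal.ofReal_lt_top hf.finite))
  refine le_mul_of_one_le_left zero_le ?_
  rw [← ENNReal.ofReal_one]
  exact ENNReal.ofReal_le_ofReal (Real.one_le_rpow (one_le_bracket _) (by norm_num))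

theorem Smooth.integrable_sq (hf : Smooth f) :
    Integrable fun y => lapSymb y * (𝓕 (toL2 f) : L2) y := by
  obtain ⟨C, -, hC⟩ := exists_lintegral_le_sobolevNorm
  refine ⟨continuous_lapSymb.aestronglyMeasurable.mul (Lp.aestronglyMeasurable _), ?_⟩
  refine lt_of_le_of_lt (lintegral_mono fun y => ?_)
    ((hC f).trans_lt (ENNReal.mul_lt_top ENNReal.ofReal_lt_top hf.finite))
  rw [enorm_mul, ← ofReal_norm]
  gcongr
  exact norm_lapSymb_le y

theorem lintegral_sq_mul_le (f : ℝ → ℂ) :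
    ∫⁻ y, ‖lapSymb y * (𝓕 (toL2 f) : L2) y‖ₑ ^ 2 ≤ sobolevNorm 10 f ^ 2 := by
  refine (lintegral_mono fun y => ?_).trans (lintegral_pow_four_le_sobolevNorm f)
  rw [enorm_mul, mul_pow, ← ofReal_norm, ← ENNReal.ofReal_pow (norm_nonneg _)]
  gcongr
  have hp := bracket_pos (2 * Real.pi * y)
  calc _ ≤ (bracket (2 * Real.pi * y) ^ (2 : ℝ)) ^ 2 := by gcongr; exact norm_lapSymb_le y
    _ = _ := by rw [← Real.rpow_natCast, ← Real.rpow_mul hp.le]; norm_num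

theorem Smooth.memLp_sq (hf : Smooth f) :
    MemLp (fun y => lapSymb y * (𝓕 (toL2 f) : L2) y) 2 volume := by
  refine ⟨hf.integrable_sq.1, ?_⟩
  rw [eLpNorm_lt_top_iff_lintegral_rpow_enorm_lt_top (by norm_num) (by norm_num)]
  have := (lintegral_sq_mul_le f).trans_lt (ENNReal.pow_lt_top hf.finite)
  simpa using this

theorem continuous_fourierInv {g : ℝ → ℂ} (hg : Integrable g) : Continuous (𝓕⁻ g) := by
  have h : 𝓕⁻ g = fun x => 𝓕 g (-x) := by
    ext x; rw [Real.fourierInv_eq_fourier_neg]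
  rw [h]
  exact (VectorFourier.fourierIntegral_continuous Real.continuous_fourierChar
    (by exact continuous_inner) hg).comp continuous_neg

theorem Smooth.eq_fourierInv (hf : Smooth f) : f = 𝓕⁻ ((𝓕 (toL2 f) : L2) : ℝ → ℂ) := by
  have h := fourierInv_toLp_ae hf.integrable (Lp.memLp (𝓕 (toL2 f) : L2))
  rw [Lp.toLp_coeFn, fourierInv_fourier_eq] at h
  exact (hf.contDiff.continuous.ae_eq_iff_eq volume (continuous_fourierInv hf.integrable)).1
    ((toL2_ae hf.memLp).symm.trans h)

/-- Differentiation under the integral sign in the Fourier inversion formula. -/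
theorem Smooth.iteratedDeriv_eq (hf : Smooth f) : iteratedDeriv 2 f
    = 𝓕⁻ fun y => lapSymb y * (𝓕 (toL2 f) : L2) y := by
  set g : ℝ → ℂ := ((𝓕 (toL2 f) : L2) : ℝ → ℂ) with hg
  have hi := hf.integrable
  have hi2 := hf.integrable_sq
  obtain ⟨C, -, hC⟩ := exists_lintegral_le_sobolevNorm
  have hn : ∀ n : ℕ, n ≤ 2 → Integrable fun y : ℝ => y ^ n • g (-y) := by
    intro n hn
    have h1 : Integrable fun y : ℝ => (-y) ^ n • g y := by
      refine ⟨(by fun_prop : Continuous fun y : ℝ => (-y) ^ n).aestronglyMeasurable.smul hi.1, ?_⟩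
      refine lt_of_le_of_lt (lintegral_mono fun y => ?_)
        ((hC f).trans_lt (ENNReal.mul_lt_top ENNReal.ofReal_lt_top hf.finite))
      rw [enorm_smul, ← ofReal_norm]
      gcongr
      rw [norm_pow, norm_neg, Real.norm_eq_abs, Real.rpow_two]
      have h2 : |y| ≤ bracket (2 * Real.pi * y) := by
        refine le_trans ?_ (abs_le_bracket _)
        rw [abs_mul, abs_of_pos Real.two_pi_pos]
        nlinarith [abs_nonneg y, Real.pi_gt_three]
      calc |y| ^ n ≤ bracket (2 * Real.pi * y) ^ n := by gcongr
        _ ≤ _ := pow_le_pow_right₀ (one_le_bracket _) hn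
    have h2 := h1.comp_neg
    simpa using h2
  conv_lhs => rw [hf.eq_fourierInv, ← hg, Real.fourierInv_eq_fourier_comp_neg]
  rw [Real.iteratedDeriv_fourier (N := 2) (n := 2) (fun n h => hn n (by exact_mod_cast h))
    (by norm_num), Real.fourierInv_eq_fourier_comp_neg]
  congr 1; ext y
  rw [smul_eq_mul, lapSymb]
  congr 1
  push_cast
  have := Complex.I_sq
  ring_nf
  rw [this]; ring

theorem enorm_fourierInv_le (g : ℝ → ℂ) (x : ℝ) : ‖𝓕⁻ g x‖ₑ ≤ ∫⁻ y, ‖g y‖ₑ := by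
  rw [Real.fourierInv_eq']
  refine (enorm_integral_le_lintegral_enorm _).trans (le_of_eq ?_)
  refine lintegral_congr fun y => ?_
  rw [enorm_smul, ← ofReal_norm, Complex.norm_exp_ofReal_mul_I]; simp

theorem Smooth.memLp_iteratedDeriv (hf : Smooth f) : MemLp (iteratedDeriv 2 f) 2 volume := by
  rw [hf.iteratedDeriv_eq]
  exact (Lp.memLp _).ae_eq (fourierInv_toLp_ae hf.integrable_sq hf.memLp_sq)

theorem Smooth.fourier_iteratedDeriv (hf : Smooth f) : (𝓕 (toL2 (iteratedDeriv 2 f)) : L2)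
    = toL2 fun y => lapSymb y * (𝓕 (toL2 f) : L2) y := by
  have h := fourierInv_toLp_ae hf.integrable_sq hf.memLp_sq
  rw [← hf.iteratedDeriv_eq] at h
  rw [← toL2_congr (Lp.memLp _) h, toL2_coe, fourier_fourierInv_eq, toL2_of_memLp hf.memLp_sq]

theorem Smooth.enorm_iteratedDeriv_le (hf : Smooth f) :
    ‖toL2 (iteratedDeriv 2 f)‖ₑ ≤ sobolevNorm 10 f := by
  rw [← ENNReal.pow_le_pow_left_iff two_ne_zero, ← enorm_fourier_toL2, hf.fourier_iteratedDeriv,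
    enorm_toL2_sq hf.memLp_sq]
  exact lintegral_sq_mul_le f

end Smooth

/-- The norm of `H^{10}` controls the function and its second derivative uniformly, and the Fourier
transform in `L¹`. The last bound is also uniform for the parts of `f` at low frequency. -/
theorem exists_sup_le_sobolevNorm : ∃ C : ℝ, 0 ≤ C ∧ ∀ f : ℝ → ℂ, Smooth f → ∀ x,
    ‖f x‖ₑ ≤ ENNReal.ofReal C * sobolevNorm 10 f ∧
    ‖iteratedDeriv 2 f x‖ₑ ≤ ENNReal.ofReal C * sobolevNorm 10 f ∧
    ∫⁻ y, ‖(𝓕 (toL2 f) : L2) y‖ₑ ≤ ENNReal.ofReal C * sobolevNorm 10 f := by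
  obtain ⟨C, hC0, hC⟩ := exists_lintegral_le_sobolevNorm
  have h0 : ∀ f : ℝ → ℂ, ∫⁻ y, ‖(𝓕 (toL2 f) : L2) y‖ₑ ≤ ENNReal.ofReal C * sobolevNorm 10 f := by
    refine fun f => (lintegral_mono fun y => ?_).trans (hC f)
    refine le_mul_of_one_le_left zero_le ?_
    rw [← ENNReal.ofReal_one]
    exact ENNReal.ofReal_le_ofReal (Real.one_le_rpow (one_le_bracket _) (by norm_num))
  refine ⟨C, hC0, fun f hf x => ⟨?_, ?_, h0 f⟩⟩
  · conv_lhs => rw [hf.eq_fourierInv]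
    exact (enorm_fourierInv_le _ _).trans (h0 f)
  · rw [hf.iteratedDeriv_eq]
    refine (enorm_fourierInv_le _ _).trans ((lintegral_mono fun y => ?_).trans (hC f))
    rw [enorm_mul, ← ofReal_norm]
    gcongr
    exact norm_lapSymb_le y

/-! ### The equation in the interaction picture -/

theorem Smooth.sub {f g : ℝ → ℂ} (hf : Smooth f) (hg : Smooth g)
    (h : sobolevNorm 10 (fun x => f x - g x) < ∞) : Smooth fun x => f x - g x :=
  ⟨hf.contDiff.sub hg.contDiff, hf.memLp.sub hg.memLp, h⟩

theorem sobolevNorm_sq_le {f g : ℝ → ℂ} (hf : MemLp f 2 volume) (hg : MemLp g 2 volume) (s : ℝ) :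
    sobolevNorm s f ^ 2 ≤ 2 * (sobolevNorm s (fun x => f x - g x) ^ 2 + sobolevNorm s g ^ 2) := by
  simp only [sobolevNorm_sq]
  have hm : ∀ h : ℝ → ℂ, Measurable fun y => ENNReal.ofReal (bracket (2 * Real.pi * y) ^ (2 * s)) *
      ‖(𝓕 (toL2 h) : L2) y‖ₑ ^ 2 := fun h =>
    (measurable_bracket_two_pi _).fun_mul
      ((Lp.stronglyMeasurable (𝓕 (toL2 h) : L2)).measurable.enorm.pow_const 2)
  rw [← mul_add, ← lintegral_add_left (hm _), mul_left_comm,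
    ← lintegral_const_mul' 2 _ (by norm_num)]
  refine mul_le_mul_right ?_ _
  refine lintegral_mono_ae ?_
  have h1 : (𝓕 (toL2 fun x => f x - g x) : L2) = 𝓕 (toL2 f) - 𝓕 (toL2 g) := by
    rw [toL2_sub hf hg, fourier_L2_sub]
  filter_upwards [Lp.coeFn_sub (𝓕 (toL2 f) : L2) (𝓕 (toL2 g))] with y hy
  rw [← h1] at hy
  have h2 : (𝓕 (toL2 f) : L2) y = (𝓕 (toL2 fun x => f x - g x) : L2) y + (𝓕 (toL2 g) : L2) y := by
    rw [hy, Pi.sub_apply, sub_add_cancel]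
  rw [← mul_add, mul_left_comm, h2]
  gcongr
  exact (pow_le_pow_left₀ zero_le (enorm_add_le _ _) 2).trans (add_sq_le_two_mul _ _)

theorem tendsto_of_enorm_sub_le {E : Type*} [NormedAddCommGroup E] {F : ℝ → E} {t₀ : ℝ}
    {g : ℝ → ℝ≥0∞} (hg : Tendsto g (𝓝 t₀) (𝓝 0)) (h : ∀ᶠ t in 𝓝 t₀, ‖F t - F t₀‖ₑ ≤ g t) :
    Tendsto F (𝓝 t₀) (𝓝 (F t₀)) := by
  refine tendsto_iff_edist_tendsto_0.2 ?_
  simp only [edist_eq_enorm_sub]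
  exact tendsto_of_tendsto_of_tendsto_of_le_of_le' tendsto_const_nhds hg
    (.of_forall fun _ => zero_le) h

/-- The cubic nonlinearity `|u|²u`. -/
def cubic (u : ℝ → ℝ → ℂ) (t x : ℝ) : ℂ := ((‖u t x‖ ^ 2 : ℝ) : ℂ) * u t x

section Solution

variable {ω : ℝ} {ζ₀ : ℝ → ℝ} {u₀ : ℝ → ℂ} {u : ℝ → ℝ → ℂ}

theorem IsSmoothSolution.smooth (hu : IsSmoothSolution ω ζ₀ u₀ u) (t : ℝ) : Smooth (u t) :=
  ⟨hu.contDiff_space t, hu.memLp t, hu.sobolevNorm_lt_top t⟩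

theorem IsSmoothSolution.eventually_smooth_sub (hu : IsSmoothSolution ω ζ₀ u₀ u) (t₀ : ℝ) :
    ∀ᶠ t in 𝓝 t₀, Smooth fun x => u t x - u t₀ x := by
  filter_upwards [(hu.continuous_sobolev t₀).eventually_lt_const one_pos] with t ht
  exact (hu.smooth t).sub (hu.smooth t₀) (ht.trans ENNReal.one_lt_top)

theorem IsSmoothSolution.eventually_sobolevNorm_le (hu : IsSmoothSolution ω ζ₀ u₀ u) (t₀ : ℝ) :
    ∃ C : ℝ, ∀ᶠ t in 𝓝 t₀, sobolevNorm 10 (u t) ≤ ENNReal.ofReal C := by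
  set B := 2 * (1 ^ 2 + sobolevNorm 10 (u t₀) ^ 2) with hB
  have hfin : B ^ (1 / 2 : ℝ) ≠ ∞ := by
    refine ENNReal.rpow_ne_top_of_nonneg (by norm_num) ?_
    exact ENNReal.mul_ne_top (by norm_num) (ENNReal.add_ne_top.2
      ⟨by norm_num, ENNReal.pow_ne_top (hu.sobolevNorm_lt_top t₀).ne⟩)
  refine ⟨(B ^ (1 / 2 : ℝ)).toReal, ?_⟩
  filter_upwards [(hu.continuous_sobolev t₀).eventually_lt_const one_pos] with t ht
  rw [ENNReal.ofReal_toReal hfin, ← ENNReal.pow_le_pow_left_iff two_ne_zero, ← ENNReal.rpow_natCast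
    (B ^ _), ← ENNReal.rpow_mul]
  norm_num
  refine (sobolevNorm_sq_le (hu.memLp t) (hu.memLp t₀) 10).trans ?_
  rw [hB]
  gcongr

theorem IsSmoothSolution.exists_sobolevNorm_le (hu : IsSmoothSolution ω ζ₀ u₀ u) {K : Set ℝ}
    (hK : IsCompact K) : ∃ C : ℝ, 0 ≤ C ∧ ∀ t ∈ K, sobolevNorm 10 (u t) ≤ ENNReal.ofReal C := by
  refine hK.induction_on (p := fun S => ∃ C : ℝ, 0 ≤ C ∧ ∀ t ∈ S, sobolevNorm 10 (u t)
    ≤ ENNReal.ofReal C) ⟨0, le_rfl, by simp⟩ ?_ ?_ ?_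
  · rintro S S' hS ⟨C, h0, hC⟩
    exact ⟨C, h0, fun t ht => hC t (hS ht)⟩
  · rintro S S' ⟨C, h0, hC⟩ ⟨C', h0', hC'⟩
    refine ⟨max C C', le_max_of_le_left h0, fun t ht => ?_⟩
    rcases ht with ht | ht
    · exact (hC t ht).trans (ENNReal.ofReal_le_ofReal (le_max_left _ _))
    · exact (hC' t ht).trans (ENNReal.ofReal_le_ofReal (le_max_right _ _))
  · intro t _
    obtain ⟨C, hC⟩ := hu.eventually_sobolevNorm_le t
    refine ⟨_, mem_nhdsWithin_of_mem_nhds hC, max C 0, le_max_right _ _, fun t' ht' => ?_⟩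
    exact le_trans (b := ENNReal.ofReal C) ht' (ENNReal.ofReal_le_ofReal (le_max_left _ _))

theorem IsSmoothSolution.continuous_toL2 (hu : IsSmoothSolution ω ζ₀ u₀ u) :
    Continuous fun t => toL2 (u t) := by
  refine continuous_iff_continuousAt.2 fun t₀ => ?_
  refine tendsto_of_enorm_sub_le (hu.continuous_sobolev t₀) (.of_forall fun t => ?_)
  rw [← toL2_sub (hu.memLp t) (hu.memLp t₀)]
  exact enorm_toL2_le_sobolevNorm _

theorem IsSmoothSolution.iteratedDeriv_sub (hu : IsSmoothSolution ω ζ₀ u₀ u) (t t₀ x : ℝ) :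
    iteratedDeriv 2 (fun x => u t x - u t₀ x) x
      = iteratedDeriv 2 (u t) x - iteratedDeriv 2 (u t₀) x :=
  iteratedDeriv_fun_sub (hu.contDiff_space t).contDiffAt (hu.contDiff_space t₀).contDiffAt

theorem IsSmoothSolution.continuous_toL2_iteratedDeriv (hu : IsSmoothSolution ω ζ₀ u₀ u) :
    Continuous fun t => toL2 (iteratedDeriv 2 (u t)) := by
  refine continuous_iff_continuousAt.2 fun t₀ => ?_
  refine tendsto_of_enorm_sub_le (hu.continuous_sobolev t₀) ?_
  filter_upwards [hu.eventually_smooth_sub t₀] with t ht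
  rw [← toL2_sub (hu.smooth t).memLp_iteratedDeriv (hu.smooth t₀).memLp_iteratedDeriv]
  refine le_trans (le_of_eq ?_) ht.enorm_iteratedDeriv_le
  congr 2; ext x
  rw [hu.iteratedDeriv_sub]

/-- Continuity in `x` for each time together with uniform convergence as `t → t₀` gives joint
continuity. -/
theorem IsSmoothSolution.continuous_uncurry_of_le (hu : IsSmoothSolution ω ζ₀ u₀ u)
    {D : ℝ → ℝ → ℂ} (hD : ∀ t, Continuous (D t)) {C : ℝ} (h : ∀ t₀, ∀ᶠ t in 𝓝 t₀, ∀ x,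
      ‖D t x - D t₀ x‖ₑ ≤ ENNReal.ofReal C * sobolevNorm 10 fun x => u t x - u t₀ x) :
    Continuous (Function.uncurry D) := by
  refine continuous_iff_continuousAt.2 fun ⟨t₀, x₀⟩ => ?_
  refine tendsto_iff_edist_tendsto_0.2 ?_
  have h1 : Tendsto (fun p : ℝ × ℝ => ENNReal.ofReal C * sobolevNorm 10 (fun x => u p.1 x - u t₀ x)
      + ‖D t₀ p.2 - D t₀ x₀‖ₑ) (𝓝 (t₀, x₀)) (𝓝 (ENNReal.ofReal C * 0 + 0)) := by
    refine Tendsto.add ?_ ?_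
    · exact ENNReal.Tendsto.const_mul ((hu.continuous_sobolev t₀).comp
        (continuous_fst.tendsto (t₀, x₀))) (Or.inr ENNReal.ofReal_ne_top)
    · have hc : Continuous fun p : ℝ × ℝ => ‖D t₀ p.2 - D t₀ x₀‖ₑ :=
        (((hD t₀).comp continuous_snd).sub continuous_const).enorm
      simpa using hc.tendsto (t₀, x₀)
  rw [mul_zero, zero_add] at h1
  refine tendsto_of_tendsto_of_tendsto_of_le_of_le' tendsto_const_nhds h1
    (.of_forall fun _ => zero_le) ?_
  filter_upwards [(continuous_fst.tendsto (t₀, x₀)).eventually (h t₀)] with p hp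
  simp only [Function.uncurry, edist_eq_enorm_sub]
  have e : D p.1 p.2 - D t₀ x₀ = (D p.1 p.2 - D t₀ p.2) + (D t₀ p.2 - D t₀ x₀) := by ring
  rw [e]
  exact (enorm_add_le _ _).trans (add_le_add_left (hp p.2) _)

theorem IsSmoothSolution.continuous_uncurry (hu : IsSmoothSolution ω ζ₀ u₀ u) :
    Continuous (Function.uncurry u) := by
  obtain ⟨C, -, hC⟩ := exists_sup_le_sobolevNorm
  refine hu.continuous_uncurry_of_le (fun t => (hu.contDiff_space t).continuous) (C := C)
    fun t₀ => ?_
  filter_upwards [hu.eventually_smooth_sub t₀] with t ht x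
  exact (hC _ ht x).1

theorem IsSmoothSolution.continuous_uncurry_iteratedDeriv (hu : IsSmoothSolution ω ζ₀ u₀ u) :
    Continuous (Function.uncurry fun t => iteratedDeriv 2 (u t)) := by
  obtain ⟨C, -, hC⟩ := exists_sup_le_sobolevNorm
  refine hu.continuous_uncurry_of_le (fun t => (hu.contDiff_space t).continuous_iteratedDeriv 2
    le_rfl) (C := C) fun t₀ => ?_
  filter_upwards [hu.eventually_smooth_sub t₀] with t ht x
  rw [← hu.iteratedDeriv_sub]
  exact (hC _ ht x).2.1

theorem IsSmoothSolution.cubic_aux (hu : IsSmoothSolution ω ζ₀ u₀ u) :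
    (∀ t, MemLp (cubic u t) 2 volume) ∧ Continuous fun t => toL2 (cubic u t) := by
  obtain ⟨C, hC0, hC⟩ := exists_sup_le_sobolevNorm
  refine continuous_toL2_mul (V := u) (W := fun t x => ((‖u t x‖ ^ 2 : ℝ) : ℂ)) hu.memLp
    hu.continuous_toL2 ?_ fun t₀ => ?_
  · exact Complex.continuous_ofReal.comp (hu.continuous_uncurry.norm.pow 2)
  · obtain ⟨B, hB⟩ := hu.eventually_sobolevNorm_le t₀
    refine ⟨(C * max B 0) ^ 2, ?_⟩
    filter_upwards [hB] with t ht x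
    rw [Complex.norm_real, norm_pow, norm_norm]
    gcongr
    have h1 := ((hC _ (hu.smooth t) x).1).trans (mul_le_mul_right ht _)
    rw [← ofReal_norm, ← ENNReal.ofReal_mul hC0] at h1
    have h2 := h1.trans (ENNReal.ofReal_le_ofReal (mul_le_mul_of_nonneg_left (le_max_left B 0) hC0))
    exact (ENNReal.ofReal_le_ofReal_iff (mul_nonneg hC0 (le_max_right _ _))).1 h2

theorem IsSmoothSolution.memLp_cubic (hu : IsSmoothSolution ω ζ₀ u₀ u) (t : ℝ) :
    MemLp (cubic u t) 2 volume := hu.cubic_aux.1 t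

theorem IsSmoothSolution.continuous_toL2_cubic (hu : IsSmoothSolution ω ζ₀ u₀ u) :
    Continuous fun t => toL2 (cubic u t) := hu.cubic_aux.2

theorem IsSmoothSolution.deriv_time (hu : IsSmoothSolution ω ζ₀ u₀ u) (t x : ℝ) :
    HasDerivAt (fun t' => u t' x)
      (Complex.I * iteratedDeriv 2 (u t) x + Complex.I * ζ₀ t * ω * cubic u t x) t := by
  have h := (hu.differentiable_time x t).hasDerivAt
  refine h.congr_deriv ?_
  have e := hu.equation t x
  have h2 := Complex.I_mul_I
  rw [cubic]
  linear_combination (-Complex.I) * e + (deriv (fun t' => u t' x) t) * h2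

/-- The time derivative of the solution, as a curve in `L²`. -/
def velocity (ω : ℝ) (ζ₀ : ℝ → ℝ) (u : ℝ → ℝ → ℂ) (t : ℝ) : L2 :=
  Complex.I • toL2 (iteratedDeriv 2 (u t)) + (Complex.I * ζ₀ t * ω) • toL2 (cubic u t)

/-- A solution in the classical sense is differentiable as a curve in `L²`. The equation is
integrated in time for each `x`, and the result is read as a Bochner integral of the continuous
curve `velocity`. -/
theorem IsSmoothSolution.hasDerivAt_toL2 (hu : IsSmoothSolution ω ζ₀ u₀ u) (hζ : Continuous ζ₀)
    (t₀ : ℝ) : HasDerivAt (fun t => toL2 (u t)) (velocity ω ζ₀ u t₀) t₀ := by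
  have hvc : Continuous (velocity ω ζ₀ u) := by
    have hc0 : Continuous fun t => Complex.I * ζ₀ t * ω := by fun_prop
    have h1 : Continuous fun t => Complex.I • toL2 (iteratedDeriv 2 (u t)) :=
      hu.continuous_toL2_iteratedDeriv.const_smul Complex.I
    exact h1.add (hc0.smul hu.continuous_toL2_cubic)
  set r : ℝ → ℝ → ℂ := fun t x =>
    Complex.I * iteratedDeriv 2 (u t) x + Complex.I * ζ₀ t * ω * cubic u t x with hr
  have hrc : Continuous (Function.uncurry r) := by
    have h1 := hu.continuous_uncurry_iteratedDeriv
    have h2 := hu.continuous_uncurry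
    have h3 : Continuous fun p : ℝ × ℝ => cubic u p.1 p.2 :=
      (Complex.continuous_ofReal.comp (h2.norm.pow 2)).mul h2
    have h4 : Continuous fun p : ℝ × ℝ => Complex.I * ζ₀ p.1 * ω := by fun_prop
    exact (continuous_const.mul h1).add (h4.mul h3)
  have hvr : ∀ t, (velocity ω ζ₀ u t : ℝ → ℂ) =ᵐ[volume] r t := by
    intro t
    filter_upwards [Lp.coeFn_add (Complex.I • toL2 (iteratedDeriv 2 (u t)))
      ((Complex.I * ζ₀ t * ω) • toL2 (cubic u t)), Lp.coeFn_smul Complex.I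
      (toL2 (iteratedDeriv 2 (u t))), Lp.coeFn_smul (Complex.I * ζ₀ t * ω) (toL2 (cubic u t)),
      toL2_ae (hu.smooth t).memLp_iteratedDeriv, toL2_ae (hu.memLp_cubic t)] with x h1 h2 h3 h4 h5
    rw [velocity, h1, Pi.add_apply, h2, h3, Pi.smul_apply, Pi.smul_apply, h4, h5, smul_eq_mul,
      smul_eq_mul]
  have hint : ∀ t, t₀ - 1 ≤ t → toL2 (u t) = toL2 (u (t₀ - 1))
      + ∫ τ in (t₀ - 1)..t, velocity ω ζ₀ u τ := by
    intro t ht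
    rw [← sub_eq_iff_eq_add', intervalIntegral.integral_of_le ht,
      ← toL2_sub (hu.memLp t) (hu.memLp _)]
    have hI := (integral_L2_ae (μ := volume.restrict (Set.Ioc (t₀ - 1) t))
      ((hvc.intervalIntegrable _ _).1) hrc.measurable hvr).2
    refine Lp.ext ?_
    filter_upwards [hI, toL2_ae ((hu.memLp t).sub (hu.memLp (t₀ - 1)))] with x hx hx'
    rw [hx]
    refine Eq.trans hx' ?_
    rw [← intervalIntegral.integral_of_le ht, intervalIntegral.integral_eq_sub_of_hasDerivAt
      (fun τ _ => hu.deriv_time τ x)]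
    · rfl
    · exact (hrc.comp (f := fun τ => (τ, x)) (by fun_prop)).intervalIntegrable _ _
  have hd := ((intervalIntegral.integral_hasDerivAt_right (hvc.intervalIntegrable (t₀ - 1) t₀)
    (hvc.stronglyMeasurableAtFilter _ _) hvc.continuousAt).const_add (toL2 (u (t₀ - 1))))
  refine hd.congr_of_eventuallyEq ?_
  filter_upwards [lt_mem_nhds (by linarith : t₀ - 1 < t₀)] with t ht
  exact hint t ht.le

end Solution

theorem norm_lapSymb_le_of_mem {N y : ℝ} (hy : y ∈ freqSet N) : ‖lapSymb y‖ ≤ N ^ 2 := by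
  rw [norm_lapSymb, ← sq_abs]
  have : |2 * Real.pi * y| ≤ N := hy
  gcongr

theorem measurable_waveSymb_mul_lapSymb (N t : ℝ) :
    Measurable fun y => waveSymb (freqSet N) t 0 y * (-(Complex.I * lapSymb y)) :=
  (waveSymb_measurable (measurableSet_freqSet N) _ _).mul
    (continuous_const.mul continuous_lapSymb).neg.measurable

theorem memLp_waveSymb_mul_lapSymb (N t : ℝ) :
    MemLp (fun y => waveSymb (freqSet N) t 0 y * (-(Complex.I * lapSymb y))) ∞ volume := by
  refine memLp_top_of_bound (measurable_waveSymb_mul_lapSymb N t).aestronglyMeasurable (N ^ 2)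
    (.of_forall fun y => ?_)
  by_cases hy : y ∈ freqSet N
  · rw [norm_mul, norm_neg, norm_mul, Complex.norm_I, one_mul]
    exact (mul_le_of_le_one_left (norm_nonneg _) (waveSymb_norm_le _ _ _ _)).trans
      (norm_lapSymb_le_of_mem hy)
  · simp [waveSymb, hy]; positivity

/-- On bounded frequencies the free evolution is differentiable in the operator norm. -/
theorem hasDerivAt_waveOp (N t₀ : ℝ) :
    HasDerivAt (fun t => waveOp (freqSet N) (-t) 0)
      (mulOp fun y => waveSymb (freqSet N) (-t₀) 0 y * (-(Complex.I * lapSymb y))) t₀ := by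
  have hJ := measurableSet_freqSet N
  rw [hasDerivAt_iff_tendsto]
  have hsymb : ∀ y ∈ freqSet N, ‖lapSymb y‖ ≤ N ^ 2 := fun y hy => norm_lapSymb_le_of_mem hy
  have hm' := measurable_waveSymb_mul_lapSymb N (-t₀)
  have hml' := memLp_waveSymb_mul_lapSymb N (-t₀)
  have key : ∀ t, |t - t₀| * N ^ 2 ≤ 1 → ‖waveOp (freqSet N) (-t) 0 - waveOp (freqSet N) (-t₀) 0
      - (t - t₀) • mulOp fun y => waveSymb (freqSet N) (-t₀) 0 y * (-(Complex.I * lapSymb y))‖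
      ≤ (|t - t₀| * N ^ 2) ^ 2 := by
    intro t ht
    set c : ℂ := ((t - t₀ : ℝ) : ℂ) with hc
    have hml1 := (waveSymb_memLp_top hJ (-t) 0)
    have hml0 := (waveSymb_memLp_top hJ (-t₀) 0)
    have e1 : waveOp (freqSet N) (-t) 0 - waveOp (freqSet N) (-t₀) 0
      - (t - t₀) • (mulOp fun y => waveSymb (freqSet N) (-t₀) 0 y * (-(Complex.I * lapSymb y)))
      = mulOp fun y => (waveSymb (freqSet N) (-t) 0 y - waveSymb (freqSet N) (-t₀) 0 y)
        - c * (waveSymb (freqSet N) (-t₀) 0 y * (-(Complex.I * lapSymb y))) := by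
      have e2 : mulOp (fun y => waveSymb (freqSet N) (-t) 0 y - waveSymb (freqSet N) (-t₀) 0 y)
        = waveOp (freqSet N) (-t) 0 - waveOp (freqSet N) (-t₀) 0 := mulOp_sub hml1 hml0
      have e3 := mulOp_sub (m := fun y => waveSymb (freqSet N) (-t) 0 y
        - waveSymb (freqSet N) (-t₀) 0 y) (hml1.sub hml0) (hml'.const_mul c)
      rw [e3, e2, mulOp_const_mul hml' c]
      rfl
    rw [e1]
    have hm : Measurable fun y => (waveSymb (freqSet N) (-t) 0 y - waveSymb (freqSet N) (-t₀) 0 y)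
        - c * (waveSymb (freqSet N) (-t₀) 0 y * (-(Complex.I * lapSymb y))) :=
      ((waveSymb_measurable hJ _ _).sub (waveSymb_measurable hJ _ _)).sub (hm'.const_mul c)
    refine mulOp_norm_le hm (by positivity) fun y => ?_
    by_cases hy : y ∈ freqSet N
    · set z : ℂ := -(c * (Complex.I * lapSymb y)) with hz
      have hzn : ‖z‖ ≤ |t - t₀| * N ^ 2 := by
        rw [hz, norm_neg, norm_mul, norm_mul, Complex.norm_I, one_mul, hc, Complex.norm_real,
          Real.norm_eq_abs]
        gcongr
        exact hsymb y hy
      have e2 : waveSymb (freqSet N) (-t) 0 y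
          = waveSymb (freqSet N) (-t₀) 0 y * Complex.exp z := by
        simp only [waveSymb, hy, Set.indicator_of_mem]
        rw [← Complex.exp_add]
        congr 1
        simp only [hz, hc, wavePhase, lapSymb]
        push_cast; ring
      have e3 : (waveSymb (freqSet N) (-t) 0 y - waveSymb (freqSet N) (-t₀) 0 y)
        - c * (waveSymb (freqSet N) (-t₀) 0 y * (-(Complex.I * lapSymb y)))
        = waveSymb (freqSet N) (-t₀) 0 y * (Complex.exp z - 1 - z) := by rw [e2, hz]; ring
      rw [e3, norm_mul]
      refine (mul_le_of_le_one_left (norm_nonneg _) (waveSymb_norm_le _ _ _ _)).trans ?_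
      refine (Complex.norm_exp_sub_one_sub_id_le (hzn.trans ht)).trans ?_
      gcongr
    · simp [waveSymb, hy]; positivity
  have hlim : Tendsto (fun t => |t - t₀| * (N ^ 2) ^ 2) (𝓝 t₀) (𝓝 0) := by
    have hc : Continuous fun t : ℝ => |t - t₀| * (N ^ 2) ^ 2 := by fun_prop
    simpa using hc.tendsto t₀
  have hsmall : ∀ᶠ t in 𝓝 t₀, |t - t₀| * N ^ 2 ≤ 1 := by
    have hc : Continuous fun t : ℝ => |t - t₀| * N ^ 2 := by fun_prop
    have := (hc.tendsto t₀).eventually_lt_const (u := 1) (by simp)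
    exact this.mono fun t ht => ht.le
  refine tendsto_of_tendsto_of_tendsto_of_le_of_le' tendsto_const_nhds hlim
    (.of_forall fun _ => by positivity) ?_
  filter_upwards [hsmall] with t ht
  rw [Real.norm_eq_abs]
  by_cases h0 : |t - t₀| = 0
  · simp [h0]
  · calc _ ≤ |t - t₀|⁻¹ * (|t - t₀| * N ^ 2) ^ 2 := by gcongr; exact key t ht
      _ = _ := by field_simp

section Profile

variable {ω : ℝ} {ζ₀ : ℝ → ℝ} {u₀ : ℝ → ℂ} {u : ℝ → ℝ → ℂ}

/-- The equation in the interaction picture. -/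
theorem IsSmoothSolution.hasDerivAt_profile (hu : IsSmoothSolution ω ζ₀ u₀ u) (hζ : Continuous ζ₀)
    (N t : ℝ) :
    HasDerivAt (profile N fun t => 𝓕 (toL2 (u t)))
      ((Complex.I * ζ₀ t * ω) • force N t (cubic u t)) t := by
  have hJ := measurableSet_freqSet N
  have h1 : HasDerivAt (fun t => (𝓕 (toL2 (u t)) : L2)) (𝓕 (velocity ω ζ₀ u t)) t := by
    have h := hu.hasDerivAt_toL2 hζ t
    exact ((
      (Lp.fourierTransformₗᵢ ℝ ℂ).toContinuousLinearEquiv.toContinuousLinearMap.restrictScalars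
        ℝ).hasFDerivAt).comp_hasDerivAt t h
  have h2 : HasDerivAt (fun t => (waveOp (freqSet N) (-t) 0).restrictScalars ℝ)
      ((mulOp fun y => waveSymb (freqSet N) (-t) 0 y *
        (-(Complex.I * lapSymb y))).restrictScalars ℝ) t :=
    (ContinuousLinearMap.restrictScalarsL ℂ L2 L2 ℝ ℝ).hasFDerivAt.comp_hasDerivAt t
      (hasDerivAt_waveOp N t)
  have h3 := h2.clm_apply h1
  refine h3.congr_deriv ?_
  have h4 : (𝓕 (velocity ω ζ₀ u t) : L2) = Complex.I • toL2 (fun y => lapSymb y *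
      (𝓕 (toL2 (u t)) : L2) y) + (Complex.I * ζ₀ t * ω) • 𝓕 (toL2 (cubic u t)) := by
    rw [← (hu.smooth t).fourier_iteratedDeriv, velocity]
    exact ((Lp.fourierTransformₗᵢ ℝ ℂ).map_add _ _).trans
      (congrArg₂ _ ((Lp.fourierTransformₗᵢ ℝ ℂ).map_smul _ _)
        ((Lp.fourierTransformₗᵢ ℝ ℂ).map_smul _ _))
  have h5 : mulOp (fun y => waveSymb (freqSet N) (-t) 0 y * (-(Complex.I * lapSymb y)))
      (𝓕 (toL2 (u t))) + Complex.I • waveOp (freqSet N) (-t) 0 (toL2 fun y => lapSymb y *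
      (𝓕 (toL2 (u t)) : L2) y) = 0 := by
    refine Lp.ext ?_
    filter_upwards [mulOp_ae (memLp_waveSymb_mul_lapSymb N (-t)) (𝓕 (toL2 (u t)) : L2),
      waveOp_ae hJ (-t) 0 (toL2 fun y => lapSymb y * (𝓕 (toL2 (u t)) : L2) y),
      toL2_ae (hu.smooth t).memLp_sq, Lp.coeFn_add (mulOp (fun y => waveSymb (freqSet N) (-t) 0 y *
      (-(Complex.I * lapSymb y))) (𝓕 (toL2 (u t)))) (Complex.I • waveOp (freqSet N) (-t) 0
      (toL2 fun y => lapSymb y * (𝓕 (toL2 (u t)) : L2) y)), Lp.coeFn_smul Complex.I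
      (waveOp (freqSet N) (-t) 0 (toL2 fun y => lapSymb y * (𝓕 (toL2 (u t)) : L2) y)),
      Lp.coeFn_zero ℂ 2 (volume : Measure ℝ)] with y e1 e2 e3 e4 e5 e6
    rw [e4, Pi.add_apply, e5, Pi.smul_apply, e1, e2, e3, e6, smul_eq_mul, Pi.zero_apply]
    ring
  rw [ContinuousLinearMap.coe_restrictScalars', ContinuousLinearMap.coe_restrictScalars', h4,
    map_add, map_smul, map_smul, ← add_assoc, h5, zero_add]
  rfl

end Profile

/-! ### Approximation by the nonlinearity of band-limited functions -/

theorem enorm_freeSol_le (J : Set ℝ) (a : L2) (t x : ℝ) : ‖freeSol J a t x‖ₑ ≤ ∫⁻ y, ‖a y‖ₑ := by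
  refine (enorm_integral_le_lintegral_enorm _).trans (lintegral_mono fun y => ?_)
  rw [enorm_mul]
  refine mul_le_of_le_one_left zero_le ?_
  rw [← ofReal_norm, ← ENNReal.ofReal_one]
  exact ENNReal.ofReal_le_ofReal (waveSymb_norm_le _ _ _ _)

theorem tendsto_waveOp_freqSet (a : L2) {M : ℕ → ℝ} (hM : Tendsto M atTop atTop) :
    Tendsto (fun k => waveOp (freqSet (M k)) 0 0 a) atTop (𝓝 a) := by
  have hlim : Tendsto (fun k => ∫⁻ y, ‖waveSymb (freqSet (M k)) 0 0 y * a y - a y‖ₑ ^ 2) atTop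
      (𝓝 (∫⁻ _ : ℝ, 0)) := by
    have ham : Measurable (a : ℝ → ℂ) := (Lp.stronglyMeasurable a).measurable
    refine tendsto_lintegral_of_dominated_convergence (fun y => ‖a y‖ₑ ^ 2) (fun k => ?_)
      (fun k => .of_forall fun y => ?_) ?_ (.of_forall fun y => ?_)
    · exact
        ((((waveSymb_measurable (measurableSet_freqSet _) 0 0).mul ham).sub ham).enorm).pow_const 2
    · dsimp only
      gcongr
      by_cases hy : y ∈ freqSet (M k) <;> simp [waveSymb, wavePhase, hy]
    · rw [L2_lintegral_sq]; finiteness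
    · refine tendsto_const_nhds.congr' ?_
      filter_upwards [hM.eventually_ge_atTop |2 * Real.pi * y|] with k hk
      have hy : y ∈ freqSet (M k) := hk
      simp [waveSymb, wavePhase, hy]
  have h2 : Tendsto (fun k => ‖waveOp (freqSet (M k)) 0 0 a - a‖ₑ ^ 2) atTop (𝓝 0) := by
    rw [lintegral_zero] at hlim
    refine hlim.congr fun k => ?_
    rw [← L2_lintegral_sq]
    refine lintegral_congr_ae ?_
    filter_upwards [waveOp_ae (measurableSet_freqSet (M k)) 0 0 a,
      Lp.coeFn_sub (waveOp (freqSet (M k)) 0 0 a) a] with y h1 h2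
    rw [h2, Pi.sub_apply, h1]
  have h3 := ((ENNReal.continuous_rpow_const (y := 1 / 2)).tendsto (0 : ℝ≥0∞)).comp h2
  refine tendsto_iff_edist_tendsto_0.2 ?_
  simp only [edist_eq_enorm_sub]
  refine Tendsto.congr (fun t => ?_) (by simpa using h3)
  simp only [Function.comp]
  rw [← ENNReal.rpow_natCast, ← ENNReal.rpow_mul]
  norm_num

theorem norm_mul_star_mul_sub_le {a b : ℂ} {A : ℝ} (ha : ‖a‖ ≤ A) (hb : ‖b‖ ≤ A) :
    ‖a * star a * a - b * star b * b‖ ≤ 3 * A ^ 2 * ‖a - b‖ := by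
  have hA : 0 ≤ A := (norm_nonneg _).trans ha
  have e : a * star a * a - b * star b * b
      = star a * a * (a - b) + b * a * star (a - b) + b * star b * (a - b) := by
    rw [star_sub]; ring
  rw [e]
  refine (norm_add₃_le).trans ?_
  simp only [norm_mul, norm_star]
  calc _ ≤ A * A * ‖a - b‖ + A * A * ‖a - b‖ + A * A * ‖a - b‖ := by gcongr
    _ = _ := by ring

theorem cubic_eq (u : ℝ → ℝ → ℂ) (t x : ℝ) : cubic u t x = u t x * star (u t x) * u t x := by
  rw [cubic]
  congr 1
  have h := Complex.mul_conj (u t x)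
  rw [Complex.normSq_eq_norm_sq] at h
  exact h.symm

section Solution

variable {ω : ℝ} {ζ₀ : ℝ → ℝ} {u₀ : ℝ → ℂ} {u : ℝ → ℝ → ℂ}

theorem memLp_triple_freqSet (M : ℝ) (a : L2) :
    MemLp (triple (freqSet M) (freqSet M) (freqSet M) a) 2 volume :=
  memLp_triple (measurableSet_freqSet M) (measurableSet_freqSet _) (measurableSet_freqSet _)
    (fun _ => abs_le_of_mem_freqSet) (fun _ => abs_le_of_mem_freqSet)
    (fun _ => abs_le_of_mem_freqSet) a

/-- The nonlinearity is the limit of the nonlinearities of the low frequencies of `u`, which are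
bounded uniformly and converge in `L²`. -/
theorem IsSmoothSolution.tendsto_lowCubic (hu : IsSmoothSolution ω ζ₀ u₀ u) (N t : ℝ) {M : ℕ → ℝ}
    (hM : Tendsto M atTop atTop) :
    Tendsto (fun k => lowCubic N (M k) (fun t => 𝓕 (toL2 (u t))) t) atTop
      (𝓝 (force N t (cubic u t))) := by
  obtain ⟨C, hC0, hC⟩ := exists_sup_le_sobolevNorm
  set A : ℝ := (ENNReal.ofReal C * sobolevNorm 10 (u t)).toReal with hA
  have hfin : ENNReal.ofReal C * sobolevNorm 10 (u t) ≠ ∞ :=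
    ENNReal.mul_ne_top ENNReal.ofReal_ne_top (hu.sobolevNorm_lt_top t).ne
  have hle : ∀ {z : ℂ}, ‖z‖ₑ ≤ ENNReal.ofReal C * sobolevNorm 10 (u t) → ‖z‖ ≤ A := fun h => by
    rw [← toReal_enorm]; exact ENNReal.toReal_mono hfin h
  set v : ℕ → ℝ → ℂ := fun k => freeSol (freqSet (M k)) (𝓕 (toL2 (u t))) 0 with hv
  have hvm : ∀ k, MemLp (v k) 2 volume := fun k =>
    memLp_freeSol (measurableSet_freqSet _) (fun _ => abs_le_of_mem_freqSet) _ _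
  have hvA : ∀ k x, ‖v k x‖ ≤ A := fun k x =>
    hle ((enorm_freeSol_le _ _ _ _).trans (hC _ (hu.smooth t) x).2.2)
  have huA : ∀ x, ‖u t x‖ ≤ A := fun x => hle (hC _ (hu.smooth t) x).1
  have hconv : Tendsto (fun k => toL2 (v k)) atTop (𝓝 (toL2 (u t))) := by
    have h1 := ((Lp.fourierTransformₗᵢ ℝ ℂ).symm.continuous.tendsto _).comp
      (tendsto_waveOp_freqSet (𝓕 (toL2 (u t)) : L2) hM)
    have h2 : (Lp.fourierTransformₗᵢ ℝ ℂ).symm (𝓕 (toL2 (u t)) : L2) = toL2 (u t) :=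
      (Lp.fourierTransformₗᵢ ℝ ℂ).symm_apply_apply (toL2 (u t))
    rw [h2] at h1
    refine h1.congr fun k => ?_
    exact (toL2_freeSol (measurableSet_freqSet _) (fun _ => abs_le_of_mem_freqSet) _ _).symm
  have hlim : Tendsto (fun k => (3 * A ^ 2) * ‖toL2 (v k) - toL2 (u t)‖) atTop (𝓝 0) := by
    have := (tendsto_iff_norm_sub_tendsto_zero.1 hconv).const_mul (3 * A ^ 2)
    simpa using this
  refine tendsto_iff_norm_sub_tendsto_zero.2 (squeeze_zero (fun _ => norm_nonneg _)
    (fun k => ?_) hlim)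
  have hmt := memLp_triple_freqSet (M k) (𝓕 (toL2 (u t)))
  have hsq : ‖lowCubic N (M k) (fun t => 𝓕 (toL2 (u t))) t - force N t (cubic u t)‖ₑ ^ 2
      ≤ (ENNReal.ofReal (3 * A ^ 2) * ‖toL2 (v k) - toL2 (u t)‖ₑ) ^ 2 := by
    rw [lowCubic, force_sub hmt (hu.memLp_cubic t)]
    refine (enorm_force_sq_le_toL2 N t (hmt.sub (hu.memLp_cubic t))).trans ?_
    have e : ‖toL2 (fun x => v k x - u t x)‖ₑ ^ 2 = ∫⁻ x, ‖v k x - u t x‖ₑ ^ 2 :=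
      enorm_toL2_sq ((hvm k).sub (hu.memLp t))
    rw [mul_pow, ← toL2_sub (hvm k) (hu.memLp t), e, ← lintegral_const_mul' _ _ (by finiteness)]
    refine lintegral_mono fun x => ?_
    rw [← mul_pow]
    gcongr
    rw [Pi.sub_apply, ← ofReal_norm, ← ofReal_norm, ← ENNReal.ofReal_mul (by positivity), cubic_eq]
    exact ENNReal.ofReal_le_ofReal (norm_mul_star_mul_sub_le (hvA k x) (huA x))
  rw [ENNReal.pow_le_pow_left_iff two_ne_zero, ← ofReal_norm, ← ofReal_norm,
    ← ENNReal.ofReal_mul (by positivity)] at hsq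
  exact (ENNReal.ofReal_le_ofReal_iff (by positivity)).1 hsq

/-- The bound is uniform in the truncation `M`; it provides the domination for the passage to the
limit in the time Fourier transform. -/
theorem IsSmoothSolution.exists_lowCubic_le (hu : IsSmoothSolution ω ζ₀ u₀ u) {K : Set ℝ}
    (hK : IsCompact K) :
    ∃ B : ℝ, ∀ N M : ℝ, ∀ t ∈ K, ‖lowCubic N M (fun t => 𝓕 (toL2 (u t))) t‖ ≤ B := by
  obtain ⟨C, hC0, hC⟩ := exists_sup_le_sobolevNorm
  obtain ⟨D, hD0, hD⟩ := hu.exists_sobolevNorm_le hK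
  refine ⟨(C * D) ^ 2 * D, fun N M t ht => ?_⟩
  have hs := hD t ht
  have hvA : ∀ x, ‖freeSol (freqSet M) (𝓕 (toL2 (u t))) 0 x‖ₑ
      ≤ ENNReal.ofReal (C * D) := fun x => by
    rw [ENNReal.ofReal_mul hC0]
    exact ((enorm_freeSol_le _ _ _ _).trans (hC _ (hu.smooth t) x).2.2).trans (by gcongr)
  have hsq : ‖lowCubic N M (fun t => 𝓕 (toL2 (u t))) t‖ₑ ^ 2
      ≤ (ENNReal.ofReal (C * D) ^ 2 * ENNReal.ofReal D) ^ 2 := by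
    refine (enorm_force_sq_le_toL2 N t (memLp_triple_freqSet M _)).trans ?_
    calc _ ≤ ∫⁻ x, (ENNReal.ofReal (C * D) ^ 2) ^ 2 *
          ‖freeSol (freqSet M) (𝓕 (toL2 (u t))) 0 x‖ₑ ^ 2 := by
          refine lintegral_mono fun x => ?_
          rw [← mul_pow, enorm_triple, pow_two (ENNReal.ofReal (C * D))]
          gcongr
          · exact hvA x
          · exact hvA x
      _ = (ENNReal.ofReal (C * D) ^ 2) ^ 2 * ‖waveOp (freqSet M) 0 0 (𝓕 (toL2 (u t)))‖ₑ ^ 2 := by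
          rw [lintegral_const_mul' _ _ (by finiteness), lintegral_freeSol_sq
            (measurableSet_freqSet M) (fun _ => abs_le_of_mem_freqSet)]
      _ ≤ _ := by
          rw [mul_pow]
          gcongr
          refine le_trans ?_ ((enorm_toL2_le_sobolevNorm (u t)).trans hs)
          rw [← enorm_fourier_toL2, ← ofReal_norm, ← ofReal_norm]
          exact ENNReal.ofReal_le_ofReal (norm_waveOp_le (measurableSet_freqSet M) _ _ _)
  rw [ENNReal.pow_le_pow_left_iff two_ne_zero, ← ofReal_norm, ← ENNReal.ofReal_pow (by positivity),
    ← ENNReal.ofReal_mul (by positivity)] at hsq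
  exact (ENNReal.ofReal_le_ofReal_iff (by positivity)).1 hsq

end Solution

/-! ### The a priori estimate -/

/-- This is `⟨r⟩^{2b} = ⟨r⟩^{2b-2} + r² ⟨r⟩^{2b-2}`, with the first term bounded by one. -/
theorem bracket_rpow_le (b r : ℝ) (hb1 : b < 1) :
    bracket r ^ (2 * b) ≤ 1 + r ^ 2 * bracket r ^ (2 * b - 2) := by
  have hp := bracket_pos r
  have h1 : bracket r ^ (2 * b) = bracket r ^ 2 * bracket r ^ (2 * b - 2) := by
    rw [← Real.rpow_natCast (bracket r) 2, ← Real.rpow_add hp]; congr 1; push_cast; ring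
  have h2 : bracket r ^ 2 = 1 + r ^ 2 := Real.sq_sqrt (by positivity)
  have h3 : bracket r ^ (2 * b - 2) ≤ 1 :=
    Real.rpow_le_one_of_one_le_of_nonpos (one_le_bracket r) (by linarith)
  rw [h1, h2, add_mul, one_mul]
  gcongr

theorem lintegral_cutoff_sq {η : ℝ → ℂ} {δ : ℝ} (hδ : 0 < δ) (t₀ : ℝ) :
    ∫⁻ t, ‖η (t / δ - t₀)‖ₑ ^ 2 = ENNReal.ofReal δ * ∫⁻ t, ‖η t‖ₑ ^ 2 := by
  rw [lintegral_comp_div (fun r => ‖η (r - t₀)‖ₑ ^ 2) hδ,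
    lintegral_sub_right_eq_self (fun r => ‖η r‖ₑ ^ 2)]

/-- Plancherel's theorem for a bounded curve, localized to times of size `δ`. -/
theorem lintegral_fourier_cutoff_le {η : ℝ → ℂ} (hη : Continuous η) (hηc : HasCompactSupport η)
    {δ : ℝ} (hδ : 0 < δ) (t₀ : ℝ) {p : ℝ → L2} (hp : Continuous p) {S : ℝ≥0∞}
    (hS : ∀ t, ‖p t‖ₑ ^ 2 ≤ S) :
    ∫⁻ σ, ‖𝓕 (fun t => η (t / δ - t₀) • p t) σ‖ₑ ^ 2
      ≤ ENNReal.ofReal δ * (∫⁻ t, ‖η t‖ₑ ^ 2) * S := by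
  have hc : Continuous fun t => η (t / δ - t₀) := hη.comp (by fun_prop)
  have hi : Integrable fun t => η (t / δ - t₀) • p t :=
    (hc.smul hp).integrable_of_hasCompactSupport (hasCompactSupport_cutoff hηc hδ t₀).smul_right
  refine (lintegral_fourier_sq_le hi).trans ?_
  rw [← lintegral_cutoff_sq hδ t₀, ← lintegral_mul_const _ (hc.enorm.measurable.pow_const 2)]
  refine lintegral_mono fun t => ?_
  rw [enorm_smul, mul_pow]
  gcongr
  exact hS t

/-- The Fourier transform of a derivative, for a real normed structure which is compatible with the
complex one but need not be its restriction by definition. -/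
theorem fourier_eq_of_hasDerivAt {E : Type*} [NormedAddCommGroup E] [NormedSpace ℂ E]
    [inst : NormedSpace ℝ E] [IsScalarTower ℝ ℂ E] {f f' : ℝ → E} (hf : Integrable f)
    (hd : ∀ t, HasDerivAt f (f' t) t) (hf' : Integrable f') (σ : ℝ) :
    𝓕 f' σ = (2 * Real.pi * Complex.I * σ : ℂ) • 𝓕 f σ := by
  obtain rfl : inst = NormedSpace.complexToReal := by
    refine NormedSpace.ext (funext fun r => funext fun x => ?_)
    exact (algebraMap_smul ℂ r x).symm
  have e : deriv f = f' := funext fun t => (hd t).deriv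
  have h := congrFun (Real.fourier_deriv hf (fun t => (hd t).differentiableAt) (e ▸ hf')) σ
  rwa [e] at h

theorem fourier_smul_add {E : Type*} [NormedAddCommGroup E] [NormedSpace ℂ E] {f g : ℝ → E}
    (hf : Integrable f) (hg : Integrable g) (c : ℂ) (σ : ℝ) :
    𝓕 (fun t => c • f t + g t) σ = c • 𝓕 f σ + 𝓕 g σ := by
  have e1 := (Real.fourierIntegral_convergent_iff (μ := volume) (f := f) σ).2 hf
  have e2 := (Real.fourierIntegral_convergent_iff (μ := volume) (f := g) σ).2 hg
  simp only [Real.fourier_eq, smul_add]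
  have e3 : Integrable (fun v => c • Real.fourierChar (-inner ℝ v σ) • f v) := e1.smul c
  rw [← integral_smul, ← integral_add e3 e2]
  simp only [smul_comm c]

/-- Integration by parts in time trades a power of the modulation for a time derivative: either the
derivative falls on the cutoff function, or it produces the forcing term. -/
theorem lintegral_localSpec_le {η : ℝ → ℂ} (hη : ContDiff ℝ (⊤ : ℕ∞) η)
    (hηc : HasCompactSupport η) {b : ℝ} (hb1 : b < 1) {δ : ℝ} (hδ : 0 < δ) (t₀ N : ℝ)
    {U : ℝ → L2} (hU : Continuous U) {m : ℝ → ℂ} (hm : Continuous m) {H : ℝ → L2}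
    (hH : Continuous H) (hd : ∀ t, HasDerivAt (profile N U) (m t • H t) t) {S : ℝ≥0∞}
    (hS : ∀ t, ‖profile N U t‖ₑ ^ 2 ≤ S) :
    ∫⁻ σ, ENNReal.ofReal (bracket (2 * Real.pi * δ * σ) ^ (2 * b)) *
        ‖localSpec η δ t₀ N U σ‖ₑ ^ 2
      ≤ ENNReal.ofReal δ * (∫⁻ t, ‖η t‖ₑ ^ 2) * S
        + 2 * (ENNReal.ofReal δ * (∫⁻ t, ‖deriv η t‖ₑ ^ 2) * S + ENNReal.ofReal (δ ^ 2) *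
          ∫⁻ σ, dualWeight b δ σ * ‖𝓕 (fun t => (η (t / δ - t₀) * m t) • H t) σ‖ₑ ^ 2) := by
  have hηd : Differentiable ℝ η := hη.differentiable (by simp)
  have hη' : Continuous (deriv η) := hη.continuous_deriv (by simp)
  have hη'c : HasCompactSupport (deriv η) := hηc.deriv
  have hp := continuous_profile N hU
  set p := profile N U with hpdef
  set f := localProfile η δ t₀ N U with hf
  have hfi : Integrable f := integrable_localProfile hη.continuous hηc hδ t₀ N hU
  set f₁ : ℝ → L2 := fun t => deriv η (t / δ - t₀) • p t with hf₁
  set f₂ : ℝ → L2 := fun t => (η (t / δ - t₀) * m t) • H t with hf₂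
  have hc₁ : Continuous fun t => deriv η (t / δ - t₀) := hη'.comp (by fun_prop)
  have hc₂ : Continuous fun t => η (t / δ - t₀) * m t :=
    (hη.continuous.comp (by fun_prop : Continuous fun t : ℝ => t / δ - t₀)).mul hm
  have hi₁ : Integrable f₁ :=
    (hc₁.smul hp).integrable_of_hasCompactSupport (hasCompactSupport_cutoff hη'c hδ t₀).smul_right
  have hi₂ : Integrable f₂ := (hc₂.smul hH).integrable_of_hasCompactSupport
    ((hasCompactSupport_cutoff hηc hδ t₀).mul_right).smul_right
  have hder : ∀ t, HasDerivAt f ((δ⁻¹ : ℂ) • f₁ t + f₂ t) t := by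
    intro t
    have h1 : HasDerivAt (fun t : ℝ => t / δ - t₀) δ⁻¹ t := by
      have := ((hasDerivAt_id t).div_const δ).sub_const t₀
      simpa using this
    have h2 := ((hηd _).hasDerivAt).scomp t h1
    have h3 := h2.smul (hd t)
    refine h3.congr_deriv ?_
    simp only [hf₁, hf₂, Function.comp]
    rw [add_comm, smul_smul, smul_smul]
    congr 2
    rw [Complex.real_smul]; push_cast; rfl
  have hF : ∀ σ : ℝ, (2 * Real.pi * Complex.I * σ : ℂ) • localSpec η δ t₀ N U σ
      = (δ⁻¹ : ℂ) • 𝓕 f₁ σ + 𝓕 f₂ σ := by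
    intro σ
    rw [← fourier_smul_add hi₁ hi₂]
    exact (fourier_eq_of_hasDerivAt hfi hder ((hi₁.smul (δ⁻¹ : ℂ)).add hi₂) σ).symm
  have hpt : ∀ σ, ENNReal.ofReal (bracket (2 * Real.pi * δ * σ) ^ (2 * b)) *
      ‖localSpec η δ t₀ N U σ‖ₑ ^ 2 ≤ ‖localSpec η δ t₀ N U σ‖ₑ ^ 2 + 2 * (‖𝓕 f₁ σ‖ₑ ^ 2 +
        ENNReal.ofReal (δ ^ 2) * (dualWeight b δ σ * ‖𝓕 f₂ σ‖ₑ ^ 2)) := by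
    intro σ
    set q := localSpec η δ t₀ N U σ with hq
    have h1 : ENNReal.ofReal ((2 * Real.pi * δ * σ) ^ 2) * ‖q‖ₑ ^ 2
        ≤ 2 * (‖𝓕 f₁ σ‖ₑ ^ 2 + ENNReal.ofReal (δ ^ 2) * ‖𝓕 f₂ σ‖ₑ ^ 2) := by
      have e1 : (2 * Real.pi * δ * Complex.I * σ : ℂ) • q = 𝓕 f₁ σ + (δ : ℂ) • 𝓕 f₂ σ := by
        have hδ' : (δ : ℂ) ≠ 0 := by exact_mod_cast hδ.ne'
        have := congrArg (fun z => (δ : ℂ) • z) (hF σ)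
        simp only [smul_add, smul_smul] at this
        rw [mul_inv_cancel₀ hδ', one_smul] at this
        rw [← this]
        congr 1; ring
      have e2 : ENNReal.ofReal ((2 * Real.pi * δ * σ) ^ 2) * ‖q‖ₑ ^ 2
          = ‖𝓕 f₁ σ + (δ : ℂ) • 𝓕 f₂ σ‖ₑ ^ 2 := by
        rw [← e1, enorm_smul]
        have : (2 * Real.pi * δ * Complex.I * σ : ℂ)
            = ((2 * Real.pi * δ * σ : ℝ) : ℂ) * Complex.I := by push_cast; ring
        rw [← sq_abs (2 * Real.pi * δ * σ), ← ofReal_norm (2 * Real.pi * δ * Complex.I * σ : ℂ),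
          this, norm_mul, Complex.norm_I, mul_one, Complex.norm_real, Real.norm_eq_abs,
          ENNReal.ofReal_pow (abs_nonneg _), mul_pow]
      rw [e2]
      refine (pow_le_pow_left₀ zero_le (enorm_add_le _ _) 2).trans
        ((add_sq_le_two_mul _ _).trans (le_of_eq ?_))
      rw [enorm_smul, mul_pow, ← ofReal_norm (δ : ℂ), Complex.norm_real, Real.norm_of_nonneg hδ.le,
        ENNReal.ofReal_pow hδ.le]
    calc _ ≤ ENNReal.ofReal (1 + (2 * Real.pi * δ * σ) ^ 2 *
          bracket (2 * Real.pi * δ * σ) ^ (2 * b - 2)) * ‖q‖ₑ ^ 2 := by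
          gcongr; exact bracket_rpow_le b _ hb1
      _ = ‖q‖ₑ ^ 2 + dualWeight b δ σ *
          (ENNReal.ofReal ((2 * Real.pi * δ * σ) ^ 2) * ‖q‖ₑ ^ 2) := by
          have hp := Real.rpow_nonneg (bracket_pos (2 * Real.pi * δ * σ)).le (2 * b - 2)
          rw [ENNReal.ofReal_add zero_le_one (by positivity), ENNReal.ofReal_mul (by positivity),
            ENNReal.ofReal_one, dualWeight]
          ring
      _ ≤ ‖q‖ₑ ^ 2 + dualWeight b δ σ *
          (2 * (‖𝓕 f₁ σ‖ₑ ^ 2 + ENNReal.ofReal (δ ^ 2) * ‖𝓕 f₂ σ‖ₑ ^ 2)) := by gcongr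
      _ = ‖q‖ₑ ^ 2 + 2 * (dualWeight b δ σ * ‖𝓕 f₁ σ‖ₑ ^ 2 +
          ENNReal.ofReal (δ ^ 2) * (dualWeight b δ σ * ‖𝓕 f₂ σ‖ₑ ^ 2)) := by ring
      _ ≤ _ := by
          gcongr
          exact mul_le_of_le_one_left zero_le (dualWeight_le_one hb1 δ σ)
  have hcF : ∀ {g : ℝ → L2}, Integrable g → Measurable fun σ => ‖𝓕 g σ‖ₑ ^ 2 := fun hg =>
    (VectorFourier.fourierIntegral_continuous Real.continuous_fourierChar
      (by exact continuous_inner) hg).enorm.measurable.pow_const 2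
  calc _ ≤ _ := lintegral_mono hpt
    _ = (∫⁻ σ, ‖𝓕 f σ‖ₑ ^ 2) + 2 * ((∫⁻ σ, ‖𝓕 f₁ σ‖ₑ ^ 2) + ENNReal.ofReal (δ ^ 2) *
        ∫⁻ σ, dualWeight b δ σ * ‖𝓕 f₂ σ‖ₑ ^ 2) := by
        have m0 : Measurable fun σ => ‖localSpec η δ t₀ N U σ‖ₑ ^ 2 := hcF hfi
        have m1 : Measurable fun σ => ‖𝓕 f₁ σ‖ₑ ^ 2 := hcF hi₁
        rw [lintegral_add_left m0, lintegral_const_mul' _ _ (by norm_num), lintegral_add_left m1,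
          lintegral_const_mul' _ _ ENNReal.ofReal_ne_top]
        rfl
    _ ≤ _ := by
        gcongr
        · exact lintegral_fourier_cutoff_le hη.continuous hηc hδ t₀ hp hS
        · exact lintegral_fourier_cutoff_le hη' hη'c hδ t₀ hp hS

/-- Low frequencies are bounded by the Sobolev norm of negative order. -/
theorem enorm_profile_sq_le {s N : ℝ} (hs0 : s ≤ 0) (hN : 1 ≤ N) (u : ℝ → ℝ → ℂ) (t : ℝ) :
    ‖profile N (fun t => 𝓕 (toL2 (u t))) t‖ₑ ^ 2
      ≤ ENNReal.ofReal ((2 * N) ^ (-(2 * s))) * sobolevNorm s (u t) ^ 2 := by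
  have hJ := measurableSet_freqSet N
  have hN2 : 0 < 2 * N := by linarith
  rw [profile, ← ofReal_norm, norm_waveOp_eq hJ, ofReal_norm, ← L2_lintegral_sq, sobolevNorm_sq,
    mul_left_comm, ← lintegral_const_mul' _ _ ENNReal.ofReal_ne_top]
  refine le_trans (lintegral_mono_ae ?_) (le_mul_of_one_le_left zero_le ?_)
  · filter_upwards [waveOp_ae hJ 0 0 (𝓕 (toL2 (u t)) : L2)] with y hy
    rw [hy, enorm_mul, mul_pow]
    by_cases h : y ∈ freqSet N
    · rw [← mul_assoc]
      gcongr
      refine le_trans (b := 1) ?_ ?_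
      · rw [← ofReal_norm, ← ENNReal.ofReal_one, ← ENNReal.ofReal_pow (norm_nonneg _)]
        exact ENNReal.ofReal_le_ofReal (pow_le_one₀ (norm_nonneg _) (waveSymb_norm_le _ _ _ _))
      · have hp := bracket_pos (2 * Real.pi * y)
        have h1 : bracket (2 * Real.pi * y) ≤ 2 * N := by
          have h2 : |2 * Real.pi * y| ≤ N := h
          refine Real.sqrt_le_iff.2 ⟨hN2.le, ?_⟩
          rw [← sq_abs]
          nlinarith [abs_nonneg (2 * Real.pi * y)]
        have h3 : (2 * N) ^ (2 * s) ≤ bracket (2 * Real.pi * y) ^ (2 * s) :=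
          Real.rpow_le_rpow_of_nonpos hp h1 (by linarith)
        rw [← ENNReal.ofReal_mul (by positivity), ← ENNReal.ofReal_one]
        refine ENNReal.ofReal_le_ofReal ?_
        calc (1 : ℝ) = (2 * N) ^ (-(2 * s)) * (2 * N) ^ (2 * s) := by
              rw [← Real.rpow_add hN2]; simp
          _ ≤ _ := by gcongr
    · simp [waveSymb, h]
  · rw [← ENNReal.ofReal_one]
    exact ENNReal.ofReal_le_ofReal (by linarith [Real.pi_gt_three])

section Solution

variable {ω : ℝ} {ζ₀ : ℝ → ℝ} {u₀ : ℝ → ℂ} {u : ℝ → ℝ → ℂ}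

/-- Outside `[-2T, 2T]` the equation is free and the profile is constant. -/
theorem IsSmoothSolution.enorm_profile_sq_le (hu : IsSmoothSolution ω ζ₀ u₀ u)
    (hζ : Continuous ζ₀) {T : ℝ} (hT : 0 < T) (hζs : ∀ t, t ∉ Set.Ioo (-2 * T) (2 * T) → ζ₀ t = 0)
    {s N : ℝ} (hs0 : s ≤ 0) (hN : 1 ≤ N) (t : ℝ) :
    ‖profile N (fun t => 𝓕 (toL2 (u t))) t‖ₑ ^ 2
      ≤ ENNReal.ofReal ((2 * N) ^ (-(2 * s))) * c0SobolevNorm T s u ^ 2 := by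
  have hin : ∀ t ∈ Set.Icc (-2 * T) (2 * T), ‖profile N (fun t => 𝓕 (toL2 (u t))) t‖ₑ ^ 2
      ≤ ENNReal.ofReal ((2 * N) ^ (-(2 * s))) * c0SobolevNorm T s u ^ 2 := by
    intro t ht
    refine (NLS.enorm_profile_sq_le hs0 hN u t).trans ?_
    gcongr
    exact le_iSup₂ (f := fun t (_ : t ∈ Set.Icc (-2 * T) (2 * T)) => sobolevNorm s (u t)) t ht
  have hd := fun t => hu.hasDerivAt_profile hζ N t
  have hc : Continuous (profile N fun t => 𝓕 (toL2 (u t))) :=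
    continuous_iff_continuousAt.2 fun t => (hd t).continuousAt
  have hz : ∀ t, t ∉ Set.Ioo (-2 * T) (2 * T) →
      HasDerivAt (profile N fun t => 𝓕 (toL2 (u t))) 0 t := by
    intro t ht
    have := hd t
    rwa [hζs t ht, Complex.ofReal_zero, mul_zero, zero_mul, zero_smul] at this
  rcases lt_or_ge t (-2 * T) with h | h
  · have h1 := constant_of_has_deriv_right_zero (a := t) (b := -2 * T) hc.continuousOn
      (fun x hx => (hz x fun h' => absurd hx.2 (not_lt.2 h'.1.le)).hasDerivWithinAt) (-2 * T)
      ⟨h.le, le_rfl⟩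
    rw [← h1]
    exact hin _ ⟨le_rfl, by linarith⟩
  rcases lt_or_ge (2 * T) t with h' | h'
  · have h1 := constant_of_has_deriv_right_zero (a := 2 * T) (b := t) hc.continuousOn
      (fun x hx => (hz x fun h'' => absurd hx.1 (not_le.2 h''.2)).hasDerivWithinAt) t
      ⟨h'.le, le_rfl⟩
    rw [h1]
    exact hin _ ⟨by linarith, le_rfl⟩
  · exact hin t ⟨h, h'⟩

theorem bourgainNorm_le_yNorm (η : ℝ → ℂ) (s b : ℝ) (u : ℝ → ℝ → ℂ) (t₀ : ℝ) {N : ℝ} (hN : 1 ≤ N) :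
    bourgainNorm 0 b (fun t x => η (t - t₀) *
      scaling (N ^ (2 * s)) (fun t' => lowFreq N (u t')) t x) ≤ yNorm η s b u :=
  (le_iSup (fun _ : 1 ≤ N => bourgainNorm 0 b (fun t x => η (t - t₀) *
      scaling (N ^ (2 * s)) (fun t' => lowFreq N (u t')) t x)) hN).trans
    ((le_iSup (fun N : ℝ => ⨆ _ : 1 ≤ N, bourgainNorm 0 b (fun t x => η (t - t₀) *
      scaling (N ^ (2 * s)) (fun t' => lowFreq N (u t')) t x)) N).trans
    (le_iSup (fun t₀ : ℝ => ⨆ (N : ℝ) (_ : 1 ≤ N), bourgainNorm 0 b (fun t x => η (t - t₀) *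
      scaling (N ^ (2 * s)) (fun t' => lowFreq N (u t')) t x)) t₀))

theorem rpow_two_mul_sq {N : ℝ} (hN : 0 < N) (s : ℝ) : (N ^ (2 * s)) ^ 2 = N ^ (4 * s) := by
  rw [← Real.rpow_natCast, ← Real.rpow_mul hN.le]; congr 1; push_cast; ring

/-- The `Y^{s,b}` norm at the frequency `M` sees times of size `M^{4s}`, so that it yields control
on all intervals of this length. -/
theorem exists_windowBound {η : ℝ → ℂ} (hη : Continuous η) (hηc : HasCompactSupport η)
    (hη0 : η 0 ≠ 0) (s : ℝ) {b : ℝ} (hb : 1 / 2 < b) :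
    ∃ ε > 0, ∃ K > 0, ∀ u : ℝ → ℝ → ℂ, (Continuous fun t => (𝓕 (toL2 (u t)) : L2)) →
      yNorm η s b u ≠ ∞ → WindowBound s ε K (fun t => 𝓕 (toL2 (u t))) (yNorm η s b u ^ 2) := by
  obtain ⟨ε, hε, κ, hκ, h⟩ := exists_controlled hη hηc hη0 hb
  have hpi := Real.pi_pos
  refine ⟨ε, hε, κ / (2 * Real.pi) ^ 2, by positivity, fun u hU hY M hM c => ?_⟩
  have hM0 : 0 < M := by linarith
  set lam := M ^ (2 * s) with hlam
  have hl : 0 < lam := Real.rpow_pos_of_pos hM0 _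
  have hl2 : lam ^ 2 = M ^ (4 * s) := rpow_two_mul_sq hM0 s
  have h1 := bourgainNorm_sq hU hη hηc b (c / lam ^ 2) M hl
  have h2 := bourgainNorm_le_yNorm η s b u (c / lam ^ 2) hM
  have h3 := h (lam ^ 2) (c / lam ^ 2) M (fun t => 𝓕 (toL2 (u t))) (by positivity) hU
    (ENNReal.ofReal (lam / (2 * Real.pi) ^ 2) * yNorm η s b u ^ 2) (by finiteness) (by
      have h4 : ENNReal.ofReal (lam / (2 * Real.pi) ^ 2) * ENNReal.ofReal ((2 * Real.pi) ^ 2 / lam)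
          = 1 := by
        rw [← ENNReal.ofReal_mul (by positivity), ← ENNReal.ofReal_one]
        congr 1; field_simp
      rw [← one_mul (∫⁻ σ, _), ← h4, mul_assoc, ← h1]
      gcongr)
  rw [mul_div_cancel₀ _ (by positivity), hl2, ← mul_assoc, ← ENNReal.ofReal_mul (by positivity)]
    at h3
  convert h3 using 3
  rw [← hl2, Real.rpow_neg hM0.le, ← hlam]
  field_simp

/-- The range of exponents allows to sum the dyadic blocks of the nonlinearity. -/
theorem exponent_pos {s b : ℝ} (hb : 1 / 2 < b) (hb1 : b < 1)
    (hsb : -s < (1 + 4 * b)⁻¹ * min (1 / 10 + 3 / 5 * (1 - b)) (1 / 12 + 2 / 3 * (1 - b))) :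
    0 < 3 - 2 * b + (18 - 8 * b) * s := by
  have hp : 0 < 1 + 4 * b := by linarith
  have h1 : -s * (1 + 4 * b) < 1 / 10 + 3 / 5 * (1 - b) := by
    rw [inv_mul_eq_div, lt_div_iff₀ hp] at hsb
    exact hsb.trans_le (min_le_left _ _)
  have h2 : 0 < (3 - 2 * b + (18 - 8 * b) * s) * (1 + 4 * b) := by
    nlinarith [mul_pos (by linarith : 0 < 18 - 8 * b) (sub_pos.2 h1), mul_pos (sub_pos.2 hb)
      (sub_pos.2 hb1)]
  exact pos_of_mul_pos_left h2 hp.le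

end Solution

/-- The a priori estimate. The cutoff function in the equation only has to be continuous with
support in `(-2T, 2T)`, and its size enters the constant. -/
theorem exists_yNorm_le
    (s b : ℝ) (hs : -(2 / 15) < s) (hs0 : s ≤ 0) (hb : 1 / 2 < b) (hb1 : b < 1)
    (hsb : -s < (1 + 4 * b)⁻¹ *
      min (1 / 10 + 3 / 5 * (1 - b)) (1 / 12 + 2 / 3 * (1 - b)))
    (η : ℝ → ℂ) (hη : ContDiff ℝ (⊤ : ℕ∞) η) (hηc : HasCompactSupport η) (hη0 : η 0 ≠ 0)
    (T : ℝ) (hT : 0 < T) (ζ₀ : ℝ → ℝ) (hζcont : Continuous ζ₀)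
    (hζs : tsupport ζ₀ ⊆ Set.Ioo (-2 * T) (2 * T)) :
    ∃ C : NNReal, ∀ ω : ℝ, (ω = 1 ∨ ω = -1) → ∀ (u₀ : ℝ → ℂ) (u : ℝ → ℝ → ℂ),
      IsSmoothSolution ω ζ₀ u₀ u →
        yNorm η s b u ≤ C * (c0SobolevNorm T s u + yNorm η s b u ^ 3) := by
  have hηcont := hη.continuous
  have hζz : ∀ t, t ∉ Set.Ioo (-2 * T) (2 * T) → ζ₀ t = 0 := fun t ht =>
    image_eq_zero_of_notMem_tsupport fun h => ht (hζs h)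
  have hζc : HasCompactSupport ζ₀ := HasCompactSupport.of_support_subset_isCompact
    (isCompact_Icc (a := -2 * T) (b := 2 * T)) fun t ht =>
      Set.Ioo_subset_Icc_self (hζs (subset_tsupport _ ht))
  obtain ⟨a₁, ha₁⟩ := hηc.exists_bound_of_continuous hηcont
  obtain ⟨a₂, ha₂⟩ := hζc.exists_bound_of_continuous hζcont
  have ha₁0 : 0 ≤ a₁ := (norm_nonneg _).trans (ha₁ 0)
  have ha₂0 : 0 ≤ a₂ := (norm_nonneg _).trans (ha₂ 0)
  obtain ⟨R, hR0, hR⟩ : ∃ R : ℝ, 0 ≤ R ∧ ∀ r, η r ≠ 0 → |r| ≤ R := by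
    obtain ⟨R, hR⟩ := hηc.isCompact.isBounded.exists_norm_le
    exact ⟨max R 0, le_max_right _ _, fun r hr =>
      (hR r (subset_tsupport _ hr)).trans (le_max_left _ _)⟩
  obtain ⟨ε, hε, K, hK, hwin⟩ := exists_windowBound hηcont hηc hη0 s hb
  obtain ⟨C₁, hC₁, hcub⟩ := exists_cubic_bound (a := a₁ * a₂) (by linarith : -(1 / 2) ≤ s) hs0 hb
    hb1 (exponent_pos hb hb1 hsb) hε hK.le hR0 (by positivity)
  have hE : ∀ {g : ℝ → ℂ}, Continuous g → HasCompactSupport g → ∃ E : ℝ, 0 ≤ E ∧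
      ∫⁻ t, ‖g t‖ₑ ^ 2 = ENNReal.ofReal E := by
    intro g hg hgc
    have h := enorm_toL2_sq (hg.memLp_of_hasCompactSupport (p := 2) (μ := volume) hgc)
    exact ⟨‖toL2 g‖ ^ 2, by positivity, by
      rw [← h, ← ofReal_norm, ENNReal.ofReal_pow (norm_nonneg _)]⟩
  obtain ⟨E₀, hE₀, hE₀'⟩ := hE hηcont hηc
  obtain ⟨E₁, hE₁, hE₁'⟩ := hE (hη.continuous_deriv (by simp)) hηc.deriv
  set A : ℝ := (2 * Real.pi) ^ 2 * (2 ^ (-(2 * s)) * (E₀ + 2 * E₁) + 2 * C₁) with hA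
  have hA0 : 0 ≤ A := by positivity
  refine ⟨(Real.sqrt A + 1).toNNReal, fun ω hω u₀ u hu => ?_⟩
  have hCpos : 0 < Real.sqrt A + 1 := by positivity
  set Y := yNorm η s b u with hY
  -- for `Y = ∞` the right-hand side is infinite because the constant is positive
  by_cases hYtop : Y = ∞
  · rw [hYtop]
    refine le_of_le_of_eq le_top (Eq.symm ?_)
    rw [ENNReal.top_pow (by norm_num), add_top, ENNReal.mul_top]
    simp
  set c0 := c0SobolevNorm T s u with hc0
  set U : ℝ → L2 := fun t => 𝓕 (toL2 (u t)) with hUdef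
  have hU : Continuous U := (Lp.fourierTransformₗᵢ ℝ ℂ).continuous.comp hu.continuous_toL2
  have hW := hwin u hU hYtop
  have hω1 : ‖(ω : ℂ)‖ = 1 := by rcases hω with rfl | rfl <;> simp
  have main : ∀ t₀ N : ℝ, 1 ≤ N → bourgainNorm 0 b (fun t x => η (t - t₀) *
      scaling (N ^ (2 * s)) (fun t' => lowFreq N (u t')) t x)
      ≤ ENNReal.ofReal (Real.sqrt A) * (c0 + Y ^ 3) := by
    intro t₀ N hN
    have hN0 : 0 < N := by linarith
    set lam := N ^ (2 * s) with hlam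
    have hl : 0 < lam := Real.rpow_pos_of_pos hN0 _
    have hl2 : lam ^ 2 = N ^ (4 * s) := rpow_two_mul_sq hN0 s
    have hδ : 0 < lam ^ 2 := by positivity
    set m : ℝ → ℂ := fun t => Complex.I * ζ₀ t * ω with hm
    have hmc : Continuous m := by fun_prop
    set H : ℝ → L2 := fun t => force N t (cubic u t) with hH
    have hHc : Continuous H := continuous_force N hu.continuous_toL2_cubic
    have h1 := lintegral_localSpec_le hη hηc hb1 hδ t₀ N hU hmc hHc
      (fun t => hu.hasDerivAt_profile hζcont N t)
      (fun t => hu.enorm_profile_sq_le hζcont hT hζz hs0 hN t)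
    set ψ : ℝ → ℂ := fun t => η (t / lam ^ 2 - t₀) * m t with hψ
    have hψc : HasCompactSupport ψ := (hasCompactSupport_cutoff hηc hδ t₀).mul_right
    obtain ⟨B, hB⟩ := hu.exists_lowCubic_le hψc.isCompact
    have hMk : Tendsto (fun k : ℕ => 8 * 2 ^ k * N) atTop atTop :=
      ((tendsto_pow_atTop_atTop_of_one_lt (by norm_num : (1 : ℝ) < 2)).const_mul_atTop
        (by norm_num : (0 : ℝ) < 8)).atTop_mul_const hN0
    have h2 := hcub N (lam ^ 2 * t₀) B ψ U H (Y ^ 2) hN hU hW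
      ((hηcont.comp (by fun_prop : Continuous fun t : ℝ => t / lam ^ 2 - t₀)).mul hmc) hψc
      (fun t => by
        rw [hψ, norm_mul, hm, norm_mul, norm_mul, Complex.norm_I, one_mul, hω1, mul_one,
          Complex.norm_real]
        exact mul_le_mul (ha₁ _) (ha₂ t) (norm_nonneg _) ha₁0)
      (fun t ht => by
        have h := hR _ (left_ne_zero_of_mul ht)
        rw [← hl2]
        have e : t - lam ^ 2 * t₀ = (t / lam ^ 2 - t₀) * lam ^ 2 := by field_simp
        rw [e, abs_mul, abs_of_pos hδ]
        gcongr)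
      (fun k t ht => hB N _ t (subset_tsupport _ ht))
      (fun t => hu.tendsto_lowCubic N t hMk)
    rw [← hl2] at h2
    have h3 : bourgainNorm 0 b (fun t x => η (t - t₀) *
        scaling lam (fun t' => lowFreq N (u t')) t x) ^ 2
        ≤ ENNReal.ofReal A * (c0 ^ 2 + (Y ^ 2) ^ 3) := by
      rw [bourgainNorm_sq hU hηcont hηc b t₀ N hl]
      refine (mul_le_mul_right (h1.trans (add_le_add_right (mul_le_mul_right (add_le_add_right
        (mul_le_mul_right h2 _) _) _) _)) _).trans ?_
      rw [hE₀', hE₁']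
      have r1 : (2 * Real.pi) ^ 2 / lam * (lam ^ 2 * (E₀ + 2 * E₁) * (2 * N) ^ (-(2 * s))) ≤ A := by
        have e1 : lam * (2 * N) ^ (-(2 * s)) = 2 ^ (-(2 * s)) := by
          rw [Real.mul_rpow (by norm_num) hN0.le, Real.rpow_neg hN0.le, ← hlam]
          field_simp
        calc _ = (2 * Real.pi) ^ 2 * (lam * (2 * N) ^ (-(2 * s)) * (E₀ + 2 * E₁)) := by
              field_simp
          _ ≤ _ := by
              rw [e1, hA]
              gcongr
              linarith
      have r2 : (2 * Real.pi) ^ 2 / lam * (2 * ((lam ^ 2) ^ 2 * (C₁ * N ^ (-(6 * s))))) ≤ A := by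
        -- the scaling `N^{2s}` cancels the growth of the masses of the three factors
        have e1 : lam ^ 3 * N ^ (-(6 * s)) = 1 := by
          rw [hlam, ← Real.rpow_natCast, ← Real.rpow_mul hN0.le, ← Real.rpow_add hN0]
          rw [show 2 * s * (3 : ℕ) + -(6 * s) = 0 by push_cast; ring, Real.rpow_zero]
        calc _ = (2 * Real.pi) ^ 2 * (2 * C₁ * (lam ^ 3 * N ^ (-(6 * s)))) := by
              field_simp
          _ ≤ _ := by
              rw [e1, hA]
              gcongr
              have : 0 ≤ (2 : ℝ) ^ (-(2 * s)) * (E₀ + 2 * E₁) := by positivity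
              linarith
      rw [mul_add (ENNReal.ofReal A)]
      calc _ = ENNReal.ofReal ((2 * Real.pi) ^ 2 / lam * (lam ^ 2 * (E₀ + 2 * E₁) *
            (2 * N) ^ (-(2 * s)))) * c0 ^ 2 + ENNReal.ofReal ((2 * Real.pi) ^ 2 / lam *
            (2 * ((lam ^ 2) ^ 2 * (C₁ * N ^ (-(6 * s)))))) * (Y ^ 2) ^ 3 := by
            rw [ENNReal.ofReal_mul (p := (2 * Real.pi) ^ 2 / lam) (by positivity),
              ENNReal.ofReal_mul (p := (2 * Real.pi) ^ 2 / lam) (by positivity),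
              ENNReal.ofReal_mul (p := lam ^ 2 * (E₀ + 2 * E₁)) (by positivity),
              ENNReal.ofReal_mul (p := lam ^ 2) (by positivity),
              ENNReal.ofReal_add hE₀ (by positivity),
              ENNReal.ofReal_mul (p := 2) (by norm_num),
              ENNReal.ofReal_mul (p := 2) (by norm_num),
              ENNReal.ofReal_mul (p := (lam ^ 2) ^ 2) (by positivity), ENNReal.ofReal_ofNat]
            ring
        _ ≤ _ := by gcongr
    rw [← ENNReal.pow_le_pow_left_iff two_ne_zero]
    refine h3.trans ?_
    rw [mul_pow, ← ENNReal.ofReal_pow (Real.sqrt_nonneg _), Real.sq_sqrt hA0]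
    gcongr
    calc c0 ^ 2 + (Y ^ 2) ^ 3 ≤ c0 ^ 2 + (Y ^ 2) ^ 3 + 2 * c0 * Y ^ 3 := le_self_add
      _ = _ := by ring
  refine iSup_le fun t₀ => iSup_le fun N => iSup_le fun hN => (main t₀ N hN).trans ?_
  gcongr
  exact ENNReal.ofReal_le_ofReal (by linarith)

end

end NLS

theorem proposition8p1
    (s b : ℝ) (hs : -(2 / 15) < s) (hs0 : s ≤ 0) (hb : 1 / 2 < b) (hb1 : b < 1)
    (hsb : -s < (1 + 4 * b)⁻¹ *
      min (1 / 10 + 3 / 5 * (1 - b)) (1 / 12 + 2 / 3 * (1 - b)))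
    -- the cutoff function in the definition of the `Y^{s,b}` norm
    (η : ℝ → ℂ) (hη : ContDiff ℝ (⊤ : ℕ∞) η) (hηc : HasCompactSupport η) (hη0 : η 0 ≠ 0)
    -- the cutoff function in the equation
    (T : ℝ) (hT : 0 < T) (ζ₀ : ℝ → ℝ) (hζ : ContDiff ℝ (⊤ : ℕ∞) ζ₀)
    (hζ1 : ∀ t ∈ Set.Icc 0 T, ζ₀ t = 1) (hζs : tsupport ζ₀ ⊆ Set.Ioo (-2 * T) (2 * T)) :
    ∃ C : NNReal, ∀ (ω : ℝ), (ω = 1 ∨ ω = -1) → ∀ (u₀ : ℝ → ℂ) (u : ℝ → ℝ → ℂ),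
      NLS.IsSmoothSolution ω ζ₀ u₀ u →
        NLS.yNorm η s b u ≤ C * (NLS.c0SobolevNorm T s u + NLS.yNorm η s b u ^ 3) :=
  NLS.exists_yNorm_le s b hs hs0 hb hb1 hsb η hη hηc hη0 T hT ζ₀ hζ.continuous hζs
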